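/- A graph is simple, finite and undirected. The bull is the graph obtained from a triangle by attaching one pendant vertex to each of two of its vertices, and $\mathsf{E}$ is the graph obtained from a path on five vertices by attaching one pendant vertex to its middle vertex. A graph is $(\mathrm{bull},\mathsf{E})$-free if it contains neither of the two as an induced subgraph. For an integer $k\ge 1$, an instance of Max Partial $k$-Coloring is a graph $G$ together with a function $\mathsf{rev}:V(G)\times\{1,\dots,k\}\to\mathbb{Q}_{\ge 0}$, and the task is to find a set $X\subseteq V(G)$ and a proper $k$-coloring $c$ of the induced subgraph $G[X]$ such that $\sum_{v\in X}\mathsf{rev}(v,c(v))$ is as large as possible. Theorem. There is an absolute constant $\tau$ such that for every $k\ge 1$ there is an algorithm that, for every $(\mathrm{bull},\mathsf{E})$-free graph $G$ and every $\mathsf{rev}:V(G)\times\{1,\dots,k\}\to\mathbb{Q}_{\ge 0}$, finds an optimum solution $(X,c)$ of Max Partial $k$-Coloring on $(G,\mathsf{rev})$; if $G$ has $n\ge 2$ vertices and clique number $\omega$, it does so in at most $n^{\tau k\omega\log_2 n}$ steps, and if $n\le 1$, in at most $\tau k$ steps. Here an algorithm is a program (one fixed program for each $k$, which is not given $\omega$)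 for a random access machine with indirect addressing, with a memory for natural numbers and a separate memory for rational numbers. Steps are counted at unit cost: loading and storing, addition, (truncated) subtraction and comparison of natural numbers, and addition, subtraction and comparison of the values of the revenue function take constant time each; multiplication is not a unit-cost operation. The graph is given by $n$ and its adjacency matrix. -/

import Mathlib

/-! ### The machine model: structured random access programs

Memory consists of word cells holding natural numbers and value cells holding rationals. Addresses
are computed words (indirect addressing). Words support addition, truncated subtraction and
comparison; there is deliberately no unit-cost multiplication of words. Values support addition,
subtraction and comparison, each in constant time. -/

namespace RAM

/-- The contents of the memory. -/
structure Memory where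
  /-- The word cells. -/
  word : ℕ → ℕ
  /-- The value cells. -/
  val : ℕ → ℚ

/-- Expressions that evaluate to words. -/
inductive WordExpr where
  | num (a : ℕ)
  | load (addr : WordExpr)
  | add (e f : WordExpr)
  | sub (e f : WordExpr)

/-- Expressions that evaluate to values. -/
inductive ValExpr where
  | zero
  | load (addr : WordExpr)
  | add (e f : ValExpr)
  | sub (e f : ValExpr)

/-- Tests. -/
inductive Test where
  | wordEq (e f : WordExpr)
  | wordLt (e f : WordExpr)
  | valLt (e f : ValExpr)

/-- Programs. -/
inductive Program where
  | skip
  | setWord (addr e : WordExpr)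
  | setVal (addr : WordExpr) (e : ValExpr)
  | seq (p q : Program)
  | ite (b : Test) (p q : Program)
  | loop (b : Test) (p : Program)

/-- The word denoted by an expression. -/
def WordExpr.eval (m : Memory) : WordExpr → ℕ
  | .num a => a
  | .load e => m.word (e.eval m)
  | .add e f => e.eval m + f.eval m
  | .sub e f => e.eval m - f.eval m

/-- The value denoted by an expression. -/
def ValExpr.eval (m : Memory) : ValExpr → ℚ
  | .zero => 0
  | .load e => m.val (e.eval m)
  | .add e f => e.eval m + f.eval m
  | .sub e f => e.eval m - f.eval m

/-- The condition expressed by a test. -/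
def Test.Holds (m : Memory) : Test → Prop
  | .wordEq e f => e.eval m = f.eval m
  | .wordLt e f => e.eval m < f.eval m
  | .valLt e f => e.eval m < f.eval m

/-- The number of steps for evaluating an expression: one for each operation, constant or load. -/
def WordExpr.cost : WordExpr → ℕ
  | .num _ => 1
  | .load e => e.cost + 1
  | .add e f => e.cost + f.cost + 1
  | .sub e f => e.cost + f.cost + 1

/-- The number of steps for evaluating an expression: one for each operation, constant or load. -/
def ValExpr.cost : ValExpr → ℕ
  | .zero => 1
  | .load e => e.cost + 1
  | .add e f => e.cost + f.cost + 1
  | .sub e f => e.cost + f.cost + 1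

/-- The number of steps for performing a test. -/
def Test.cost : Test → ℕ
  | .wordEq e f => e.cost + f.cost + 1
  | .wordLt e f => e.cost + f.cost + 1
  | .valLt e f => e.cost + f.cost + 1

/-- Writing the word `a` into the word cell `i`. -/
def Memory.setWord (m : Memory) (i a : ℕ) : Memory :=
  { m with word := Function.update m.word i a }

/-- Writing the value `a` into the value cell `i`. -/
def Memory.setVal (m : Memory) (i : ℕ) (a : ℚ) : Memory :=
  { m with val := Function.update m.val i a }

/-- `p.Runs m t m'`: the program `p`, started with memory `m`, halts after exactly `t` steps with
memory `m'`. -/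
inductive Program.Runs : Program → Memory → ℕ → Memory → Prop where
  | skip (m : Memory) : Runs .skip m 1 m
  | setWord (m : Memory) (addr e : WordExpr) :
      Runs (.setWord addr e) m (addr.cost + e.cost + 1) (m.setWord (addr.eval m) (e.eval m))
  | setVal (m : Memory) (addr : WordExpr) (e : ValExpr) :
      Runs (.setVal addr e) m (addr.cost + e.cost + 1) (m.setVal (addr.eval m) (e.eval m))
  | seq {p q : Program} {m₁ m₂ m₃ : Memory} {s t : ℕ} :
      Runs p m₁ s m₂ → Runs q m₂ t m₃ → Runs (.seq p q) m₁ (s + t) m₃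
  | iteTrue {b : Test} {p q : Program} {m m' : Memory} {t : ℕ} :
      b.Holds m → Runs p m t m' → Runs (.ite b p q) m (b.cost + t) m'
  | iteFalse {b : Test} {p q : Program} {m m' : Memory} {t : ℕ} :
      ¬ b.Holds m → Runs q m t m' → Runs (.ite b p q) m (b.cost + t) m'
  | loopTrue {b : Test} {p : Program} {m₁ m₂ m₃ : Memory} {s t : ℕ} :
      b.Holds m₁ → Runs p m₁ s m₂ → Runs (.loop b p) m₂ t m₃ →
        Runs (.loop b p) m₁ (b.cost + s + t) m₃
  | loopFalse {b : Test} {p : Program} {m : Memory} :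
      ¬ b.Holds m → Runs (.loop b p) m b.cost m

end RAM

/-! ### The two forbidden induced subgraphs -/

/-- The bull: a triangle `0, 1, 2` with one pendant vertex at `0` and one at `1`. -/
def bullGraph : SimpleGraph (Fin 5) :=
  SimpleGraph.fromEdgeSet {s(0, 1), s(1, 2), s(0, 2), s(0, 3), s(1, 4)}

/-- The graph `E`: a path `0, 1, 2, 3, 4` with one pendant vertex at its middle vertex `2`. -/
def graphE : SimpleGraph (Fin 6) :=
  SimpleGraph.fromEdgeSet {s(0, 1), s(1, 2), s(2, 3), s(3, 4), s(2, 5)}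

/-! ### The problem Max Partial k-Coloring -/

/-- A solution: a set `X` of vertices and a proper `k`-coloring of the subgraph induced by `X`. -/
structure PartialColoring {V : Type*} (G : SimpleGraph V) (k : ℕ) where
  /-- The set of coloured vertices. -/
  X : Finset V
  /-- The proper coloring of the induced subgraph. -/
  coloring : (G.induce {v | v ∈ X}).Coloring (Fin k)

namespace PartialColoring

/-- The total revenue of a solution. -/
def revenue {V : Type*} {G : SimpleGraph V} {k : ℕ} (S : PartialColoring G k)
    (rev : V → Fin k → ℚ≥0) : ℚ≥0 :=
  ∑ v ∈ S.X.attach, rev v.1 (S.coloring ⟨v.1, v.2⟩)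

/-- A solution of maximum possible revenue. -/
def IsOptimal {V : Type*} {G : SimpleGraph V} {k : ℕ} (S : PartialColoring G k)
    (rev : V → Fin k → ℚ≥0) : Prop :=
  ∀ S' : PartialColoring G k, S'.revenue rev ≤ S.revenue rev

open Classical in
/-- The encoding of a solution: `0` if `v` does not belong to `X`, and `i + 1` if `v` belongs to `X`
and has color `i` (the colors being `0, …, k - 1`). -/
noncomputable def code {V : Type*} {G : SimpleGraph V} {k : ℕ} (S : PartialColoring G k)
    (v : V) : ℕ :=
  if h : v ∈ S.X then (S.coloring ⟨v, h⟩ : ℕ) + 1 else 0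

end PartialColoring

open Classical in
/-- The initial memory for an instance with vertices `0, …, n - 1`. Word cell `0` holds `n`, word cell
`1 + (v + n * u)` holds `1` if `u` and `v` are adjacent and `0` otherwise (adjacency matrix), value
cell `i + k * u` holds `rev u i`, and every other cell holds `0`. -/
noncomputable def inputMemory {n k : ℕ} (G : SimpleGraph (Fin n)) (rev : Fin n → Fin k → ℚ≥0) :
    RAM.Memory where
  word
    | 0 => n
    | a + 1 =>
      if h : a < n * n then
        if G.Adj (finProdFinEquiv.symm ⟨a, h⟩).1 (finProdFinEquiv.symm ⟨a, h⟩).2 then 1 else 0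
      else 0
  val a :=
    if h : a < n * k then
      (rev (finProdFinEquiv.symm ⟨a, h⟩).1 (finProdFinEquiv.symm ⟨a, h⟩).2 : ℚ)
    else 0

/-! ## A branching algorithm for Max Partial k-Coloring on (bull, E)-free graphs

A solution is encoded as a set of pairs (vertex, color) without conflicts, where two pairs conflict if
they have the same vertex, or the same color and adjacent vertices. The algorithm maintains a set of
pairs that are still allowed. It branches, and it treats the connected components of the conflict
relation separately.

*Branching.* A move concerns a vertex `v` and a color `e`. Let `I` be the set of vertices of color `e` in
the solution. If `v ∉ I`, then the vertices of `I` outside `N(v)` have the same neighbours in `N(v)` as some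
two of them, `a` and `b` (`exists_pair_dominating`): a minimal set with this property that had three
members would have private neighbours in `N(v)`, pairwise nonadjacent because there is no induced bull, and
these would form an induced `E` with centre `v`. After guessing `a` and `b`, or that `v ∈ I`, the pairs of
color `e` in `N(v)` and those outside `N(v)` do not conflict any more (`separated_move`). There are only `n²`
moves for each `v` and `e`, and once `v` has been treated in all `k` colors, every component lies inside
`N(v)` or avoids it (`reach_of_vertex`).

*Depth.* In a connected graph of this class the closed neighbourhood of some five vertices is a balanced
separator (`exists_balanced_separator`). This is the path argument of Gyárfás: the vertex that extends the
induced path dominates what the vertex before it had contributed to the boundary of the big component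
(`adj_of_far`), so that three fixed vertices and the end of the path suffice. Treating the five vertices
leaves components inside the neighbourhood of a treated vertex, on which the clique number is smaller,
single pairs, and components with at most half of the vertices. Hence a branch has `5 * k * log n` moves,
up to rounding, before the clique number drops, and `O(k * ω * log n)` moves altogether.

*The program does not know which vertices to choose, nor `ω`.* It tries all vertices `v` in each step. The
number of moves is limited by a budget, which restarts only if the current component lies in the
neighbourhood of `v` and `v` occurs in the set at which the budget was last restarted (`Fresh`). Therefore
the clique number bounds the number of restarts. The predicate `Reach` says which solutions are taken into
account. By `reach_root` these are all solutions, and by `solves` the recursion finds a solution at least as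
good as those, in time `(10 * n³) ^ (μ + 1)` up to a polynomial factor, where the measure `μ` combines clique
number and remaining budget.

*The machine.* The recursion is a loop over an explicit stack, written in a small language with variables and
arrays (`Stmt`), for which total correctness with time bounds is derived by the rules for `Run`.
`Exec.runs` translates it to the random access machine with a constant factor in time. Arrays are
interleaved modulo `32`, so that addresses are computed by doublings and no multiplication is needed. -/

/-! ### Forbidden configurations, separators and balanced pieces -/

namespace PartialColoringAlgorithm

section Combinatorics

variable {V : Type*} {H : SimpleGraph V}

/-- No induced bull: triangle `x y z`, pendants `a` at `x` and `b` at `y`. -/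
def BullFree (H : SimpleGraph V) : Prop :=
  ∀ x y z a b, H.Adj x y → H.Adj y z → H.Adj x z → H.Adj x a → H.Adj y b →
    ¬ H.Adj x b → ¬ H.Adj y a → ¬ H.Adj z a → ¬ H.Adj z b → ¬ H.Adj a b → False

/-- No induced `E`: centre `o` with pendant `z` and the two legs `o x a` and `o y b`. -/
def EFree (H : SimpleGraph V) : Prop :=
  ∀ o x a y b z, H.Adj o x → H.Adj x a → H.Adj o y → H.Adj y b → H.Adj o z →
    ¬ H.Adj o a → ¬ H.Adj o b → ¬ H.Adj x y → ¬ H.Adj x b → ¬ H.Adj x z → ¬ H.Adj a y →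
    ¬ H.Adj a b → ¬ H.Adj a z → ¬ H.Adj y z → ¬ H.Adj b z → a ≠ b → False

/-- Two vertices of an independent set that avoids `N(v)` have the same neighbours in `N(v)` as the
whole set: otherwise three of them have private neighbours in `N(v)`, which are pairwise nonadjacent
by bull-freeness and together with `v` produce an `E`. -/
theorem exists_pair_dominating (hb : BullFree H) (he : EFree H) (v : V) (I : Finset V)
    (hI : ∀ x ∈ I, ∀ y ∈ I, ¬ H.Adj x y) (hv : ∀ x ∈ I, ¬ H.Adj v x) (hne : I.Nonempty) :
    ∃ a ∈ I, ∃ b ∈ I, ∀ x, H.Adj v x → (∃ y ∈ I, H.Adj x y) → H.Adj a x ∨ H.Adj b x := by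
  classical
  let dom : Finset V → Prop := fun J => ∀ x, H.Adj v x → (∃ y ∈ I, H.Adj x y) → ∃ y ∈ J, H.Adj x y
  obtain ⟨J, hJ⟩ := ((I.powerset.filter dom).exists_minimal ⟨I, by
    simpa [dom] using fun x _ y hy hxy => ⟨y, hy, hxy⟩⟩)
  have hJI : J ⊆ I := by simpa using (Finset.mem_filter.mp hJ.1).1
  have hJd : dom J := (Finset.mem_filter.mp hJ.1).2
  have hpriv : ∀ a ∈ J, ∃ x, H.Adj v x ∧ H.Adj x a ∧ ∀ b ∈ J, b ≠ a → ¬ H.Adj x b := by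
    intro a ha
    by_contra! hcon
    have hd : dom (J.erase a) := by
      intro x hx hy
      obtain ⟨y, hyJ, hxy⟩ := hJd x hx hy
      by_cases hya : y = a
      · subst hya
        obtain ⟨b, hbJ, hba, hxb⟩ := hcon x hx hxy
        exact ⟨b, Finset.mem_erase.mpr ⟨hba, hbJ⟩, hxb⟩
      · exact ⟨y, Finset.mem_erase.mpr ⟨hya, hyJ⟩, hxy⟩
    have := hJ.2 (y := J.erase a) (by
      simp only [Finset.mem_filter, Finset.mem_powerset]
      exact ⟨(Finset.erase_subset _ _).trans hJI, hd⟩) (Finset.erase_subset _ _)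
    exact absurd (this ha) (by simp)
  have hcard : J.card ≤ 2 := by
    by_contra hlt
    obtain ⟨a, b, c, ha, hb', hc, hab, hac, hbc⟩ := Finset.two_lt_card_iff.mp (not_le.mp hlt)
    obtain ⟨x, hvx, hxa, hx⟩ := hpriv a ha
    obtain ⟨y, hvy, hyb, hy⟩ := hpriv b hb'
    obtain ⟨z, hvz, hzc, hz⟩ := hpriv c hc
    have key : ∀ a ∈ J, ∀ b ∈ J, a ≠ b → ∀ x y, H.Adj v x → H.Adj x a → ¬ H.Adj x b →
        H.Adj v y → H.Adj y b → ¬ H.Adj y a → ¬ H.Adj x y := fun a ha b hb' hab x y hvx hxa hxb hvy hyb hya hxy =>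
      hb x y v a b hxy hvy.symm hvx.symm hxa hyb hxb hya (hv a (hJI ha)) (hv b (hJI hb'))
        (hI a (hJI ha) b (hJI hb'))
    exact he v x a y b z hvx hxa hvy hyb hvz (hv a (hJI ha)) (hv b (hJI hb'))
      (key a ha b hb' hab x y hvx hxa (hx b hb' hab.symm) hvy hyb (hy a ha hab)) (hx b hb' hab.symm)
      (key a ha c hc hac x z hvx hxa (hx c hc hac.symm) hvz hzc (hz a ha hac))
      (fun h => hy a ha hab h.symm) (hI a (hJI ha) b (hJI hb')) (fun h => hz a ha hac h.symm)
      (key b hb' c hc hbc y z hvy hyb (hy c hc hbc.symm) hvz hzc (hz b hb' hbc))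
      (fun h => hz b hb' hbc h.symm) hab
  have hsub : ∃ a ∈ I, ∃ b ∈ I, J ⊆ {a, b} := by
    obtain ⟨c, hc⟩ := hne
    have h3 : J.card = 0 ∨ J.card = 1 ∨ J.card = 2 := by omega
    rcases h3 with h | h | h
    · exact ⟨c, hc, c, hc, by simp [Finset.card_eq_zero.mp h]⟩
    · obtain ⟨a, rfl⟩ := Finset.card_eq_one.mp h
      have : a ∈ I := hJI (by simp)
      exact ⟨a, this, a, this, by simp⟩
    · obtain ⟨a, b, -, rfl⟩ := Finset.card_eq_two.mp h
      exact ⟨a, hJI (by simp), b, hJI (by simp), subset_rfl⟩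
  obtain ⟨a, ha, b, hb', hab⟩ := hsub
  refine ⟨a, ha, b, hb', fun x hx hy => ?_⟩
  obtain ⟨y, hyJ, hxy⟩ := hJd x hx hy
  have := hab hyJ
  simp only [Finset.mem_insert, Finset.mem_singleton] at this
  rcases this with rfl | rfl
  · exact Or.inl hxy.symm
  · exact Or.inr hxy.symm

/-- Connectedness of a finite set with respect to a relation, phrased by cuts: no proper nonempty
subset is closed under the relation. -/
def Conn (r : V → V → Prop) (W : Finset V) : Prop :=
  ∀ T ⊆ W, T.Nonempty → (∀ x ∈ T, ∀ y ∈ W, r x y → y ∈ T) → T = W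

/-- The vertex `x` belongs to the closed neighbourhood of the list `S`. -/
def Near (H : SimpleGraph V) (S : List V) (x : V) : Prop := ∃ s ∈ S, x = s ∨ H.Adj s x

/-- Beyond the induced path `p q r s y`, a neighbour of `s` that sees a vertex far from the path must
also be adjacent to `y`. -/
theorem adj_of_far (hb : BullFree H) (he : EFree H) {p q r s y x a : V}
    (hpq : H.Adj p q) (hqr : H.Adj q r) (hrs : H.Adj r s) (hsy : H.Adj s y)
    (hpr : ¬ H.Adj p r) (hps : ¬ H.Adj p s) (hpy : ¬ H.Adj p y) (hqs : ¬ H.Adj q s)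
    (hqy : ¬ H.Adj q y) (hry : ¬ H.Adj r y) (hap : ¬ H.Adj a p) (haq : ¬ H.Adj a q)
    (har : ¬ H.Adj a r) (has : ¬ H.Adj a s) (hay : ¬ H.Adj a y) (hxs : H.Adj s x)
    (hxa : H.Adj x a) : H.Adj y x := by
  have sy : ∀ {u v}, ¬ H.Adj u v → ¬ H.Adj v u := fun h h' => h h'.symm
  by_contra hyx
  have hxr : ¬ H.Adj x r := fun h =>
    hb x s r a y hxs.symm hrs.symm h hxa hsy (sy hyx) (sy has) (sy har) hry hay
  have hxq : H.Adj x q := by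
    by_contra hxq
    exact he s x a r q y hxs hxa hrs.symm hqr.symm hsy (sy has) (sy hqs) hxr hxq (sy hyx) har haq hay
      hry hqy (by rintro rfl; exact har hqr)
  by_cases hxp : H.Adj x p
  · exact hb x q p a r hxq hpq.symm hxp hxa hqr hxr (sy haq) (sy hap) hpr har
  · exact he x s y q p a hxs.symm hsy hxq hpq.symm hxa (sy hyx) hxp (sy hqs) (sy hps) (sy has)
      (sy hqy) (sy hpy) (sy hay) (sy haq) (sy hap) (by rintro rfl; exact hqy hpq.symm)

/-- The set `A` is a connected part of `W`, away from the closed neighbourhood of `S`, that holds more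
than half of `W` and whose neighbours in `W` all lie in that neighbourhood. -/
structure BigPart (H : SimpleGraph V) (W : Finset V) (S : List V) (A : Finset V) : Prop where
  subset : A ⊆ W
  conn : Conn H.Adj A
  far : ∀ x ∈ A, ¬ Near H S x
  big : W.card < 2 * A.card
  closed : ∀ x ∈ A, ∀ y ∈ W, H.Adj x y → y ∉ A → Near H S y

theorem conn_insert [DecidableEq V] {r : V → V → Prop} (hr : ∀ x y, r x y → r y x) {A : Finset V}
    (hA : Conn r A) {x y : V} (hx : x ∈ A) (hxy : r x y) : Conn r (insert y A) := by
  intro T hT hne hcl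
  by_cases hy : y ∈ T
  · have hxT : x ∈ T := hcl y hy x (Finset.mem_insert_of_mem hx) (hr _ _ hxy)
    have : T ∩ A = A := hA _ Finset.inter_subset_right ⟨x, by simp [hxT, hx]⟩ (by
      intro u hu w hw huw
      simp only [Finset.mem_inter] at hu ⊢
      exact ⟨hcl u hu.1 w (Finset.mem_insert_of_mem hw) huw, hw⟩)
    refine Finset.Subset.antisymm hT (Finset.insert_subset hy ?_)
    rw [← this]; exact Finset.inter_subset_left
  · have hTA : T ⊆ A := fun u hu => by
      rcases Finset.mem_insert.mp (hT hu) with rfl | h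
      · exact absurd hu hy
      · exact h
    have : T = A := hA T hTA hne fun u hu w hw huw => hcl u hu w (Finset.mem_insert_of_mem hw) huw
    subst this
    exact absurd (hcl x hx y (Finset.mem_insert_self _ _) hxy) hy

theorem exists_bigPart {W : Finset V} {S : List V}
    (h : ∃ A ⊆ W, Conn H.Adj A ∧ (∀ x ∈ A, ¬ Near H S x) ∧ W.card < 2 * A.card) :
    ∃ A, BigPart H W S A := by
  classical
  obtain ⟨A, hA⟩ := (W.powerset.filter (fun A => Conn H.Adj A ∧ (∀ x ∈ A, ¬ Near H S x) ∧
    W.card < 2 * A.card)).exists_maximal (by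
      obtain ⟨A, h1, h2⟩ := h
      exact ⟨A, Finset.mem_filter.mpr ⟨Finset.mem_powerset.mpr h1, h2⟩⟩)
  have hm := Finset.mem_filter.mp hA.1
  refine ⟨A, Finset.mem_powerset.mp hm.1, hm.2.1, hm.2.2.1, hm.2.2.2, fun x hx y hy hxy hyA => ?_⟩
  by_contra hS
  have := hA.2 (y := insert y A) (by
    simp only [Finset.mem_filter, Finset.mem_powerset]
    refine ⟨Finset.insert_subset hy (Finset.mem_powerset.mp hm.1),
      conn_insert (fun _ _ h => h.symm) hm.2.1 hx hxy, ?_, ?_⟩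
    · intro u hu
      rcases Finset.mem_insert.mp hu with rfl | hu
      · exact hS
      · exact hm.2.2.1 u hu
    · rw [Finset.card_insert_of_notMem hyA]; have := hm.2.2.2; omega) (Finset.subset_insert _ _)
  exact hyA (this (Finset.mem_insert_self _ _))

/-- Enlarging the list shrinks the big part. -/
theorem BigPart.mono {W : Finset V} {S S' : List V} {A A' : Finset V} (hA : BigPart H W S A)
    (hA' : BigPart H W S' A') (hS : ∀ s ∈ S, s ∈ S') : A' ⊆ A := by
  classical
  have hne : (A' ∩ A).Nonempty := by
    rw [Finset.nonempty_iff_ne_empty]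
    intro h0
    have h1 : (A' ∪ A).card = A'.card + A.card :=
      Finset.card_union_of_disjoint (Finset.disjoint_iff_inter_eq_empty.mpr h0)
    have h2 := Finset.card_le_card (Finset.union_subset hA'.subset hA.subset)
    have := hA.big; have := hA'.big
    omega
  have := hA'.conn (A' ∩ A) Finset.inter_subset_left hne (by
    intro x hx y hy hxy
    rw [Finset.mem_inter] at hx ⊢
    refine ⟨hy, ?_⟩
    by_contra hyA
    obtain ⟨s, hs, hsy⟩ := hA.closed x hx.2 y (hA'.subset hy) hxy hyA
    exact hA'.far y hy ⟨s, hS s hs, hsy⟩)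
  rw [← this]; exact Finset.inter_subset_right

/-- If `y` sees the part `A`, then the path extends by a vertex of `A` that sees the next part. -/
theorem BigPart.next {W : Finset V} {S S' : List V} {A A' : Finset V} (hA : BigPart H W S A)
    (hA' : BigPart H W S' A') (y : V) (hS : ∀ s, s ∈ S' ↔ s ∈ S ∨ s = y) (hyA : y ∉ A)
    (hy : ∃ z ∈ A, H.Adj y z) :
    A' ⊂ A ∧ ∃ y' ∈ A, y' ∉ A' ∧ H.Adj y y' ∧ ∃ z ∈ A', H.Adj y' z := by
  have hsub : A' ⊆ A := hA.mono hA' fun s hs => (hS s).mpr (Or.inl hs)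
  obtain ⟨z, hz, hyz⟩ := hy
  have hzA' : z ∉ A' := fun h => hA'.far z h ⟨y, (hS y).mpr (Or.inr rfl), Or.inr hyz⟩
  refine ⟨Finset.ssubset_iff_subset_ne.mpr ⟨hsub, fun h => hzA' (h ▸ hz)⟩, ?_⟩
  have hne : A'.Nonempty := by
    rw [← Finset.card_pos]; have := hA'.big; omega
  have : ∃ u ∈ A', ∃ w ∈ A, H.Adj u w ∧ w ∉ A' := by
    by_contra! hcon
    exact hzA' (hA.conn A' hsub hne hcon ▸ hz)
  obtain ⟨u, hu, w, hw, huw, hwA'⟩ := this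
  refine ⟨w, hw, hwA', ?_, u, hu, huw.symm⟩
  obtain ⟨s, hs, hsw⟩ := hA'.closed u hu w (hA.subset hw) huw hwA'
  rcases (hS s).mp hs with h | rfl
  · exact absurd ⟨s, h, hsw⟩ (hA.far w hw)
  · rcases hsw with rfl | h
    · exact absurd hw hyA
    · exact h

theorem not_adj_of_not_near {S : List V} {x s : V} (h : ¬ Near H S x) (hs : s ∈ S) : ¬ H.Adj s x :=
  fun h' => h ⟨s, hs, Or.inr h'⟩

/-- The descent: with an induced path `p q r s y` and a big part that is far from the path and is
bounded by `N(u₁), N(u₂), N(u₃), N(s)` only, there is a smaller such part. -/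
theorem no_long_path (hb : BullFree H) (he : EFree H) {W : Finset V}
    (hbig : ∀ u₁ u₂ u₃ u₄ u₅, u₁ ∈ W → u₂ ∈ W → u₃ ∈ W → u₄ ∈ W → u₅ ∈ W →
      ∃ A, BigPart H W [u₁, u₂, u₃, u₄, u₅] A) {u₁ u₂ u₃ : V}
    (hu₁ : u₁ ∈ W) (hu₂ : u₂ ∈ W) (hu₃ : u₃ ∈ W) (N : ℕ) :
    ∀ (p q r s y : V) (A : Finset V), A.card ≤ N → s ∈ W → y ∈ W →
      BigPart H W [u₁, u₂, u₃, s] A → H.Adj p q → H.Adj q r → H.Adj r s → H.Adj s y →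
      ¬ H.Adj p r → ¬ H.Adj p s → ¬ H.Adj p y → ¬ H.Adj q s → ¬ H.Adj q y → ¬ H.Adj r y →
      (∀ x ∈ A, ¬ H.Adj p x ∧ ¬ H.Adj q x ∧ ¬ H.Adj r x) → y ∉ A → (∃ z ∈ A, H.Adj y z) → False := by
  induction N with
  | zero =>
    intro p q r s y A hc _ _ hA
    have := hA.big; omega
  | succ N ih =>
    intro p q r s y A hc hs hy hA hpq hqr hrs hsy hpr hps hpy hqs hqy hry hfar hyA hz
    obtain ⟨A', hA'⟩ := hbig u₁ u₂ u₃ s y hu₁ hu₂ hu₃ hs hy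
    obtain ⟨hss, y', hy'A, hy'A', hyy', hz'⟩ := hA.next hA' y (by simp; tauto) hyA hz
    have hA's : ∀ x ∈ A', ¬ H.Adj s x := fun x hx => not_adj_of_not_near (hA'.far x hx) (by simp)
    have hA'y : ∀ x ∈ A', ¬ H.Adj y x := fun x hx => not_adj_of_not_near (hA'.far x hx) (by simp)
    refine ih q r s y y' A' (by have := Finset.card_lt_card hss; omega) hy (hA.subset hy'A)
      ⟨hA'.subset, hA'.conn, ?_, hA'.big, ?_⟩ hqr hrs hsy hyy' hqs hqy (hfar y' hy'A).2.1 hry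
      (hfar y' hy'A).2.2 (not_adj_of_not_near (hA.far y' hy'A) (by simp)) (fun x hx => ?_) hy'A' hz'
    · rintro x hx ⟨t, ht, htx⟩
      exact hA'.far x hx ⟨t, by simp at ht ⊢; tauto, htx⟩
    · intro x hx w hw hxw hwA'
      obtain ⟨t, ht, htw⟩ := hA'.closed x hx w hw hxw hwA'
      simp only [List.mem_cons, List.not_mem_nil, or_false] at ht
      have keep : t = u₁ ∨ t = u₂ ∨ t = u₃ ∨ t = y → Near H [u₁, u₂, u₃, y] w := fun h =>
        ⟨t, by simpa using h, htw⟩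
      rcases ht with h | h | h | rfl | h
      · exact keep (by tauto)
      · exact keep (by tauto)
      · exact keep (by tauto)
      · rcases htw with rfl | htw
        · exact absurd hxw.symm (hA's x hx)
        · have h3 := hfar x (hss.1 hx)
          exact ⟨y, by simp, Or.inr (adj_of_far hb he hpq hqr hrs hsy hpr hps hpy hqs hqy hry
            (fun h => h3.1 h.symm) (fun h => h3.2.1 h.symm) (fun h => h3.2.2 h.symm)
            (fun h => hA's x hx h.symm) (fun h => hA'y x hx h.symm) htw hxw.symm)⟩
      · exact keep (by tauto)
    · exact ⟨(hfar x (hss.1 hx)).2.1, (hfar x (hss.1 hx)).2.2, hA's x hx⟩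

/-- In a connected `(bull, E)`-free graph the closed neighbourhood of some five vertices is a balanced
separator. -/
theorem exists_balanced_separator (hb : BullFree H) (he : EFree H) {W : Finset V} (hW : W.Nonempty)
    (hconn : Conn H.Adj W) :
    ∃ u₁ ∈ W, ∃ u₂ ∈ W, ∃ u₃ ∈ W, ∃ u₄ ∈ W, ∃ u₅ ∈ W, ∀ A ⊆ W, Conn H.Adj A →
      (∀ x ∈ A, ¬ Near H [u₁, u₂, u₃, u₄, u₅] x) → 2 * A.card ≤ W.card := by
  classical
  by_contra! hcon
  have hbig : ∀ u₁ u₂ u₃ u₄ u₅, u₁ ∈ W → u₂ ∈ W → u₃ ∈ W → u₄ ∈ W → u₅ ∈ W →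
      ∃ A, BigPart H W [u₁, u₂, u₃, u₄, u₅] A := by
    intro u₁ u₂ u₃ u₄ u₅ h₁ h₂ h₃ h₄ h₅
    obtain ⟨A, h⟩ := hcon u₁ h₁ u₂ h₂ u₃ h₃ u₄ h₄ u₅ h₅
    exact exists_bigPart ⟨A, h⟩
  have eqv : ∀ {S S' : List V} {A : Finset V}, (∀ s, s ∈ S ↔ s ∈ S') → BigPart H W S A →
      BigPart H W S' A := by
    intro S S' A hS hA
    have hn : ∀ x, Near H S x ↔ Near H S' x := fun x => by simp only [Near, hS]
    exact ⟨hA.subset, hA.conn, fun x hx => (hn x).not.mp (hA.far x hx), hA.big,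
      fun x hx y hy hxy hyA => (hn y).mp (hA.closed x hx y hy hxy hyA)⟩
  obtain ⟨p, hp⟩ := hW
  obtain ⟨A₁, hA₁⟩ := hbig p p p p p hp hp hp hp hp
  obtain ⟨z, hz⟩ : A₁.Nonempty := by rw [← Finset.card_pos]; have := hA₁.big; omega
  -- The first step of the path: by connectedness some neighbour of `p` sees `A₁`.
  obtain ⟨q, hqW, hqA, hpq, hzq⟩ : ∃ q ∈ W, q ∉ A₁ ∧ H.Adj p q ∧ ∃ z ∈ A₁, H.Adj q z := by
    have : ∃ u ∈ A₁, ∃ w ∈ W, H.Adj u w ∧ w ∉ A₁ := by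
      by_contra! h
      have := hconn A₁ hA₁.subset ⟨z, hz⟩ h
      exact hA₁.far p (this ▸ hp) ⟨p, by simp, Or.inl rfl⟩
    obtain ⟨u, hu, w, hw, huw, hwA⟩ := this
    obtain ⟨s, hs, hsw⟩ := hA₁.closed u hu w hw huw hwA
    have hsp : s = p := by simpa using hs
    subst hsp
    rcases hsw with rfl | hsw
    · exact absurd huw.symm (not_adj_of_not_near (hA₁.far u hu) (by simp))
    · exact ⟨w, hw, hwA, hsw, u, hu, huw.symm⟩
  obtain ⟨A₂, hA₂⟩ := hbig p p p p q hp hp hp hp hqW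
  obtain ⟨h12, r, hrA₁, hrA₂, hqr, hzr⟩ := hA₁.next hA₂ q (by simp) hqA hzq
  have hrW := hA₁.subset hrA₁
  obtain ⟨A₃, hA₃⟩ := hbig p p p q r hp hp hp hqW hrW
  obtain ⟨h23, s, hsA₂, hsA₃, hrs, hzs⟩ := hA₂.next hA₃ r (by simp; tauto) hrA₂ hzr
  have hsW := hA₂.subset hsA₂
  obtain ⟨A₄, hA₄⟩ := hbig p p q r s hp hp hqW hrW hsW
  obtain ⟨h34, y, hyA₃, hyA₄, hsy, hzy⟩ := hA₃.next hA₄ s (by simp; tauto) hsA₃ hzs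
  have f₁ := fun x hx => not_adj_of_not_near (hA₁.far x hx) (s := p) (by simp)
  have f₂ := fun x hx => not_adj_of_not_near (hA₂.far x hx) (s := q) (by simp)
  have f₃ := fun x hx => not_adj_of_not_near (hA₃.far x hx) (s := r) (by simp)
  exact no_long_path hb he hbig hp hqW hrW _ p q r s y A₄ le_rfl hsW (hA₃.subset hyA₃)
    (eqv (by simp) hA₄) hpq hqr hrs hsy (f₁ r hrA₁) (f₁ s (h12.1 hsA₂))
    (f₁ y (h12.1 (h23.1 hyA₃))) (f₂ s hsA₂) (f₂ y (h23.1 hyA₃)) (f₃ y hyA₃)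
    (fun x hx => ⟨f₁ x (h12.1 (h23.1 (h34.1 hx))), f₂ x (h23.1 (h34.1 hx)), f₃ x (h34.1 hx)⟩)
    hyA₄ hzy

end Combinatorics

end PartialColoringAlgorithm

namespace PartialColoringAlgorithm

/-! ### Vertex-color pairs, moves and reachable solutions -/

section Pairs

open Classical

/-- The conflict relation on vertex-color pairs, where `p` stands for vertex `p / k` and color `p % k`:
a solution is a set of pairs without conflicts. -/
def Conflict (H : SimpleGraph ℕ) (k p q : ℕ) : Prop :=
  (p / k = q / k ∧ p ≠ q) ∨ (p % k = q % k ∧ H.Adj (p / k) (q / k))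

theorem Conflict.symm {H : SimpleGraph ℕ} {k p q : ℕ} (h : Conflict H k p q) :
    Conflict H k q p := by
  rcases h with ⟨h, h'⟩ | ⟨h, h'⟩
  · exact Or.inl ⟨h.symm, h'.symm⟩
  · exact Or.inr ⟨h.symm, h'.symm⟩

/-- A set of pairs without conflicts. -/
def ConflictFree (H : SimpleGraph ℕ) (k : ℕ) (I : Finset ℕ) : Prop :=
  ∀ p ∈ I, ∀ q ∈ I, ¬ Conflict H k p q

/-- The condition under which the pair `p` of `A` survives the move `(v, a, b)` in color `e`. The move
expresses the guess that `v` has color `e` exactly if `a = v`, and that `a` and `b` together see all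
neighbours of `v` that are seen from outside `N(v)` by vertices of color `e`. -/
def Survives (H : SimpleGraph ℕ) (k : ℕ) (A : Finset ℕ) (v a b e p : ℕ) : Prop :=
  p % k = e →
    (p / k = v → a = v) ∧
    (H.Adj v (p / k) → ¬ H.Adj a (p / k) ∧ ¬ H.Adj b (p / k)) ∧
    (¬ H.Adj v (p / k) → p / k ≠ v → ∀ q ∈ A, q % k = e → H.Adj v (q / k) →
      ¬ H.Adj a (q / k) → ¬ H.Adj b (q / k) → ¬ H.Adj (q / k) (p / k))

/-- The pairs that survive a move. -/
noncomputable def move (H : SimpleGraph ℕ) (k : ℕ) (A : Finset ℕ) (v a b e : ℕ) : Finset ℕ :=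
  A.filter (Survives H k A v a b e)

/-- The vertices that occur in a set of pairs. -/
def verts (k : ℕ) (A : Finset ℕ) : Finset ℕ := A.image (· / k)

theorem mem_verts {k : ℕ} {A : Finset ℕ} {v : ℕ} : v ∈ verts k A ↔ ∃ p ∈ A, p / k = v := by
  simp [verts]

theorem eq_of_div_mod {k p q : ℕ} (h : p / k = q / k) (h' : p % k = q % k) : p = q := by
  rw [← Nat.div_add_mod p k, h, h', Nat.div_add_mod]

/-- A connected component of `R` for the conflict relation. -/
structure IsComp (H : SimpleGraph ℕ) (k : ℕ) (R C : Finset ℕ) : Prop where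
  subset : C ⊆ R
  nonempty : C.Nonempty
  closed : ∀ p ∈ C, ∀ q ∈ R, Conflict H k p q → q ∈ C
  conn : Conn (Conflict H k) C

/-- The component `C`, reached by a move at `v`, lies in the neighbourhood of `v`, and `v` occurs in
the base set `B`. This bounds how often a branch can restart its budget by the clique number. -/
def Fresh (H : SimpleGraph ℕ) (k : ℕ) (B C : Finset ℕ) (v : ℕ) : Prop :=
  v ∈ verts k B ∧ ∀ p ∈ C, H.Adj v (p / k)

/-- `Reach n k D H B A d I`: the recursion, called for the set `A` of pairs with base set `B` and
remaining budget `d`, takes a solution at least as good as `I` into account. A move at budget `d + 1`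
concerns the color `(d + 1) % k`; a fresh component starts again with the full budget `D`. -/
inductive Reach (n k D : ℕ) (H : SimpleGraph ℕ) : Finset ℕ → Finset ℕ → ℕ → Finset ℕ → Prop where
  | single (B : Finset ℕ) (d p : ℕ) (I : Finset ℕ) : I ⊆ {p} → Reach n k D H B {p} d I
  | step (B A : Finset ℕ) (d : ℕ) (I : Finset ℕ) (v a b : ℕ) : v < n → a < n → b < n →
      I ⊆ move H k A v a b ((d + 1) % k) →
      (∀ C, IsComp H k (move H k A v a b ((d + 1) % k)) C →
        Reach n k D H (if Fresh H k B C v then C else B) C (if Fresh H k B C v then D else d)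
          (I ∩ C)) →
      Reach n k D H B A (d + 1) I

variable {H : SimpleGraph ℕ} {n k : ℕ}

theorem conn_verts {A : Finset ℕ} (hA : Conn (Conflict H k) A) : Conn H.Adj (verts k A) := by
  intro T hT hne hcl
  have : A.filter (fun p => p / k ∈ T) = A := hA _ (Finset.filter_subset _ _) (by
      obtain ⟨x, hx⟩ := hne
      obtain ⟨p, hp, rfl⟩ := mem_verts.mp (hT hx)
      exact ⟨p, by simp [hp, hx]⟩) (by
    intro p hp q hq hpq
    simp only [Finset.mem_filter] at hp ⊢
    refine ⟨hq, ?_⟩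
    rcases hpq with ⟨h, -⟩ | ⟨-, h⟩
    · exact h ▸ hp.2
    · exact hcl _ hp.2 _ (mem_verts.mpr ⟨q, hq, rfl⟩) h)
  refine Finset.Subset.antisymm hT fun x hx => ?_
  obtain ⟨p, hp, rfl⟩ := mem_verts.mp hx
  rw [← this] at hp
  exact (Finset.mem_filter.mp hp).2

/-- In color `e` there is no edge of `A` between the neighbourhood of `v` and its complement. -/
def Separated (H : SimpleGraph ℕ) (k : ℕ) (A : Finset ℕ) (v e : ℕ) : Prop :=
  ∀ p ∈ A, ∀ q ∈ A, p % k = e → q % k = e → H.Adj v (p / k) → ¬ H.Adj v (q / k) →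
    ¬ H.Adj (p / k) (q / k)

theorem Separated.mono {A A' : Finset ℕ} {v e : ℕ} (h : Separated H k A v e) (hA : A' ⊆ A) :
    Separated H k A' v e :=
  fun p hp q hq => h p (hA hp) q (hA hq)

theorem separated_move (A : Finset ℕ) (v a b e : ℕ) : Separated H k (move H k A v a b e) v e := by
  intro p hp q hq hpe hqe hvp hvq hpq
  simp only [move, Finset.mem_filter] at hp hq
  obtain ⟨-, hp2, -⟩ := hp.2 hpe
  obtain ⟨hq1, -, hq3⟩ := hq.2 hqe
  obtain ⟨hap, hbp⟩ := hp2 hvp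
  by_cases hqv : q / k = v
  · rw [hq1 hqv] at hap
    exact hap hvp
  · exact hq3 hvq hqv p hp.1 hpe hvp hap hbp hpq

/-- Every solution survives some move at `v`. -/
theorem exists_move (hb : BullFree H) (he : EFree H) (hn : 2 ≤ n) {v : ℕ} (hv : v < n) (e : ℕ)
    {I : Finset ℕ} (hI : ConflictFree H k I) (hIn : ∀ p ∈ I, p / k < n) :
    ∃ a < n, ∃ b < n, (a = v → ∃ p ∈ I, p / k = v ∧ p % k = e) ∧
      ∀ A, I ⊆ A → I ⊆ move H k A v a b e := by
  have hadj : ∀ p ∈ I, ∀ q ∈ I, p % k = e → q % k = e → ¬ H.Adj (p / k) (q / k) :=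
    fun p hp q hq hpe hqe h => hI p hp q hq (Or.inr ⟨hpe.trans hqe.symm, h⟩)
  by_cases hvI : ∃ p ∈ I, p / k = v ∧ p % k = e
  · obtain ⟨p, hp, hpv, hpe⟩ := hvI
    refine ⟨v, hv, v, hv, fun _ => ⟨p, hp, hpv, hpe⟩, fun A hA q hq => ?_⟩
    refine Finset.mem_filter.mpr ⟨hA hq, fun hqe => ⟨fun _ => rfl, fun h => ?_, ?_⟩⟩
    · exact absurd h (hpv ▸ hadj p hp q hq hpe hqe)
    · exact fun _ _ r _ _ h h' => absurd h h'
  · push Not at hvI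
    by_cases hD : ∃ p ∈ I, p % k = e ∧ ¬ H.Adj v (p / k)
    · -- the vertices of color `e` outside the neighbourhood of `v`
      let D := verts k (I.filter fun p => p % k = e ∧ ¬ H.Adj v (p / k))
      have memD : ∀ x, x ∈ D ↔ ∃ p ∈ I, p % k = e ∧ ¬ H.Adj v (p / k) ∧ p / k = x := by
        intro x; simp only [D, mem_verts, Finset.mem_filter]
        constructor
        · rintro ⟨p, ⟨h1, h2, h3⟩, h4⟩; exact ⟨p, h1, h2, h3, h4⟩
        · rintro ⟨p, h1, h2, h3, h4⟩; exact ⟨p, ⟨h1, h2, h3⟩, h4⟩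
      obtain ⟨a, ha, b, hb', hab⟩ := exists_pair_dominating hb he v D
        (by
          intro x hx y hy
          obtain ⟨p, hp, hpe, -, rfl⟩ := (memD x).mp hx
          obtain ⟨q, hq, hqe, -, rfl⟩ := (memD y).mp hy
          exact hadj p hp q hq hpe hqe)
        (by
          intro x hx
          obtain ⟨p, hp, hpe, h, rfl⟩ := (memD x).mp hx
          exact h)
        (by
          obtain ⟨p, hp, hpe, h⟩ := hD
          exact ⟨_, (memD _).mpr ⟨p, hp, hpe, h, rfl⟩⟩)
      obtain ⟨pa, hpa, hpae, -, rfl⟩ := (memD a).mp ha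
      obtain ⟨pb, hpb, hpbe, -, rfl⟩ := (memD b).mp hb'
      refine ⟨_, hIn pa hpa, _, hIn pb hpb, fun h => absurd hpae (hvI pa hpa h), fun A hA q hq => ?_⟩
      refine Finset.mem_filter.mpr ⟨hA hq, fun hqe => ⟨fun h => absurd hqe (hvI q hq h), ?_, ?_⟩⟩
      · exact fun _ => ⟨hadj pa hpa q hq hpae hqe, hadj pb hpb q hq hpbe hqe⟩
      · intro hvq _ r _ _ hvr har hbr hrq
        rcases hab (r / k) hvr ⟨q / k, (memD _).mpr ⟨q, hq, hqe, hvq, rfl⟩, hrq⟩ with h | h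
        · exact har h
        · exact hbr h
    · push Not at hD
      by_cases hne : ∃ p ∈ I, p % k = e
      · obtain ⟨p, hp, hpe⟩ := hne
        refine ⟨_, hIn p hp, _, hIn p hp, fun h => absurd hpe (hvI p hp h), fun A hA q hq => ?_⟩
        refine Finset.mem_filter.mpr ⟨hA hq, fun hqe => ⟨fun h => absurd hqe (hvI q hq h), ?_, ?_⟩⟩
        · exact fun _ => ⟨hadj p hp q hq hpe hqe, hadj p hp q hq hpe hqe⟩
        · exact fun h => absurd (hD q hq hqe) h
      · push Not at hne
        obtain ⟨a, ha, hav⟩ : ∃ a < n, a ≠ v := by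
          by_cases h : v = 0
          · exact ⟨1, by omega, by omega⟩
          · exact ⟨0, by omega, by omega⟩
        exact ⟨a, ha, a, ha, fun h => absurd h hav, fun A hA q hq =>
          Finset.mem_filter.mpr ⟨hA hq, fun hqe => absurd hqe (hne q hq)⟩⟩

theorem ConflictFree.mono {I J : Finset ℕ} (hI : ConflictFree H k I) (h : J ⊆ I) :
    ConflictFree H k J :=
  fun p hp q hq => hI p (h hp) q (h hq)

/-- Any `k` consecutive budgets meet every color. -/
theorem exists_add_mod_eq {k : ℕ} (d e : ℕ) (he : e < k) : ∃ i, 0 < i ∧ i ≤ k ∧ e = (d + i) % k := by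
  have hd := Nat.mod_lt d (by omega : 0 < k)
  by_cases h : d % k < e
  · refine ⟨e - d % k, by omega, by omega, ?_⟩
    rw [Nat.add_mod, Nat.mod_eq_of_lt (by omega : e - d % k < k), Nat.add_sub_cancel' h.le,
      Nat.mod_eq_of_lt he]
  · refine ⟨k + e - d % k, by omega, by omega, ?_⟩
    have : d + (k + e - d % k) = e + k * (d / k + 1) := by
      have := Nat.div_add_mod d k
      rw [Nat.mul_add]; omega
    rw [this, Nat.add_mul_mod_self_left, Nat.mod_eq_of_lt he]

/-- After moves at `v` in all `k` colors, what remains are components inside the neighbourhood of `v`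
and components outside. -/
theorem reach_of_vertex {D : ℕ} (hb : BullFree H) (he : EFree H) (hn : 2 ≤ n) (hk : 0 < k)
    {B A I : Finset ℕ} {v d : ℕ} (hAn : ∀ p ∈ A, p / k < n) (hI : ConflictFree H k I)
    (hv : v < n) (hvB : v ∈ verts k B) (hA : Conn (Conflict H k) A)
    (h₁ : ∀ C ⊆ A, C.Nonempty → Conn (Conflict H k) C → (∀ p ∈ C, H.Adj v (p / k)) →
      Reach n k D H C C D (I ∩ C))
    (h₂ : ∀ C ⊆ A, C.Nonempty → Conn (Conflict H k) C → (∀ p ∈ C, ¬ H.Adj v (p / k)) →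
      (∀ p ∈ C, p / k = v → p ∈ I) → Reach n k D H B C d (I ∩ C)) (hne : A.Nonempty) :
    Reach n k D H B A (d + k) (I ∩ A) := by
  have key : ∀ j ≤ k, ∀ A' ⊆ A, A'.Nonempty → Conn (Conflict H k) A' →
      (j < k → ¬ ∀ p ∈ A', H.Adj v (p / k)) →
      (∀ i, j < i → i ≤ k → Separated H k A' v ((d + i) % k)) →
      (∀ i, j < i → i ≤ k → ∀ p ∈ A', p / k = v → p % k = (d + i) % k → p ∈ I) →
      Reach n k D H B A' (d + j) (I ∩ A') := by
    intro j
    induction j with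
    | zero =>
      intro _ A' hA' hne hconn hin hsep hcol
      have hmod : ∀ p : ℕ, ∃ i, 0 < i ∧ i ≤ k ∧ p % k = (d + i) % k :=
        fun p => exists_add_mod_eq d _ (Nat.mod_lt p hk)
      refine h₂ A' hA' hne hconn (fun p hp hvp => hin hk ?_) fun p hp hpv => ?_
      · have : A'.filter (fun p => H.Adj v (p / k)) = A' := hconn _ (Finset.filter_subset _ _)
          ⟨p, by simp [hp, hvp]⟩ (by
            intro x hx y hy hxy
            simp only [Finset.mem_filter] at hx ⊢
            refine ⟨hy, ?_⟩
            rcases hxy with ⟨h, -⟩ | ⟨h, h'⟩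
            · exact h ▸ hx.2
            · obtain ⟨i, hi, hik, hxi⟩ := hmod x
              by_contra hvy
              exact hsep i hi hik x hx.1 y hy hxi (h.symm.trans hxi) hx.2 hvy h')
        intro q hq
        rw [← this] at hq
        exact (Finset.mem_filter.mp hq).2
      · obtain ⟨i, hi, hik, hpi⟩ := hmod p
        exact hcol i hi hik p hp hpv hpi
    | succ j ih =>
      intro hj A' hA' hne hconn _ hsep hcol
      obtain ⟨a, ha, b, hb', hav, hmove⟩ := exists_move (k := k) hb he hn hv ((d + (j + 1)) % k)
        (hI.mono (Finset.inter_subset_left (s₂ := A')))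
        (fun p hp => hAn p (hA' (Finset.mem_of_mem_inter_right hp)))
      refine Reach.step B A' (d + j) _ v a b hv ha hb' (hmove A' Finset.inter_subset_right) ?_
      intro C hC
      have hCA' : C ⊆ A' := hC.subset.trans (Finset.filter_subset _ _)
      have hIC : I ∩ A' ∩ C = I ∩ C := by
        rw [Finset.inter_assoc, Finset.inter_eq_right.mpr hCA']
      rw [hIC]
      by_cases hf : ∀ p ∈ C, H.Adj v (p / k)
      · have : Fresh H k B C v := ⟨hvB, hf⟩
        simp only [this, if_true]
        exact h₁ C (hCA'.trans hA') hC.nonempty hC.conn hf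
      · have : ¬ Fresh H k B C v := fun h => hf h.2
        simp only [this, if_false]
        refine ih (by omega) C (hCA'.trans hA') hC.nonempty hC.conn (fun _ => hf) ?_ ?_
        · intro i hi hik
          by_cases hij : i = j + 1
          · subst hij; exact (separated_move A' v a b _).mono hC.subset
          · exact (hsep i (by omega) hik).mono hCA'
        · intro i hi hik p hp hpv hpi
          by_cases hij : i = j + 1
          · subst hij
            have hs := ((Finset.mem_filter.mp (hC.subset hp)).2 hpi).1 hpv
            obtain ⟨q, hq, hqv, hqe⟩ := hav hs
            rw [eq_of_div_mod (hpv.trans hqv.symm) (hpi.trans hqe.symm)]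
            exact Finset.mem_of_mem_inter_left hq
          · exact hcol i (by omega) hik p (hCA' hp) hpv hpi
  exact key k le_rfl A subset_rfl hne hA (fun h => absurd h (lt_irrefl k))
    (fun i h h' => absurd h' (by omega)) fun i h h' => absurd h' (by omega)

/-- Every clique in `W` has at most `w` vertices. -/
def CliqueLE (H : SimpleGraph ℕ) (W : Finset ℕ) (w : ℕ) : Prop :=
  ∀ K ⊆ W, (∀ x ∈ K, ∀ y ∈ K, x ≠ y → H.Adj x y) → K.card ≤ w

theorem verts_mono {A B : Finset ℕ} (h : A ⊆ B) : verts k A ⊆ verts k B :=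
  Finset.image_subset_image h

theorem CliqueLE.mono {W W' : Finset ℕ} {w : ℕ} (h : CliqueLE H W w) (hW : W' ⊆ W) :
    CliqueLE H W' w :=
  fun K hK => h K (hK.trans hW)

theorem CliqueLE.pos {W : Finset ℕ} {w : ℕ} (h : CliqueLE H W w) (hW : W.Nonempty) : 0 < w := by
  obtain ⟨x, hx⟩ := hW
  have := h {x} (by simpa using hx) (by simp)
  rw [Finset.card_singleton] at this
  omega

theorem CliqueLE.nbhd {W W' : Finset ℕ} {w v : ℕ} (h : CliqueLE H W (w + 1)) (hv : v ∈ W)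
    (hW : W' ⊆ W) (hadj : ∀ x ∈ W', H.Adj v x) : CliqueLE H W' w := by
  intro K hK hcl
  have hvK : v ∉ K := fun hvK => (hadj v (hK hvK)).ne rfl
  have := h (insert v K) (Finset.insert_subset hv (hK.trans hW)) (by
    intro x hx y hy hxy
    rcases Finset.mem_insert.mp hx with h1 | h1 <;> rcases Finset.mem_insert.mp hy with h2 | h2
    · exact absurd (h1.trans h2.symm) hxy
    · exact h1 ▸ hadj y (hK h2)
    · exact h2 ▸ (hadj x (hK h1)).symm
    · exact hcl x h1 y h2 hxy)
  rw [Finset.card_insert_of_notMem hvK] at this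
  omega

/-- The recursion finds an optimum solution: with the budget for five vertices per halving of the
number of vertices, every solution is reached. -/
theorem reach_all (hb : BullFree H) (he : EFree H) (hn : 2 ≤ n) (hk : 0 < k) {s₀ : ℕ}
    (hs₀ : n < 2 ^ s₀) (w : ℕ) : ∀ (s : ℕ) (B A I : Finset ℕ) (d : ℕ), A ⊆ B → A.Nonempty →
      (∀ p ∈ A, p / k < n) → Conn (Conflict H k) A → ConflictFree H k I →
      CliqueLE H (verts k B) w → (verts k A).card < 2 ^ s →
      Reach n k (5 * k * s₀) H B A (5 * k * s + d) (I ∩ A) := by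
  induction w with
  | zero =>
    intro s B A I d hAB hne _ _ _ hw
    obtain ⟨p, hp⟩ := hne
    exact absurd (hw.pos ⟨_, mem_verts.mpr ⟨p, hAB hp, rfl⟩⟩) (lt_irrefl 0)
  | succ w ihw =>
    intro s
    induction s with
    | zero =>
      intro B A I d _ hne _ _ _ _ hcard
      obtain ⟨p, hp⟩ := hne
      have : 0 < (verts k A).card := Finset.card_pos.mpr ⟨_, mem_verts.mpr ⟨p, hp, rfl⟩⟩
      omega
    | succ s ihs =>
      intro B A I d hAB hne hAn hconn hI hw hcard
      have hWn : ∀ v ∈ verts k A, v < n := by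
        intro v hv
        obtain ⟨p, hp, rfl⟩ := mem_verts.mp hv
        exact hAn p hp
      have hAB' := verts_mono (k := k) hAB
      obtain ⟨u₁, h₁, u₂, h₂, u₃, h₃, u₄, h₄, u₅, h₅, hsep⟩ := exists_balanced_separator hb he
        (W := verts k A) (hne.image _) (conn_verts hconn)
      have fresh : ∀ v ∈ verts k A, ∀ C ⊆ A, C.Nonempty → Conn (Conflict H k) C →
          (∀ p ∈ C, H.Adj v (p / k)) → Reach n k (5 * k * s₀) H C C (5 * k * s₀) (I ∩ C) := by
        intro v hv C hCA hCne hC hCv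
        have hCB := verts_mono (k := k) (hCA.trans hAB)
        refine ihw s₀ C C I 0 subset_rfl hCne (fun p hp => hAn p (hCA hp)) hC hI
          (hw.nbhd (hAB' hv) hCB ?_) ?_
        · intro x hx
          obtain ⟨p, hp, rfl⟩ := mem_verts.mp hx
          exact hCv p hp
        · refine lt_of_le_of_lt ?_ hs₀
          have : verts k C ⊆ Finset.range n := fun x hx =>
            Finset.mem_range.mpr (hWn x (verts_mono hCA hx))
          simpa using Finset.card_le_card this
      have step : ∀ v ∈ verts k A, ∀ A' ⊆ A, A'.Nonempty → Conn (Conflict H k) A' → ∀ d',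
          (∀ C ⊆ A', C.Nonempty → Conn (Conflict H k) C → (∀ p ∈ C, ¬ H.Adj v (p / k)) →
            (∀ p ∈ C, p / k = v → p ∈ I) → Reach n k (5 * k * s₀) H B C d' (I ∩ C)) →
          Reach n k (5 * k * s₀) H B A' (d' + k) (I ∩ A') := by
        intro v hv A' hA' hne' hconn' d' h
        exact reach_of_vertex hb he hn hk (fun p hp => hAn p (hA' hp)) hI (hWn v hv) (hAB' hv) hconn'
          (fun C hC => fresh v hv C (hC.trans hA')) h hne'
      have e : 5 * k * (s + 1) + d = 5 * k * s + d + k + k + k + k + k := by ring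
      rw [e]
      refine step u₁ h₁ A subset_rfl hne hconn _ fun C₁ hC₁ n₁ c₁ a₁ i₁ => ?_
      refine step u₂ h₂ C₁ hC₁ n₁ c₁ _ fun C₂ hC₂ n₂ c₂ a₂ i₂ => ?_
      refine step u₃ h₃ C₂ (hC₂.trans hC₁) n₂ c₂ _ fun C₃ hC₃ n₃ c₃ a₃ i₃ => ?_
      refine step u₄ h₄ C₃ (hC₃.trans (hC₂.trans hC₁)) n₃ c₃ _ fun C₄ hC₄ n₄ c₄ a₄ i₄ => ?_
      refine step u₅ h₅ C₄ (hC₄.trans (hC₃.trans (hC₂.trans hC₁))) n₄ c₄ _ fun C hC n₅ c₅ a₅ i₅ => ?_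
      have hC4 := hC
      have hC3 := hC.trans hC₄
      have hC2 := hC3.trans hC₃
      have hC1 := hC2.trans hC₂
      have hCA := hC1.trans hC₁
      -- A component that avoids `N(v)` but contains `v` consists of pairs with the vertex `v` only.
      have isolated : ∀ v, (∀ p ∈ C, ¬ H.Adj v (p / k)) → (∀ p ∈ C, p / k = v → p ∈ I) →
          v ∈ verts k C → Reach n k (5 * k * s₀) H B C (5 * k * s + d) (I ∩ C) := by
        intro v hadj hvI hv
        obtain ⟨p, hp, hpv⟩ := mem_verts.mp hv
        have hall : C = {p} := by
          have hT : C.filter (fun q => q / k = v) = C := c₅ _ (Finset.filter_subset _ _)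
            ⟨p, by simp [hp, hpv]⟩ (by
              intro x hx y hy hxy
              simp only [Finset.mem_filter] at hx ⊢
              refine ⟨hy, ?_⟩
              rcases hxy with ⟨h, -⟩ | ⟨-, h⟩
              · exact h ▸ hx.2
              · exact absurd (hx.2 ▸ h) (hadj y hy))
          refine Finset.eq_singleton_iff_unique_mem.mpr ⟨hp, fun q hq => ?_⟩
          have hq' := hq
          rw [← hT] at hq'
          by_contra hqp
          have hqv := (Finset.mem_filter.mp hq').2
          exact hI q (hvI q hq hqv) p (hvI p hp hpv) (Or.inl ⟨hqv.trans hpv.symm, hqp⟩)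
        have := Reach.single (n := n) (k := k) (D := 5 * k * s₀) (H := H) B (5 * k * s + d) p
          (I ∩ C) (hall ▸ Finset.inter_subset_right)
        rwa [← hall] at this
      by_cases m₁ : u₁ ∈ verts k C
      · exact isolated u₁ (fun p hp => a₁ p (hC1 hp)) (fun p hp => i₁ p (hC1 hp)) m₁
      by_cases m₂ : u₂ ∈ verts k C
      · exact isolated u₂ (fun p hp => a₂ p (hC2 hp)) (fun p hp => i₂ p (hC2 hp)) m₂
      by_cases m₃ : u₃ ∈ verts k C
      · exact isolated u₃ (fun p hp => a₃ p (hC3 hp)) (fun p hp => i₃ p (hC3 hp)) m₃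
      by_cases m₄ : u₄ ∈ verts k C
      · exact isolated u₄ (fun p hp => a₄ p (hC4 hp)) (fun p hp => i₄ p (hC4 hp)) m₄
      by_cases m₅ : u₅ ∈ verts k C
      · exact isolated u₅ a₅ i₅ m₅
      refine ihs B C I d (hCA.trans hAB) n₅ (fun p hp => hAn p (hCA hp)) c₅ hI hw ?_
      have := hsep (verts k C) (verts_mono hCA) (conn_verts c₅) (by
        rintro x hx ⟨u, hu, hux⟩
        obtain ⟨p, hp, rfl⟩ := mem_verts.mp hx
        simp only [List.mem_cons, List.not_mem_nil, or_false] at hu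
        have no : ∀ u, u ∉ verts k C → ¬ H.Adj u (p / k) → ¬ (p / k = u ∨ H.Adj u (p / k)) := by
          rintro u hu hadj (h | h)
          · exact hu (h ▸ hx)
          · exact hadj h
        rcases hu with rfl | rfl | rfl | rfl | rfl
        · exact no _ m₁ (a₁ p (hC1 hp)) hux
        · exact no _ m₂ (a₂ p (hC2 hp)) hux
        · exact no _ m₃ (a₃ p (hC3 hp)) hux
        · exact no _ m₄ (a₄ p (hC4 hp)) hux
        · exact no _ m₅ (a₅ p hp) hux)
      rw [pow_succ] at hcard
      omega

/-- The call for the whole graph, which need not be connected: its first move splits it. -/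
theorem reach_root (hb : BullFree H) (he : EFree H) (hn : 2 ≤ n) (hk : 0 < k) {s₀ w : ℕ}
    (hs₀ : n < 2 ^ s₀) {A I : Finset ℕ} (hAn : ∀ p ∈ A, p / k < n) (hI : ConflictFree H k I)
    (hIA : I ⊆ A) (hw : CliqueLE H (verts k A) w) :
    Reach n k (5 * k * s₀) H A A (5 * k * s₀ + k) I := by
  obtain ⟨j, rfl⟩ : ∃ j, k = j + 1 := ⟨k - 1, by omega⟩
  obtain ⟨a, ha, b, hb', -, hmove⟩ := exists_move (k := j + 1) hb he hn (v := 0) (by omega)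
    ((5 * (j + 1) * s₀ + j + 1) % (j + 1)) hI (fun p hp => hAn p (hIA hp))
  have hcard : ∀ C ⊆ A, (verts (j + 1) C).card < 2 ^ s₀ := by
    intro C hC
    refine lt_of_le_of_lt ?_ hs₀
    have : verts (j + 1) C ⊆ Finset.range n := fun x hx => by
      obtain ⟨p, hp, rfl⟩ := mem_verts.mp hx
      exact Finset.mem_range.mpr (hAn p (hC hp))
    simpa using Finset.card_le_card this
  refine Reach.step A A (5 * (j + 1) * s₀ + j) I 0 a b (by omega) ha hb' (hmove A hIA) fun C hC => ?_
  have hCA : C ⊆ A := hC.subset.trans (Finset.filter_subset _ _)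
  by_cases hf : Fresh H (j + 1) A C 0
  · simp only [hf, if_true]
    exact reach_all hb he hn hk hs₀ w s₀ C C I 0 subset_rfl hC.nonempty (fun p hp => hAn p (hCA hp))
      hC.conn hI (hw.mono (verts_mono hCA)) (hcard C hCA)
  · simp only [hf, if_false]
    exact reach_all hb he hn hk hs₀ w s₀ A C I j hCA hC.nonempty (fun p hp => hAn p (hCA hp))
      hC.conn hI hw (hcard C hCA)

end Pairs

end PartialColoringAlgorithm

namespace PartialColoringAlgorithm

/-! ### A structured language above the random access machine -/

/-- The scalar variables of the program: the number of vertices, of colors, of pairs and of moves and the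
full budget; the level of the current stack frame and the positions of its rows and of its values; loop
variables and search results; the data of the current move. -/
inductive Var where
  | size | colors | pairs | moves | full | lv | fb | vb
  | ix | iy | iz | rf | rg | rh | rt
  | cv | ca | cb | rv | ra | rb | ce
  deriving DecidableEq

/-- The arrays of the program: the adjacency matrix; tables of the vertex and the color of each pair, of
the rows of the matrix and of the moves; the fields of the stack frames; the color table. In a frame,
`set`, `base`, `rest`, `cur` and `best` are rows with one entry per pair, and `bud`, `clr`, `idx` and `phase`
are the budget, the color that belongs to it, the number of the move and the state of the call. -/
inductive Arr where
  | adj | vert | col | row | mv | ma | mb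
  | set | base | rest | cur | best | bud | clr | idx | phase | out
  deriving DecidableEq

/-- The contents of the variables, of the arrays and of the value memory. -/
structure Store where
  /-- The scalar variables. -/
  s : Var → ℕ
  /-- The arrays. -/
  w : Arr → ℕ → ℕ
  /-- The value cells. -/
  v : ℕ → ℚ

/-- Word expressions. -/
inductive Ex where
  | num (a : ℕ)
  | var (x : Var)
  | rd (j : Arr) (e : Ex)
  | add (e f : Ex)
  | sub (e f : Ex)

/-- Value expressions. -/
inductive VEx where
  | zero
  | get (e : Ex)
  | add (e f : VEx)

/-- Conditions. -/
inductive Cond where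
  | eq (e f : Ex)
  | lt (e f : Ex)
  | vlt (e f : VEx)
  | neg (c : Cond)
  | conj (c d : Cond)
  | disj (c d : Cond)

/-- Statements. -/
inductive Stmt where
  | skip
  | set (x : Var) (e : Ex)
  | wr (j : Arr) (i e : Ex)
  | setv (i : Ex) (e : VEx)
  | seq (p q : Stmt)
  | ifc (c : Cond) (p q : Stmt)
  | loop (e f : Ex) (p : Stmt)

/-- The word denoted by an expression. -/
@[simp] def Ex.eval (σ : Store) : Ex → ℕ
  | .num a => a
  | .var x => σ.s x
  | .rd j e => σ.w j (e.eval σ)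
  | .add e f => e.eval σ + f.eval σ
  | .sub e f => e.eval σ - f.eval σ

/-- The value denoted by an expression. -/
@[simp] def VEx.eval (σ : Store) : VEx → ℚ
  | .zero => 0
  | .get e => σ.v (e.eval σ)
  | .add e f => e.eval σ + f.eval σ

/-- The truth of a condition. -/
@[simp] def Cond.Holds (σ : Store) : Cond → Prop
  | .eq e f => e.eval σ = f.eval σ
  | .lt e f => e.eval σ < f.eval σ
  | .vlt e f => e.eval σ < f.eval σ
  | .neg c => ¬ c.Holds σ
  | .conj c d => c.Holds σ ∧ d.Holds σ
  | .disj c d => c.Holds σ ∨ d.Holds σ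

namespace Store

/-- Assignment to a scalar variable. -/
def setS (σ : Store) (x : Var) (a : ℕ) : Store := { σ with s := Function.update σ.s x a }

/-- Assignment to an array entry. -/
def setW (σ : Store) (j : Arr) (i a : ℕ) : Store :=
  { σ with w := Function.update σ.w j (Function.update (σ.w j) i a) }

/-- Assignment to a value cell. -/
def setV (σ : Store) (i : ℕ) (a : ℚ) : Store := { σ with v := Function.update σ.v i a }

variable (σ : Store) (x y : Var) (j j' : Arr) (i i' a : ℕ) (q : ℚ)

@[simp] theorem setS_s : (σ.setS x a).s = Function.update σ.s x a := rfl
@[simp] theorem setS_w : (σ.setS x a).w = σ.w := rfl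
@[simp] theorem setS_v : (σ.setS x a).v = σ.v := rfl
@[simp] theorem setW_s : (σ.setW j i a).s = σ.s := rfl
@[simp] theorem setW_w :
    (σ.setW j i a).w = Function.update σ.w j (Function.update (σ.w j) i a) := rfl
@[simp] theorem setW_v : (σ.setW j i a).v = σ.v := rfl
@[simp] theorem setV_s : (σ.setV i q).s = σ.s := rfl
@[simp] theorem setV_w : (σ.setV i q).w = σ.w := rfl
@[simp] theorem setV_v : (σ.setV i q).v = Function.update σ.v i q := rfl

end Store

/-- `Exec p σ t σ'`: the statement `p` turns `σ` into `σ'` in `t` ticks. A tick stands for one assignment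
or one test, and costs a bounded number of machine steps. -/
inductive Exec : Stmt → Store → ℕ → Store → Prop where
  | skip (σ) : Exec .skip σ 1 σ
  | set (σ x e) : Exec (.set x e) σ 1 (σ.setS x (e.eval σ))
  | wr (σ j i e) : Exec (.wr j i e) σ 1 (σ.setW j (i.eval σ) (e.eval σ))
  | setv (σ i e) : Exec (.setv i e) σ 1 (σ.setV (i.eval σ) (e.eval σ))
  | seq {p q σ₁ σ₂ σ₃ s t} : Exec p σ₁ s σ₂ → Exec q σ₂ t σ₃ → Exec (.seq p q) σ₁ (s + t) σ₃
  | ifTrue {c p q σ σ' t} : c.Holds σ → Exec p σ t σ' → Exec (.ifc c p q) σ (t + 1) σ'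
  | ifFalse {c p q σ σ' t} : ¬ c.Holds σ → Exec q σ t σ' → Exec (.ifc c p q) σ (t + 1) σ'
  | loopTrue {e f p σ₁ σ₂ σ₃ s t} : e.eval σ₁ < f.eval σ₁ → Exec p σ₁ s σ₂ →
      Exec (.loop e f p) σ₂ t σ₃ → Exec (.loop e f p) σ₁ (s + t + 1) σ₃
  | loopFalse {e f p σ} : ¬ e.eval σ < f.eval σ → Exec (.loop e f p) σ 1 σ

/-! ### Translation to the random access machine -/

/-- The position of a variable in memory. -/
def Var.code : Var → ℕ
  | size => 0 | colors => 1 | pairs => 2 | moves => 3 | full => 4 | lv => 5 | fb => 6 | vb => 7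
  | ix => 8 | iy => 9 | iz => 10 | rf => 11 | rg => 12 | rh => 13 | rt => 14
  | cv => 15 | ca => 16 | cb => 17 | rv => 18 | ra => 19 | rb => 20 | ce => 21

/-- The residue class modulo `32` of the addresses of an array; class `0` holds the variables. -/
def Arr.code : Arr → ℕ
  | adj => 1 | vert => 2 | col => 3 | row => 4 | mv => 5 | ma => 6 | mb => 7
  | set => 8 | base => 9 | rest => 10 | cur => 11 | best => 12 | bud => 13 | clr => 14 | idx => 15
  | phase => 16 | out => 17

theorem Var.code_injective : Function.Injective Var.code := by
  intro x y h
  cases x <;> cases y <;> first | rfl | (simp [Var.code] at h)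

theorem Arr.code_injective : Function.Injective Arr.code := by
  intro x y h
  cases x <;> cases y <;> first | rfl | (simp [Arr.code] at h)

theorem Arr.code_pos (j : Arr) : 0 < j.code := by cases j <;> simp [Arr.code]

theorem Arr.code_lt (j : Arr) : j.code < 32 := by cases j <;> simp [Arr.code]

open RAM

/-- Doubling an expression. -/
def double (e : WordExpr) : WordExpr := .add e e

/-- The base address of the working memory, kept in word cell `0`. -/
def basePtr : WordExpr := .load (.num 0)

/-- The address of a variable. -/
def Var.addr (x : Var) : WordExpr := .add basePtr (.num (32 * x.code))

/-- The address of an array entry with a translated index. -/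
def Arr.addr (j : Arr) (e : WordExpr) : WordExpr :=
  .add basePtr (.add (double (double (double (double (double e))))) (.num j.code))

/-- Translation of word expressions. -/
def Ex.code : Ex → WordExpr
  | .num a => .num a
  | .var x => .load x.addr
  | .rd j e => .load (j.addr e.code)
  | .add e f => .add e.code f.code
  | .sub e f => .sub e.code f.code

/-- Translation of value expressions. -/
def VEx.code : VEx → ValExpr
  | .zero => .zero
  | .get e => .load e.code
  | .add e f => .add e.code f.code

/-- Translation of conditional statements. -/
def Cond.code : Cond → Program → Program → Program
  | .eq e f, p, q => .ite (.wordEq e.code f.code) p q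
  | .lt e f, p, q => .ite (.wordLt e.code f.code) p q
  | .vlt e f, p, q => .ite (.valLt e.code f.code) p q
  | .neg c, p, q => c.code q p
  | .conj c d, p, q => c.code (d.code p q) q
  | .disj c d, p, q => c.code p (d.code p q)

/-- Translation of statements. -/
def Stmt.code : Stmt → Program
  | .skip => .skip
  | .set x e => .setWord x.addr e.code
  | .wr j i e => .setWord (j.addr i.code) e.code
  | .setv i e => .setVal i.code e.code
  | .seq p q => .seq p.code q.code
  | .ifc c p q => c.code p.code q.code
  | .loop e f p => .loop (.wordLt e.code f.code) p.code

/-- The cost of a translated word expression. -/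
def Ex.cost : Ex → ℕ
  | .num _ => 1
  | .var _ => 5
  | .rd _ e => 32 * e.cost + 37
  | .add e f => e.cost + f.cost + 1
  | .sub e f => e.cost + f.cost + 1

/-- The cost of a translated value expression. -/
def VEx.cost : VEx → ℕ
  | .zero => 1
  | .get e => e.cost + 1
  | .add e f => e.cost + f.cost + 1

/-- A bound for the cost of the tests of a translated condition. -/
def Cond.cost : Cond → ℕ
  | .eq e f => e.cost + f.cost + 1
  | .lt e f => e.cost + f.cost + 1
  | .vlt e f => e.cost + f.cost + 1
  | .neg c => c.cost
  | .conj c d => c.cost + d.cost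
  | .disj c d => c.cost + d.cost

/-- The largest number of machine steps behind one tick of a statement. -/
def Stmt.tick : Stmt → ℕ
  | .skip => 1
  | .set _ e => e.cost + 5
  | .wr _ i e => 32 * i.cost + e.cost + 37
  | .setv i e => i.cost + e.cost + 1
  | .seq p q => max p.tick q.tick
  | .ifc c p q => max c.cost (max p.tick q.tick)
  | .loop e f p => max (e.cost + f.cost + 1) p.tick

theorem Ex.cost_code (e : Ex) : e.code.cost = e.cost := by
  induction e with
  | num => rfl
  | var => rfl
  | rd j e ih =>
    simp only [Ex.code, Arr.addr, basePtr, double, WordExpr.cost, Ex.cost, ih]; omega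
  | add e f ihe ihf => simp only [Ex.code, WordExpr.cost, Ex.cost, ihe, ihf]
  | sub e f ihe ihf => simp only [Ex.code, WordExpr.cost, Ex.cost, ihe, ihf]

theorem VEx.cost_code (e : VEx) : e.code.cost = e.cost := by
  induction e with
  | zero => rfl
  | get e => simp only [VEx.code, ValExpr.cost, VEx.cost, Ex.cost_code]
  | add e f ihe ihf => simp only [VEx.code, ValExpr.cost, VEx.cost, ihe, ihf]

/-- The memory `m` represents the store `σ`, with the working memory starting at address `Z`. -/
structure Rep (Z : ℕ) (m : Memory) (σ : Store) : Prop where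
  base : m.word 0 = Z
  pos : 0 < Z
  var : ∀ x : Var, m.word (Z + 32 * x.code) = σ.s x
  arr : ∀ (j : Arr) (i : ℕ), m.word (Z + (32 * i + j.code)) = σ.w j i
  val : m.val = σ.v

variable {Z : ℕ} {m : Memory} {σ : Store}

theorem Rep.eval_var_addr (h : Rep Z m σ) (x : Var) : x.addr.eval m = Z + 32 * x.code := by
  simp only [Var.addr, basePtr, WordExpr.eval, h.base]

theorem Rep.eval_arr_addr (h : Rep Z m σ) (j : Arr) (e : WordExpr) :
    (j.addr e).eval m = Z + (32 * e.eval m + j.code) := by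
  simp only [Arr.addr, basePtr, double, WordExpr.eval, h.base]; omega

theorem Rep.eval (h : Rep Z m σ) (e : Ex) : e.code.eval m = e.eval σ := by
  induction e with
  | num => rfl
  | var x => simp only [Ex.code, WordExpr.eval, h.eval_var_addr, h.var, Ex.eval]
  | rd j e ih => simp only [Ex.code, WordExpr.eval, h.eval_arr_addr, ih, h.arr, Ex.eval]
  | add e f ihe ihf => simp only [Ex.code, WordExpr.eval, ihe, ihf, Ex.eval]
  | sub e f ihe ihf => simp only [Ex.code, WordExpr.eval, ihe, ihf, Ex.eval]

theorem Rep.evalV (h : Rep Z m σ) (e : VEx) : e.code.eval m = e.eval σ := by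
  induction e with
  | zero => rfl
  | get e => simp only [VEx.code, ValExpr.eval, h.eval, h.val, VEx.eval]
  | add e f ihe ihf => simp only [VEx.code, ValExpr.eval, ihe, ihf, VEx.eval]

theorem Rep.setS (h : Rep Z m σ) (x : Var) (a : ℕ) :
    Rep Z (m.setWord (Z + 32 * x.code) a) (σ.setS x a) := by
  have hp := h.pos
  refine ⟨?_, hp, fun y => ?_, fun j i => ?_, h.val⟩
  · simp only [Memory.setWord]
    rw [Function.update_of_ne (by omega), h.base]
  · by_cases hxy : y = x
    · subst hxy; simp [Memory.setWord]
    · have : y.code ≠ x.code := fun h' => hxy (Var.code_injective h')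
      simp only [Memory.setWord, Store.setS_s]
      rw [Function.update_of_ne (by omega), Function.update_of_ne hxy, h.var]
  · have := j.code_pos; have := j.code_lt
    simp only [Memory.setWord, Store.setS_w]
    rw [Function.update_of_ne (by omega), h.arr]

theorem Rep.setW (h : Rep Z m σ) (j : Arr) (i a : ℕ) :
    Rep Z (m.setWord (Z + (32 * i + j.code)) a) (σ.setW j i a) := by
  have hp := h.pos
  have hj := j.code_pos; have hj' := j.code_lt
  refine ⟨?_, hp, fun y => ?_, fun j' i' => ?_, h.val⟩
  · simp only [Memory.setWord]
    rw [Function.update_of_ne (by omega), h.base]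
  · simp only [Memory.setWord, Store.setW_s]
    rw [Function.update_of_ne (by omega), h.var]
  · have := j'.code_pos; have := j'.code_lt
    simp only [Memory.setWord, Store.setW_w]
    by_cases hjj : j' = j
    · subst hjj
      rw [Function.update_self]
      by_cases hii : i' = i
      · subst hii; simp
      · rw [Function.update_of_ne (by omega), Function.update_of_ne hii, h.arr]
    · have : j'.code ≠ j.code := fun h' => hjj (Arr.code_injective h')
      rw [Function.update_of_ne (by omega), Function.update_of_ne hjj, h.arr]

theorem Rep.setV (h : Rep Z m σ) (i : ℕ) (a : ℚ) : Rep Z (m.setVal i a) (σ.setV i a) :=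
  ⟨h.base, h.pos, h.var, h.arr, by simp only [Memory.setVal, Store.setV_v, h.val]⟩

theorem Cond.runs (h : Rep Z m σ) (c : Cond) : ∀ {p q : Program} {t : ℕ} {m' : Memory},
    (c.Holds σ → p.Runs m t m') → (¬ c.Holds σ → q.Runs m t m') →
      ∃ t' ≤ c.cost + t, (c.code p q).Runs m t' m' := by
  have simple : ∀ (b : Test) (P : Prop) (_ : b.Holds m ↔ P) {p q : Program} {t : ℕ} {m' : Memory},
      (P → p.Runs m t m') → (¬ P → q.Runs m t m') → (Program.ite b p q).Runs m (b.cost + t) m' := by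
    intro b P hb p q t m' hp hq
    by_cases hP : P
    · exact .iteTrue (hb.mpr hP) (hp hP)
    · exact .iteFalse (fun h => hP (hb.mp h)) (hq hP)
  induction c with
  | eq e f =>
    intro p q t m' hp hq
    refine ⟨_, ?_, simple (.wordEq e.code f.code) _ ?_ hp hq⟩
    · simp only [Test.cost, Ex.cost_code, Cond.cost, le_refl]
    · simp only [Test.Holds, h.eval, Cond.Holds]
  | lt e f =>
    intro p q t m' hp hq
    refine ⟨_, ?_, simple (.wordLt e.code f.code) _ ?_ hp hq⟩
    · simp only [Test.cost, Ex.cost_code, Cond.cost, le_refl]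
    · simp only [Test.Holds, h.eval, Cond.Holds]
  | vlt e f =>
    intro p q t m' hp hq
    refine ⟨_, ?_, simple (.valLt e.code f.code) _ ?_ hp hq⟩
    · simp only [Test.cost, VEx.cost_code, Cond.cost, le_refl]
    · simp only [Test.Holds, h.evalV, Cond.Holds]
  | neg c ih =>
    intro p q t m' hp hq
    exact ih (fun h => hq (not_not.mpr h)) fun h => hp h
  | conj c d ihc ihd =>
    intro p q t m' hp hq
    by_cases hc : c.Holds σ
    · obtain ⟨s, hs, hr⟩ := ihd (fun hd => hp ⟨hc, hd⟩) fun hd => hq fun h => hd h.2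
      obtain ⟨s', hs', hr'⟩ := ihc (q := q) (fun _ => hr) fun h => absurd hc h
      exact ⟨s', by simp only [Cond.cost]; omega, hr'⟩
    · obtain ⟨s', hs', hr'⟩ := ihc (p := d.code p q) (fun h => absurd h hc) fun _ =>
        hq fun h => hc h.1
      exact ⟨s', by simp only [Cond.cost]; omega, hr'⟩
  | disj c d ihc ihd =>
    intro p q t m' hp hq
    by_cases hc : c.Holds σ
    · obtain ⟨s', hs', hr'⟩ := ihc (q := d.code p q) (fun _ => hp (Or.inl hc)) fun h => absurd hc h
      exact ⟨s', by simp only [Cond.cost]; omega, hr'⟩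
    · obtain ⟨s, hs, hr⟩ := ihd (fun hd => hp (Or.inr hd)) fun hd => hq fun h => h.elim hc hd
      obtain ⟨s', hs', hr'⟩ := ihc (p := p) (fun h => absurd h hc) fun _ => hr
      exact ⟨s', by simp only [Cond.cost]; omega, hr'⟩

/-- The translation is correct, with `K` machine steps for each tick. -/
theorem Exec.runs {K : ℕ} {p : Stmt} {σ σ' : Store} {t : ℕ} (h : Exec p σ t σ') (hK : p.tick ≤ K) :
    ∀ {m : Memory}, Rep Z m σ → ∃ t' m', t' ≤ K * t ∧ p.code.Runs m t' m' ∧ Rep Z m' σ' := by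
  induction h with
  | skip σ => exact fun hr => ⟨_, _, by simpa [Stmt.tick] using hK, .skip _, hr⟩
  | set σ x e =>
    intro m hr
    refine ⟨_, _, ?_, .setWord _ _ _, ?_⟩
    · simp only [Stmt.tick] at hK
      rw [Ex.cost_code]
      simp only [Var.addr, basePtr, WordExpr.cost]; omega
    · rw [hr.eval_var_addr, hr.eval]; exact hr.setS _ _
  | wr σ j i e =>
    intro m hr
    refine ⟨_, _, ?_, .setWord _ _ _, ?_⟩
    · simp only [Stmt.tick] at hK
      rw [Ex.cost_code]
      simp only [Arr.addr, double, basePtr, WordExpr.cost, Ex.cost_code]; omega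
    · rw [hr.eval_arr_addr, hr.eval, hr.eval]; exact hr.setW _ _ _
  | setv σ i e =>
    intro m hr
    refine ⟨_, _, ?_, .setVal _ _ _, ?_⟩
    · simp only [Stmt.tick] at hK
      rw [Ex.cost_code, VEx.cost_code]; omega
    · rw [hr.evalV, hr.eval]; exact hr.setV _ _
  | seq _ _ ih₁ ih₂ =>
    intro m hr
    simp only [Stmt.tick, max_le_iff] at hK
    obtain ⟨t₁, m₁, h₁, r₁, hr₁⟩ := ih₁ hK.1 hr
    obtain ⟨t₂, m₂, h₂, r₂, hr₂⟩ := ih₂ hK.2 hr₁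
    exact ⟨_, m₂, by rw [Nat.mul_add]; omega, .seq r₁ r₂, hr₂⟩
  | ifTrue hc _ ih =>
    intro m hr
    simp only [Stmt.tick, max_le_iff] at hK
    obtain ⟨t₁, m₁, h₁, r₁, hr₁⟩ := ih hK.2.1 hr
    obtain ⟨t₂, h₂, r₂⟩ := Cond.runs hr _ (fun _ => r₁) fun h => absurd hc h
    exact ⟨t₂, m₁, by rw [Nat.mul_add]; omega, r₂, hr₁⟩
  | ifFalse hc _ ih =>
    intro m hr
    simp only [Stmt.tick, max_le_iff] at hK
    obtain ⟨t₁, m₁, h₁, r₁, hr₁⟩ := ih hK.2.2 hr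
    obtain ⟨t₂, h₂, r₂⟩ := Cond.runs hr _ (fun h => absurd h hc) fun _ => r₁
    exact ⟨t₂, m₁, by rw [Nat.mul_add]; omega, r₂, hr₁⟩
  | loopTrue hc _ _ ih₁ ih₂ =>
    intro m hr
    have hK' := hK
    simp only [Stmt.tick, max_le_iff] at hK'
    obtain ⟨t₁, m₁, h₁, r₁, hr₁⟩ := ih₁ hK'.2 hr
    obtain ⟨t₂, m₂, h₂, r₂, hr₂⟩ := ih₂ hK hr₁
    refine ⟨_, m₂, ?_, .loopTrue ?_ r₁ r₂, hr₂⟩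
    · simp only [Test.cost, Ex.cost_code, Nat.mul_add]; omega
    · simpa only [Test.Holds, hr.eval] using hc
  | loopFalse hc =>
    intro m hr
    refine ⟨_, m, ?_, .loopFalse ?_, hr⟩
    · simp only [Stmt.tick, max_le_iff] at hK
      simp only [Test.cost, Ex.cost_code]; omega
    · simpa only [Test.Holds, hr.eval] using hc

/-! ### Rules for total correctness with time bounds -/

/-- The statement `p`, started in `σ`, halts within `T` ticks in a store that satisfies `Q`. -/
def Run (p : Stmt) (σ : Store) (T : ℕ) (Q : Store → Prop) : Prop :=
  ∃ t σ', t ≤ T ∧ Exec p σ t σ' ∧ Q σ'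

namespace Run

variable {p q : Stmt} {σ : Store} {T T₁ T₂ : ℕ} {Q R : Store → Prop} {c : Cond} {e f : Ex} {x : Var}

theorem mono (h : Run p σ T R) (hT : T ≤ T₁) (hQ : ∀ σ', R σ' → Q σ') : Run p σ T₁ Q := by
  obtain ⟨t, σ', h₁, h₂, h₃⟩ := h
  exact ⟨t, σ', h₁.trans hT, h₂, hQ _ h₃⟩

theorem weaken (h : Run p σ T Q) (hT : T ≤ T₁) : Run p σ T₁ Q := h.mono hT fun _ => id

theorem skip (h : Q σ) : Run .skip σ 1 Q := ⟨1, σ, le_rfl, .skip σ, h⟩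

theorem set (h : Q (σ.setS x (e.eval σ))) : Run (.set x e) σ 1 Q :=
  ⟨1, _, le_rfl, .set σ x e, h⟩

theorem wr {j : Arr} {i : Ex} (h : Q (σ.setW j (i.eval σ) (e.eval σ))) : Run (.wr j i e) σ 1 Q :=
  ⟨1, _, le_rfl, .wr σ j i e, h⟩

theorem setv {i : Ex} {e : VEx} (h : Q (σ.setV (i.eval σ) (e.eval σ))) : Run (.setv i e) σ 1 Q :=
  ⟨1, _, le_rfl, .setv σ i e, h⟩

theorem seq (h : Run p σ T₁ fun σ' => Run q σ' T₂ Q) : Run (.seq p q) σ (T₁ + T₂) Q := by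
  obtain ⟨t₁, σ₁, h₁, r₁, t₂, σ₂, h₂, r₂, h⟩ := h
  exact ⟨t₁ + t₂, σ₂, by omega, .seq r₁ r₂, h⟩

theorem ifc (hp : c.Holds σ → Run p σ T Q) (hq : ¬ c.Holds σ → Run q σ T Q) :
    Run (.ifc c p q) σ (T + 1) Q := by
  by_cases hc : c.Holds σ
  · obtain ⟨t, σ', h, r, hQ⟩ := hp hc
    exact ⟨t + 1, σ', by omega, .ifTrue hc r, hQ⟩
  · obtain ⟨t, σ', h, r, hQ⟩ := hq hc
    exact ⟨t + 1, σ', by omega, .ifFalse hc r, hQ⟩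

theorem loop_true (hc : e.eval σ < f.eval σ) (h : Run p σ T₁ fun σ' => Run (.loop e f p) σ' T₂ Q) :
    Run (.loop e f p) σ (T₁ + T₂ + 1) Q := by
  obtain ⟨t₁, σ₁, h₁, r₁, t₂, σ₂, h₂, r₂, h⟩ := h
  exact ⟨t₁ + t₂ + 1, σ₂, by omega, .loopTrue hc r₁ r₂, h⟩

theorem loop_false (hc : ¬ e.eval σ < f.eval σ) (h : Q σ) : Run (.loop e f p) σ 1 Q :=
  ⟨1, σ, le_rfl, .loopFalse hc, h⟩

end Run

/-- The loop `for x < e`. -/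
def forLoop (x : Var) (e : Ex) (p : Stmt) : Stmt :=
  .seq (.set x (.num 0)) (.loop (.var x) e (.seq p (.set x (.add (.var x) (.num 1)))))

theorem Run.forLoop {x : Var} {e : Ex} {p : Stmt} {σ : Store} {T : ℕ} {Q : Store → Prop}
    (B : ℕ) (Inv : ℕ → Store → Prop) (h0 : Inv 0 (σ.setS x 0))
    (he : ∀ i ≤ B, ∀ σ', σ'.s x = i → Inv i σ' → e.eval σ' = B)
    (hb : ∀ i < B, ∀ σ', σ'.s x = i → Inv i σ' →
      Run p σ' T fun σ'' => σ''.s x = i ∧ Inv (i + 1) (σ''.setS x (i + 1)))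
    (hQ : ∀ σ', σ'.s x = B → Inv B σ' → Q σ') :
    Run (forLoop x e p) σ (B * (T + 2) + 2) Q := by
  have key : ∀ r i, i + r = B → ∀ σ', σ'.s x = i → Inv i σ' →
      Run (.loop (.var x) e (.seq p (.set x (.add (.var x) (.num 1))))) σ' (r * (T + 2) + 1) Q := by
    intro r
    induction r with
    | zero =>
      intro i hi σ' hx hInv
      have hiB : i = B := by omega
      subst hiB
      refine Run.weaken (.loop_false ?_ (hQ σ' hx hInv)) (by omega)
      simp [hx, he i le_rfl σ' hx hInv]
    | succ r ih =>
      intro i hi σ' hx hInv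
      refine Run.weaken (Run.loop_true (T₁ := T + 1) (T₂ := r * (T + 2) + 1) ?_ ?_) (by
        rw [Nat.add_mul]; omega)
      · simp [hx, he i (by omega) σ' hx hInv]; omega
      · refine Run.seq ((hb i (by omega) σ' hx hInv).mono le_rfl fun σ'' h => ?_)
        refine Run.set (ih (i + 1) (by omega) _ ?_ ?_)
        · simp [h.1]
        · simpa [h.1] using h.2
  refine Run.weaken (Run.seq (T₁ := 1) (T₂ := B * (T + 2) + 1) (Run.set (key B 0 (by omega) _ ?_ ?_)))
    (by omega)
  · simp
  · simpa using h0

/-- Search for an index below `N` with a given property; the result is `N` if there is none. -/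
def search (x f : Var) (c : Cond) : Stmt :=
  .seq (.set f (.var .pairs)) (forLoop x (.var .pairs) (.ifc c (.set f (.var x)) .skip))

theorem Run.search {x f : Var} {c : Cond} {σ : Store} {Q : Store → Prop} {N : ℕ} (P : ℕ → Prop)
    (hN : σ.s .pairs = N) (hxf : x ≠ f) (hxN : x ≠ .pairs) (hfN : f ≠ .pairs)
    (hc : ∀ i < N, ∀ s' : Var → ℕ, (∀ y, y ≠ x → y ≠ f → s' y = σ.s y) → s' x = i →
      (c.Holds ⟨s', σ.w, σ.v⟩ ↔ P i))
    (hQ : ∀ s' : Var → ℕ, (∀ y, y ≠ x → y ≠ f → s' y = σ.s y) →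
      (s' f < N ∧ P (s' f)) ∨ (s' f = N ∧ ∀ i < N, ¬ P i) → Q ⟨s', σ.w, σ.v⟩) :
    Run (search x f c) σ (4 * N + 3) Q := by
  refine Run.weaken (Run.seq (T₁ := 1) (T₂ := N * (2 + 2) + 2) (Run.set ?_)) (by omega)
  refine Run.forLoop N (fun i σ' => (∀ y, y ≠ x → y ≠ f → σ'.s y = σ.s y) ∧ σ'.w = σ.w ∧ σ'.v = σ.v ∧
    ((σ'.s f < N ∧ P (σ'.s f)) ∨ (σ'.s f = N ∧ ∀ i' < i, ¬ P i'))) ?_ ?_ ?_ ?_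
  · refine ⟨fun y hy hy' => by simp [hy, hy'], rfl, rfl, Or.inr ⟨by simp [hxf.symm, hN], by simp⟩⟩
  · rintro i - σ' - ⟨h, -⟩
    simp [h .pairs hxN.symm hfN.symm, hN]
  · rintro i hi σ' hx ⟨h₁, h₂, h₃, h₄⟩
    have hh := hc i hi σ'.s h₁ hx
    rw [← h₂, ← h₃] at hh
    refine Run.ifc (fun hcond => Run.set ?_) (fun hcond => Run.skip ?_)
    · refine ⟨by simp [hxf, hx], fun y hy hy' => by simp [hy, hy', h₁ y hy hy'], h₂, h₃, Or.inl ?_⟩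
      simp [hxf.symm, hx, hi, hh.mp hcond]
    · refine ⟨hx, fun y hy hy' => by simp [hy, h₁ y hy hy'], h₂, h₃, ?_⟩
      simp only [Store.setS_s, Function.update_of_ne hxf.symm]
      refine h₄.imp id fun h => ⟨h.1, fun i' hi' => ?_⟩
      rcases Nat.lt_succ_iff_lt_or_eq.mp hi' with h' | rfl
      · exact h.2 i' h'
      · exact fun h' => hcond (hh.mpr h')
  · rintro ⟨s', w', v'⟩ - ⟨h₁, h₂, h₃, h₄⟩
    simp only at h₁ h₂ h₃ h₄
    subst h₂ h₃
    exact hQ s' h₁ h₄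

/-- The array `a` with the entries at `b, …, b + i - 1` replaced by `g 0, …, g (i - 1)`. -/
def overwrite (a : ℕ → ℕ) (b i : ℕ) (g : ℕ → ℕ) (q : ℕ) : ℕ :=
  if b ≤ q ∧ q < b + i then g (q - b) else a q

theorem overwrite_succ (a : ℕ → ℕ) (b i : ℕ) (g : ℕ → ℕ) :
    overwrite a b (i + 1) g = Function.update (overwrite a b i g) (b + i) (g i) := by
  funext q
  by_cases hq : q = b + i
  · subst hq; simp [overwrite]
  · rw [Function.update_of_ne hq]
    have : (b ≤ q ∧ q < b + (i + 1)) ↔ (b ≤ q ∧ q < b + i) := by omega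
    simp only [overwrite, this]

/-- A loop that fills the entries `b, …, b + N - 1` of an array, with scratch variables `X`. -/
theorem Run.fill {x : Var} {p : Stmt} {σ : Store} {Q : Store → Prop} {N T : ℕ} (X : List Var)
    (j : Arr) (b : ℕ) (g : ℕ → ℕ) (hN : σ.s .pairs = N) (hxN : x ≠ .pairs) (hXN : .pairs ∉ X) (hxX : x ∉ X)
    (hb : ∀ i < N, ∀ s' : Var → ℕ, (∀ y, y ≠ x → y ∉ X → s' y = σ.s y) → s' x = i →
      Run p ⟨s', Function.update σ.w j (overwrite (σ.w j) b i g), σ.v⟩ T fun σ'' =>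
        (∀ y ∉ X, σ''.s y = s' y) ∧
        σ''.w = Function.update σ.w j (overwrite (σ.w j) b (i + 1) g) ∧ σ''.v = σ.v)
    (hQ : ∀ s' : Var → ℕ, (∀ y, y ≠ x → y ∉ X → s' y = σ.s y) →
      Q ⟨s', Function.update σ.w j (overwrite (σ.w j) b N g), σ.v⟩) :
    Run (PartialColoringAlgorithm.forLoop x (.var .pairs) p) σ (N * (T + 2) + 2) Q := by
  refine Run.forLoop N (fun i σ' => (∀ y, y ≠ x → y ∉ X → σ'.s y = σ.s y) ∧
    σ'.w = Function.update σ.w j (overwrite (σ.w j) b i g) ∧ σ'.v = σ.v) ?_ ?_ ?_ ?_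
  · refine ⟨fun y hy _ => by simp [hy], ?_, rfl⟩
    have : overwrite (σ.w j) b 0 g = σ.w j := by
      funext q
      simp only [overwrite]
      rw [if_neg (by omega)]
    rw [this, Function.update_eq_self]; rfl
  · rintro i - σ' - ⟨h, -⟩
    simp [h .pairs hxN.symm hXN, hN]
  · rintro i hi ⟨s', w', v'⟩ hx ⟨h₁, h₂, h₃⟩
    simp only at h₁ h₂ h₃ hx
    subst h₂ h₃
    refine (hb i hi s' h₁ hx).mono le_rfl fun σ'' h => ⟨(h.1 x hxX).trans hx, fun y hy hyX => ?_,
      h.2.1, h.2.2⟩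
    simp [hy, h.1 y hyX, h₁ y hy hyX]
  · rintro ⟨s', w', v'⟩ - ⟨h₁, h₂, h₃⟩
    simp only at h₁ h₂ h₃
    subst h₂ h₃
    exact hQ s' h₁

end PartialColoringAlgorithm

namespace PartialColoringAlgorithm

/-! ### The program -/

/-- The condition that an array entry equals `1`. -/
def isOne (j : Arr) (e : Ex) : Cond := .eq (.rd j e) (.num 1)

/-- Position `x` in the row of the current frame. -/
def here (x : Var) : Ex := .add (.var .fb) (.var x)

/-- Position `x` in the row of the next frame. -/
def above (x : Var) : Ex := .add (.add (.var .fb) (.var .pairs)) (.var x)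

/-- Position `x` in the row of the previous frame. -/
def below (x : Var) : Ex := .add (.sub (.var .fb) (.var .pairs)) (.var x)

/-- The vertex of the pair `x`. -/
def vtx (x : Var) : Ex := .rd .vert (.var x)

/-- The color of the pair `x`. -/
def clrOf (x : Var) : Ex := .rd .col (.var x)

/-- Adjacency to the vertex of the pair `x`, for the row of the adjacency matrix starting at `r`. -/
def adjTo (r : Ex) (x : Var) : Cond := isOne .adj (.add r (vtx x))

/-- Conflict of the pairs `x` and `y`. -/
def conflictCond (x y : Var) : Cond :=
  .disj (.conj (.eq (vtx x) (vtx y)) (.neg (.eq (.var x) (.var y))))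
    (.conj (.eq (clrOf x) (clrOf y)) (adjTo (.rd .row (vtx x)) y))

/-- Filling a row with the indicator of a condition on the loop variable `ix`. -/
def fillIf (j : Arr) (pos : Ex) (c : Cond) : Stmt :=
  forLoop .ix (.var .pairs) (.ifc c (.wr j pos (.num 1)) (.wr j pos (.num 0)))

/-- Entering a call: the first candidate solution is a single pair. Without budget no moves are tried. -/
def enter : Stmt :=
  .seq (search .ix .rf (isOne .set (here .ix)))
  (.seq (fillIf .best (here .ix) (.eq (.var .ix) (.var .rf)))
  (.seq (.setv (.var .vb) (.get (.var .rf)))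
  (.seq (.wr .phase (.var .lv) (.num 1))
  (.ifc (.eq (.rd .bud (.var .lv)) (.num 0)) (.wr .idx (.var .lv) (.var .moves))
    (.wr .idx (.var .lv) (.num 0))))))

/-- Loading the current move. -/
def loadMove : Stmt :=
  .seq (.set .cv (.rd .mv (.rd .idx (.var .lv))))
  (.seq (.set .ca (.rd .ma (.rd .idx (.var .lv))))
  (.seq (.set .cb (.rd .mb (.rd .idx (.var .lv))))
  (.seq (.set .rv (.rd .row (.var .cv)))
  (.seq (.set .ra (.rd .row (.var .ca)))
  (.seq (.set .rb (.rd .row (.var .cb)))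
  (.set .ce (.rd .clr (.var .lv))))))))

/-- Applying the current move to the set of the frame. -/
def applyMove : Stmt :=
  forLoop .ix (.var .pairs)
    (.seq (search .iy .rf
      (.conj (isOne .set (here .iy)) (.conj (.eq (clrOf .iy) (.var .ce))
        (.conj (adjTo (.var .rv) .iy) (.conj (.neg (adjTo (.var .ra) .iy))
          (.conj (.neg (adjTo (.var .rb) .iy)) (adjTo (.rd .row (vtx .iy)) .ix)))))))
    (.ifc (.conj (isOne .set (here .ix)) (.disj (.neg (.eq (clrOf .ix) (.var .ce)))
        (.conj (.disj (.neg (.eq (vtx .ix) (.var .cv))) (.eq (.var .ca) (.var .cv)))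
          (.conj (.disj (.neg (adjTo (.var .rv) .ix))
              (.conj (.neg (adjTo (.var .ra) .ix)) (.neg (adjTo (.var .rb) .ix))))
            (.disj (adjTo (.var .rv) .ix)
              (.disj (.eq (vtx .ix) (.var .cv)) (.eq (.var .rf) (.var .pairs))))))))
      (.wr .rest (here .ix) (.num 1)) (.wr .rest (here .ix) (.num 0))))

/-- Starting with the current move. -/
def startMove : Stmt :=
  .seq loadMove
  (.seq applyMove
  (.seq (fillIf .cur (here .ix) (.lt (.num 0) (.num 0)))
  (.seq (.setv (.add (.var .vb) (.num 1)) .zero)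
  (.wr .phase (.var .lv) (.num 2)))))

/-- Computing the component of the pair `rf` in the remaining set, in the row of the next frame. One round
for each pair suffices, since each round but the last adds a pair. -/
def component : Stmt :=
  .seq (fillIf .set (above .ix) (.eq (.var .ix) (.var .rf)))
  (forLoop .iz (.var .pairs) (forLoop .ix (.var .pairs) (forLoop .iy (.var .pairs)
    (.ifc (.conj (isOne .set (above .ix)) (.conj (isOne .rest (here .iy)) (conflictCond .ix .iy)))
      (.wr .set (above .iy) (.num 1)) .skip))))

/-- The base set, budget and color of the next frame: a restart with the full budget if the component lies
in the neighbourhood of the vertex of the move and this vertex occurs in the base set, and the next smaller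
budget otherwise. -/
def prepare : Stmt :=
  .seq (.set .cv (.rd .mv (.rd .idx (.var .lv))))
  (.seq (.set .rv (.rd .row (.var .cv)))
  (.seq (search .ix .rg (.conj (isOne .base (here .ix)) (.eq (vtx .ix) (.var .cv))))
  (.seq (search .ix .rh (.conj (isOne .set (above .ix)) (.neg (adjTo (.var .rv) .ix))))
  (.ifc (.conj (.lt (.var .rg) (.var .pairs)) (.eq (.var .rh) (.var .pairs)))
    (.seq (fillIf .base (above .ix) (isOne .set (above .ix)))
    (.seq (.wr .bud (.add (.var .lv) (.num 1)) (.var .full))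
    (.wr .clr (.add (.var .lv) (.num 1)) (.num 0))))
    (.seq (fillIf .base (above .ix) (isOne .base (here .ix)))
    (.seq (.wr .bud (.add (.var .lv) (.num 1)) (.sub (.rd .bud (.var .lv)) (.num 1)))
    (.ifc (.eq (.rd .clr (.var .lv)) (.num 0))
      (.wr .clr (.add (.var .lv) (.num 1)) (.sub (.var .colors) (.num 1)))
      (.wr .clr (.add (.var .lv) (.num 1)) (.sub (.rd .clr (.var .lv)) (.num 1))))))))))

/-- Calling the procedure for the component of the pair `rf`. -/
def descend : Stmt :=
  .seq component
  (.seq (fillIf .rest (here .ix) (.conj (isOne .rest (here .ix)) (.neg (isOne .set (above .ix)))))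
  (.seq prepare
  (.seq (.wr .phase (.add (.var .lv) (.num 1)) (.num 0))
  (.seq (.set .fb (.add (.var .fb) (.var .pairs)))
  (.seq (.set .vb (.add (.var .vb) (.num 2)))
  (.set .lv (.add (.var .lv) (.num 1))))))))

/-- After the last component of a move: keep the better solution and go to the next move. -/
def finish : Stmt :=
  .seq (.ifc (.vlt (.get (.var .vb)) (.get (.add (.var .vb) (.num 1))))
    (.seq (fillIf .best (here .ix) (isOne .cur (here .ix)))
      (.setv (.var .vb) (.get (.add (.var .vb) (.num 1))))) .skip)
  (.seq (.wr .idx (.var .lv) (.add (.rd .idx (.var .lv)) (.num 1)))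
  (.wr .phase (.var .lv) (.num 1)))

/-- Returning from a call: the solution found is added to the current solution of the caller. -/
def ret : Stmt :=
  .seq (fillIf .cur (below .ix) (.disj (isOne .best (here .ix)) (isOne .cur (below .ix))))
  (.seq (.setv (.sub (.var .vb) (.num 1))
    (.add (.get (.sub (.var .vb) (.num 1))) (.get (.var .vb))))
  (.seq (.set .fb (.sub (.var .fb) (.var .pairs)))
  (.seq (.set .vb (.sub (.var .vb) (.num 2)))
  (.set .lv (.sub (.var .lv) (.num 1))))))

/-- One step of the stack machine. The phase of a call is `0` at its start, `1` between two moves, and `2`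
while the components left by a move are treated. -/
def step : Stmt :=
  .ifc (.eq (.rd .phase (.var .lv)) (.num 0)) enter
  (.ifc (.eq (.rd .phase (.var .lv)) (.num 1))
    (.ifc (.eq (.rd .idx (.var .lv)) (.var .moves)) ret startMove)
    (.seq (search .ix .rf (isOne .rest (here .ix)))
      (.ifc (.eq (.var .rf) (.var .pairs)) finish descend)))

/-- The stack machine, which halts when the call at level `1` has returned. -/
def mainLoop : Stmt := .loop (.num 0) (.var .lv) step

/-! ### Memory layout and the effect of single steps -/

open Classical

/-- The data that stay fixed during the recursion. -/
structure Inst where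
  /-- The number of vertices. -/
  n : ℕ
  /-- The number of colors. -/
  k : ℕ
  /-- The number of moves. -/
  M : ℕ
  /-- The full budget, a multiple of `k`, so that the color `0` belongs to it. -/
  D : ℕ
  /-- The graph, of which only the vertices below `n` matter. -/
  H : SimpleGraph ℕ
  /-- The vertex that each move treats. -/
  mv : ℕ → ℕ
  /-- The first vertex guessed by each move. -/
  ma : ℕ → ℕ
  /-- The second vertex guessed by each move. -/
  mb : ℕ → ℕ
  /-- The revenue of each pair. -/
  wt : ℕ → ℚ
  k_pos : 0 < k
  mod_D : D % k = 0
  mv_lt : ∀ j < M, mv j < n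
  ma_lt : ∀ j < M, ma j < n
  mb_lt : ∀ j < M, mb j < n
  moves : ∀ v < n, ∀ a < n, ∀ b < n, ∃ j < M, mv j = v ∧ ma j = a ∧ mb j = b
  wt_nonneg : ∀ p, 0 ≤ wt p

/-- The number of pairs. -/
def Inst.N (P : Inst) : ℕ := P.n * P.k

theorem Inst.div_lt {P : Inst} {p : ℕ} (hp : p < P.N) : p / P.k < P.n :=
  Nat.div_lt_of_lt_mul (by rw [Nat.mul_comm]; exact hp)

/-- The tables hold the fixed data. -/
structure Ctx (P : Inst) (σ : Store) : Prop where
  colors : σ.s .colors = P.k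
  pairs : σ.s .pairs = P.N
  moves : σ.s .moves = P.M
  full : σ.s .full = P.D
  vert : ∀ p < P.N, σ.w .vert p = p / P.k
  col : ∀ p < P.N, σ.w .col p = p % P.k
  row : ∀ u < P.n, σ.w .row u = P.n * u
  adj : ∀ u < P.n, ∀ v < P.n, σ.w .adj (P.n * u + v) = 1 ↔ P.H.Adj u v
  mv : ∀ j < P.M, σ.w .mv j = P.mv j
  ma : ∀ j < P.M, σ.w .ma j = P.ma j
  mb : ∀ j < P.M, σ.w .mb j = P.mb j
  wt : ∀ p < P.N, σ.v p = P.wt p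

/-- The pointers to the frame of level `l`. -/
structure Top (P : Inst) (σ : Store) (l : ℕ) : Prop where
  lv : σ.s .lv = l
  fb : σ.s .fb = l * P.N
  vb : σ.s .vb = P.N + 2 * l

/-- The tables and the frames below level `l` agree; for `r = 1` also frame `l` agrees up to its
current solution. -/
structure Agree (P : Inst) (l r : ℕ) (σ σ' : Store) : Prop where
  vars : ∀ y, y = .colors ∨ y = .pairs ∨ y = .moves ∨ y = .full ∨ y = .size → σ'.s y = σ.s y
  tables : ∀ j, j = .adj ∨ j = .vert ∨ j = .col ∨ j = .row ∨ j = .mv ∨ j = .ma ∨ j = .mb ∨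
    j = .out → σ'.w j = σ.w j
  rows : ∀ j, j = .set ∨ j = .base ∨ j = .rest ∨ j = .best → ∀ i < (l + r) * P.N,
    σ'.w j i = σ.w j i
  cur : ∀ i < l * P.N, σ'.w .cur i = σ.w .cur i
  entries : ∀ j, j = .bud ∨ j = .clr ∨ j = .idx ∨ j = .phase → ∀ i < l + r, σ'.w j i = σ.w j i
  vals : ∀ i < P.N + 2 * l + r, σ'.v i = σ.v i

theorem Agree.trans {P : Inst} {l r : ℕ} {σ₁ σ₂ σ₃ : Store} (h : Agree P l r σ₁ σ₂)
    (h' : Agree P l r σ₂ σ₃) : Agree P l r σ₁ σ₃ where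
  vars y hy := (h'.vars y hy).trans (h.vars y hy)
  tables j hj := (h'.tables j hj).trans (h.tables j hj)
  rows j hj i hi := (h'.rows j hj i hi).trans (h.rows j hj i hi)
  cur i hi := (h'.cur i hi).trans (h.cur i hi)
  entries j hj i hi := (h'.entries j hj i hi).trans (h.entries j hj i hi)
  vals i hi := (h'.vals i hi).trans (h.vals i hi)

theorem Agree.weaken {P : Inst} {l r : ℕ} {σ₁ σ₂ : Store} (h : Agree P l r σ₁ σ₂) :
    Agree P l 0 σ₁ σ₂ where
  vars := h.vars
  tables := h.tables
  rows j hj i hi := h.rows j hj i (lt_of_lt_of_le hi (Nat.mul_le_mul_right _ (by omega)))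
  cur := h.cur
  entries j hj i hi := h.entries j hj i (by omega)
  vals i hi := h.vals i (by omega)

theorem Agree.down {P : Inst} {l : ℕ} {σ₁ σ₂ : Store} (h : Agree P (l + 1) 0 σ₁ σ₂) :
    Agree P l 1 σ₁ σ₂ where
  vars := h.vars
  tables := h.tables
  rows j hj i hi := h.rows j hj i hi
  cur i hi := h.cur i (lt_of_lt_of_le hi (Nat.mul_le_mul_right _ (by omega)))
  entries j hj i hi := h.entries j hj i (by omega)
  vals i hi := h.vals i (by omega)

theorem Ctx.congr {P : Inst} {l r : ℕ} {σ σ' : Store} (h : Ctx P σ) (ha : Agree P l r σ σ') :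
    Ctx P σ' where
  colors := by rw [ha.vars _ (by tauto), h.colors]
  pairs := by rw [ha.vars _ (by tauto), h.pairs]
  moves := by rw [ha.vars _ (by tauto), h.moves]
  full := by rw [ha.vars _ (by tauto), h.full]
  vert := by rw [ha.tables _ (by tauto)]; exact h.vert
  col := by rw [ha.tables _ (by tauto)]; exact h.col
  row := by rw [ha.tables _ (by tauto)]; exact h.row
  adj := by rw [ha.tables _ (by tauto)]; exact h.adj
  mv := by rw [ha.tables _ (by tauto)]; exact h.mv
  ma := by rw [ha.tables _ (by tauto)]; exact h.ma
  mb := by rw [ha.tables _ (by tauto)]; exact h.mb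
  wt p hp := by rw [ha.vals p (by omega), h.wt p hp]

/-- The row starting at `b` of the array `a` is the indicator of `A`. -/
def HasRow (a : ℕ → ℕ) (b N : ℕ) (A : Finset ℕ) : Prop :=
  ∀ p < N, a (b + p) = if p ∈ A then 1 else 0

/-- The indicator of a property. -/
noncomputable def ind (p : ℕ → Prop) (i : ℕ) : ℕ := if p i then 1 else 0

theorem HasRow.one_iff {a : ℕ → ℕ} {b N p : ℕ} {A : Finset ℕ} (h : HasRow a b N A) (hp : p < N) :
    a (b + p) = 1 ↔ p ∈ A := by
  rw [h p hp]; split_ifs with h <;> simp [h]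

theorem HasRow.overwrite {a : ℕ → ℕ} {b N : ℕ} {A : Finset ℕ} {q : ℕ → Prop}
    (h : ∀ i < N, q i ↔ i ∈ A) : HasRow (overwrite a b N (ind q)) b N A := by
  intro p hp
  have : b ≤ b + p ∧ b + p < b + N := by omega
  simp [PartialColoringAlgorithm.overwrite, hp, ind, h p hp]

theorem overwrite_of_lt {a : ℕ → ℕ} {b N i : ℕ} {g : ℕ → ℕ} (h : i < b) :
    overwrite a b N g i = a i := by
  simp only [overwrite]; rw [if_neg (by omega)]

theorem overwrite_of_ge {a : ℕ → ℕ} {b N i : ℕ} {g : ℕ → ℕ} (h : b + N ≤ i) :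
    overwrite a b N g i = a i := by
  simp only [overwrite]; rw [if_neg (by omega)]

theorem HasRow.congr {a a' : ℕ → ℕ} {b N : ℕ} {A : Finset ℕ} (h : HasRow a b N A)
    (ha : ∀ i < b + N, a' i = a i) : HasRow a' b N A :=
  fun p hp => by rw [ha _ (by omega), h p hp]

theorem Run.fillIf {j : Arr} {pos : Ex} {c : Cond} {σ : Store} {Q : Store → Prop} {N : ℕ} (b : ℕ)
    (q : ℕ → Prop) (hN : σ.s .pairs = N)
    (hpos : ∀ i < N, ∀ s' : Var → ℕ, ∀ w v, (∀ y, y ≠ .ix → s' y = σ.s y) → s' .ix = i →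
      pos.eval ⟨s', w, v⟩ = b + i)
    (hc : ∀ i < N, ∀ s' : Var → ℕ, (∀ y, y ≠ .ix → s' y = σ.s y) → s' .ix = i →
      (c.Holds ⟨s', Function.update σ.w j (overwrite (σ.w j) b i (ind q)), σ.v⟩ ↔ q i))
    (hQ : ∀ s' : Var → ℕ, (∀ y, y ≠ .ix → s' y = σ.s y) →
      Q ⟨s', Function.update σ.w j (overwrite (σ.w j) b N (ind q)), σ.v⟩) :
    Run (fillIf j pos c) σ (N * 4 + 2) Q := by
  refine Run.fill (T := 2) [] j b (ind q) hN (by simp) (by simp) (by simp) ?_ ?_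
  · intro i hi s' hs' hx
    have hs'' : ∀ y, y ≠ .ix → s' y = σ.s y := fun y hy => hs' y hy (by simp)
    have hcc := hc i hi s' hs'' hx
    refine Run.ifc (fun h => Run.wr ?_) (fun h => Run.wr ?_)
    · refine ⟨fun y _ => rfl, ?_, rfl⟩
      simp only [Store.setW_w, hpos i hi s' _ _ hs'' hx, Function.update_self, Function.update_idem,
        Ex.eval]
      rw [overwrite_succ]
      simp [ind, hcc.mp h]
    · refine ⟨fun y _ => rfl, ?_, rfl⟩
      simp only [Store.setW_w, hpos i hi s' _ _ hs'' hx, Function.update_self, Function.update_idem,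
        Ex.eval]
      rw [overwrite_succ]
      have hq : ¬ q i := fun h' => h (hcc.mpr h')
      simp [ind, hq]
  · exact fun s' hs' => hQ s' fun y hy => hs' y hy (by simp)

/-- The part of frame `l` that describes the call: base set `B`, set `A` and budget `d`. -/
structure Call (P : Inst) (σ : Store) (l : ℕ) (B A : Finset ℕ) (d : ℕ) : Prop where
  base : HasRow (σ.w .base) (l * P.N) P.N B
  set : HasRow (σ.w .set) (l * P.N) P.N A
  bud : σ.w .bud l = d
  clr : σ.w .clr l = d % P.k

/-- Frame `l` is about to try move `j`, with best solution `S` so far. -/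
structure AtMove (P : Inst) (σ : Store) (l : ℕ) (B A : Finset ℕ) (d j : ℕ) (S : Finset ℕ) :
    Prop extends Call P σ l B A d where
  phase : σ.w .phase l = 1
  idx : σ.w .idx l = j
  best : HasRow (σ.w .best) (l * P.N) P.N S
  bestVal : σ.v (P.N + 2 * l) = ∑ p ∈ S, P.wt p

/-- Frame `l` is working on move `j`: the pairs `R` remain, and `C` is the solution for the components
treated so far. -/
structure AtComp (P : Inst) (σ : Store) (l : ℕ) (B A : Finset ℕ) (d j : ℕ) (S R C : Finset ℕ) :
    Prop extends Call P σ l B A d where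
  phase : σ.w .phase l = 2
  idx : σ.w .idx l = j
  best : HasRow (σ.w .best) (l * P.N) P.N S
  bestVal : σ.v (P.N + 2 * l) = ∑ p ∈ S, P.wt p
  rest : HasRow (σ.w .rest) (l * P.N) P.N R
  cur : HasRow (σ.w .cur) (l * P.N) P.N C
  curVal : σ.v (P.N + 2 * l + 1) = ∑ p ∈ C, P.wt p

theorem Run.enter {P : Inst} {σ : Store} {l : ℕ} {B A : Finset ℕ} {d : ℕ} {Q : Store → Prop}
    (hctx : Ctx P σ) (htop : Top P σ l) (hcall : Call P σ l B A d) (hA : A ⊆ Finset.range P.N)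
    (hne : A.Nonempty)
    (hQ : ∀ σ' p, p ∈ A → Top P σ' l → Agree P l 0 σ σ' →
      AtMove P σ' l B A d (if d = 0 then P.M else 0) {p} → Q σ') :
    Run enter σ ((4 * P.N + 3) + ((P.N * 4 + 2) + (1 + (1 + (1 + 1))))) Q := by
  refine Run.seq (Run.search (fun i => i ∈ A) hctx.pairs (by simp) (by simp) (by simp) ?_ ?_)
  · intro i hi s' hs' hx
    simp [isOne, here, hx, hs' .fb, htop.fb, hcall.set.one_iff hi]
  · intro s₁ hs₁ hf
    obtain ⟨hfN, hfA⟩ : s₁ .rf < P.N ∧ s₁ .rf ∈ A := by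
      rcases hf with h | ⟨-, h⟩
      · exact h
      · obtain ⟨p, hp⟩ := hne
        exact absurd hp (h p (Finset.mem_range.mp (hA hp)))
    refine Run.seq (Run.fillIf (l * P.N) (fun i => i = s₁ .rf) (by simp [hs₁, hctx.pairs]) ?_ ?_ ?_)
    · intro i hi s' w v hs' hx
      simp [here, hx, hs' .fb, hs₁ .fb, htop.fb]
    · intro i hi s' hs' hx
      simp [hx, hs' .rf]
    · intro s₂ hs₂
      have hlv : s₂ .lv = l := by simp [hs₂, hs₁, htop.lv]
      have hvb : s₂ .vb = P.N + 2 * l := by simp [hs₂, hs₁, htop.vb]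
      have hrf : s₂ .rf = s₁ .rf := by simp [hs₂]
      have hmv : s₂ .moves = P.M := by simp [hs₂, hs₁, hctx.moves]
      refine Run.seq (Run.setv (Run.seq (Run.wr ?_)))
      have fin : ∀ a, a = (if d = 0 then P.M else 0) →
          Q ((((⟨s₂, Function.update σ.w .best (overwrite (σ.w .best) (l * P.N) P.N
            (ind fun i => i = s₁ .rf)), σ.v⟩ : Store).setV (P.N + 2 * l) (σ.v (s₁ .rf))).setW
            .phase l 1).setW .idx l a) := by
        rintro a rfl
        refine hQ _ (s₁ .rf) hfA ⟨?_, ?_, ?_⟩ ⟨?_, ?_, ?_, ?_, ?_, ?_⟩ ⟨⟨?_, ?_, ?_, ?_⟩, ?_, ?_, ?_, ?_⟩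
        · simpa using hlv
        · simp [hs₂, hs₁, htop.fb]
        · simpa using hvb
        · intro y hy
          rcases hy with rfl | rfl | rfl | rfl | rfl <;> simp [hs₂, hs₁]
        · intro j hj
          rcases hj with rfl | rfl | rfl | rfl | rfl | rfl | rfl | rfl <;> simp
        · intro j hj i hi
          rcases hj with rfl | rfl | rfl | rfl <;> simp
          exact overwrite_of_lt (by simpa using hi)
        · intro i hi; simp
        · intro j hj i hi
          rcases hj with rfl | rfl | rfl | rfl <;> simp <;>
            exact Function.update_of_ne (by omega) _ _
        · intro i hi
          simp only [Store.setW_v, Store.setV_v]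
          exact Function.update_of_ne (by omega) _ _
        · simpa using hcall.base
        · simpa using hcall.set
        · simpa using hcall.bud
        · simpa using hcall.clr
        · simp
        · simp
        · simpa using HasRow.overwrite (by simp)
        · simp [hctx.wt _ hfN]
      refine Run.ifc (fun h => Run.wr ?_) (fun h => Run.wr ?_)
      · have hd : d = 0 := by simpa [hlv, hcall.bud] using h
        simpa [hlv, hvb, hrf, hmv] using fin P.M (by simp [hd])
      · have hd : d ≠ 0 := by simpa [hlv, hcall.bud] using h
        simpa [hlv, hvb, hrf, hmv] using fin 0 (by simp [hd])

end PartialColoringAlgorithm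

namespace PartialColoringAlgorithm

open Classical

/-! ### Moves and returns -/

variable {P : Inst} {σ : Store} {l : ℕ} {B A : Finset ℕ} {d : ℕ} {Q : Store → Prop}

theorem Run.loadMove {j : ℕ} (hctx : Ctx P σ) (hlv : σ.s .lv = l) (hidx : σ.w .idx l = j)
    (hj : j < P.M)
    (hQ : ∀ s' : Var → ℕ, (∀ y, y ≠ .cv → y ≠ .ca → y ≠ .cb → y ≠ .rv → y ≠ .ra → y ≠ .rb →
      y ≠ .ce → s' y = σ.s y) → s' .cv = P.mv j → s' .ca = P.ma j → s' .rv = P.n * P.mv j →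
      s' .ra = P.n * P.ma j → s' .rb = P.n * P.mb j → s' .ce = σ.w .clr l → Q ⟨s', σ.w, σ.v⟩) :
    Run loadMove σ (1 + (1 + (1 + (1 + (1 + (1 + 1)))))) Q := by
  refine Run.seq (Run.set (Run.seq (Run.set (Run.seq (Run.set (Run.seq (Run.set
    (Run.seq (Run.set (Run.seq (Run.set (Run.set ?_)))))))))))) 
  have h1 := hctx.row _ (P.mv_lt j hj)
  have h2 := hctx.row _ (P.ma_lt j hj)
  have h3 := hctx.row _ (P.mb_lt j hj)
  refine hQ _ ?_ ?_ ?_ ?_ ?_ ?_ ?_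
  · intro y h1 h2 h3 h4 h5 h6 h7
    simp [h1, h2, h3, h4, h5, h6, h7]
  all_goals simp [hlv, hidx, hctx.mv j hj, hctx.ma j hj, hctx.mb j hj, h1, h2, h3]

theorem Run.applyMove {v a b e : ℕ} (hctx : Ctx P σ) (hfb : σ.s .fb = l * P.N)
    (hA : HasRow (σ.w .set) (l * P.N) P.N A) (hAN : A ⊆ Finset.range P.N)
    (hv : v < P.n) (ha : a < P.n) (hb : b < P.n)
    (hcv : σ.s .cv = v) (hca : σ.s .ca = a) (hrv : σ.s .rv = P.n * v) (hra : σ.s .ra = P.n * a)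
    (hrb : σ.s .rb = P.n * b) (hce : σ.s .ce = e)
    (hQ : ∀ s' : Var → ℕ, (∀ y, y ≠ .ix → y ≠ .iy → y ≠ .rf → s' y = σ.s y) →
      Q ⟨s', Function.update σ.w .rest (overwrite (σ.w .rest) (l * P.N) P.N
        (ind (· ∈ move P.H P.k A v a b e))), σ.v⟩) :
    Run applyMove σ (P.N * ((4 * P.N + 3 + 2) + 2) + 2) Q := by
  refine Run.fill [.iy, .rf] .rest (l * P.N) (ind (· ∈ move P.H P.k A v a b e)) hctx.pairs (by simp) (by simp) (by simp) ?_ ?_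
  · intro i hi s₁ hs₁ hx
    have hvi := hctx.vert i hi
    have hdi := P.div_lt hi
    have hpairs : s₁ .pairs = P.N := by simp [hs₁, hctx.pairs]
    refine Run.seq (T₁ := 4 * P.N + 3) (T₂ := 2) (Run.search (x := .iy) (f := .rf) (N := P.N) (fun q => q ∈ A ∧ q % P.k = e ∧ P.H.Adj v (q / P.k) ∧
      ¬ P.H.Adj a (q / P.k) ∧ ¬ P.H.Adj b (q / P.k) ∧ P.H.Adj (q / P.k) (i / P.k))
      hpairs (by simp) (by simp) (by simp) ?_ ?_)
    · intro q hq s₂ hs₂ hy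
      have hvq := hctx.vert q hq
      have hdq := P.div_lt hq
      have h1 : s₂ .fb = l * P.N := by simp [hs₂, hs₁, hfb]
      have h2 : s₂ .ce = e := by simp [hs₂, hs₁, hce]
      have h3 : s₂ .rv = P.n * v := by simp [hs₂, hs₁, hrv]
      have h4 : s₂ .ra = P.n * a := by simp [hs₂, hs₁, hra]
      have h5 : s₂ .rb = P.n * b := by simp [hs₂, hs₁, hrb]
      have h6 : s₂ .ix = i := by simp [hs₂, hx]
      simp [isOne, here, clrOf, adjTo, vtx, hy, h1, h2, h3, h4, h5, h6, hvq, hvi, hA.one_iff hq,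
        hctx.col q hq, hctx.adj _ hv _ hdq, hctx.adj _ ha _ hdq, hctx.adj _ hb _ hdq,
        hctx.row _ hdq, hctx.adj _ hdq _ hdi]
    · intro s₂ hs₂ hrf
      have h0 : s₂ .pairs = P.N := by simp [hs₂, hs₁, hctx.pairs]
      have h1 : s₂ .fb = l * P.N := by simp [hs₂, hs₁, hfb]
      have h2 : s₂ .ce = e := by simp [hs₂, hs₁, hce]
      have h3 : s₂ .rv = P.n * v := by simp [hs₂, hs₁, hrv]
      have h4 : s₂ .ra = P.n * a := by simp [hs₂, hs₁, hra]
      have h5 : s₂ .rb = P.n * b := by simp [hs₂, hs₁, hrb]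
      have h6 : s₂ .ix = i := by simp [hs₂, hx]
      have h7 : s₂ .cv = v := by simp [hs₂, hs₁, hcv]
      have h8 : s₂ .ca = a := by simp [hs₂, hs₁, hca]
      have h9 : s₂ .rf = P.N ↔ ∀ q ∈ A, q % P.k = e → P.H.Adj v (q / P.k) → ¬ P.H.Adj a (q / P.k) →
          ¬ P.H.Adj b (q / P.k) → ¬ P.H.Adj (q / P.k) (i / P.k) := by
        rcases hrf with ⟨h, hA', h1, h2, h3, h4, h5⟩ | ⟨h, hno⟩
        · exact ⟨fun h' => absurd h' h.ne, fun h' => absurd h5 (h' _ hA' h1 h2 h3 h4)⟩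
        · exact ⟨fun _ q hq h1 h2 h3 h4 h5 =>
            hno q (Finset.mem_range.mp (hAN hq)) ⟨hq, h1, h2, h3, h4, h5⟩, fun _ => h⟩
      have hs : ∀ y ∉ [Var.iy, .rf], s₂ y = s₁ y := fun y hy => by
        simp at hy; exact hs₂ y hy.1 hy.2
      have key : (Cond.conj (isOne .set (here .ix)) (.disj (.neg (.eq (clrOf .ix) (.var .ce)))
        (.conj (.disj (.neg (.eq (vtx .ix) (.var .cv))) (.eq (.var .ca) (.var .cv)))
          (.conj (.disj (.neg (adjTo (.var .rv) .ix))
              (.conj (.neg (adjTo (.var .ra) .ix)) (.neg (adjTo (.var .rb) .ix))))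
            (.disj (adjTo (.var .rv) .ix)
              (.disj (.eq (vtx .ix) (.var .cv)) (.eq (.var .rf) (.var .pairs)))))))).Holds
          ⟨s₂, Function.update σ.w .rest (overwrite (σ.w .rest) (l * P.N) i
            (ind (· ∈ move P.H P.k A v a b e))), σ.v⟩ ↔ i ∈ move P.H P.k A v a b e := by
        simp only [isOne, here, clrOf, adjTo, vtx, Cond.Holds, Ex.eval, h0, h1, h2, h3, h4, h5, h6, h7,
          h8, ne_eq, reduceCtorEq, not_false_eq_true, Function.update_of_ne, hvi, hA.one_iff hi,
          hctx.col i hi, hctx.adj _ hv _ hdi, hctx.adj _ ha _ hdi, hctx.adj _ hb _ hdi, h9, move,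
          Finset.mem_filter, Survives]
        tauto
      refine Run.ifc (fun h => Run.wr ⟨hs, ?_, rfl⟩) (fun h => Run.wr ⟨hs, ?_, rfl⟩)
      · have := key.mp h
        simp [here, h1, h6, overwrite_succ, ind, this]
      · have : i ∉ move P.H P.k A v a b e := fun h' => h (key.mpr h')
        simp [here, h1, h6, overwrite_succ, ind, this]
  · intro s' hs'
    exact hQ s' fun y h1 h2 h3 => hs' y h1 (by simp [h2, h3])

theorem Run.startMove {j : ℕ} {S : Finset ℕ} (hctx : Ctx P σ) (htop : Top P σ l)
    (hm : AtMove P σ l B A d j S) (hAN : A ⊆ Finset.range P.N) (hj : j < P.M)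
    (hQ : ∀ σ', Top P σ' l → Agree P l 0 σ σ' →
      AtComp P σ' l B A d j S (move P.H P.k A (P.mv j) (P.ma j) (P.mb j) (d % P.k)) ∅ → Q σ') :
    Run startMove σ ((1 + (1 + (1 + (1 + (1 + (1 + 1)))))) + ((P.N * ((4 * P.N + 3 + 2) + 2) + 2) +
      ((P.N * 4 + 2) + (1 + 1)))) Q := by
  refine Run.seq (Run.loadMove hctx htop.lv hm.idx hj fun s₁ hs₁ hcv hca hrv hra hrb hce => ?_)
  have hctx₁ : Ctx P ⟨s₁, σ.w, σ.v⟩ := by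
    refine hctx.congr (l := 0) (r := 0) ⟨?_, ?_, ?_, ?_, ?_, ?_⟩
    · intro y hy
      rcases hy with rfl | rfl | rfl | rfl | rfl <;> simp [hs₁]
    all_goals intros; rfl
  refine Run.seq (Run.applyMove hctx₁ (l := l) (by simp [hs₁, htop.fb]) hm.set hAN (P.mv_lt j hj)
    (P.ma_lt j hj) (P.mb_lt j hj) hcv hca hrv hra hrb hce fun s₂ hs₂ => ?_)
  simp only at hs₂ ⊢
  refine Run.seq (Run.fillIf (N := P.N) (l * P.N) (fun _ => False) (by simp [hs₂, hs₁, hctx.pairs])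
    ?_ ?_ ?_)
  · intro i hi s' w v hs' hx
    simp [here, hx, hs', hs₂, hs₁, htop.fb]
  · intro i hi s' hs' hx
    simp
  intro s₃ hs₃
  have hlv : s₃ .lv = l := by simp [hs₃, hs₂, hs₁, htop.lv]
  have hvb : s₃ .vb = P.N + 2 * l := by simp [hs₃, hs₂, hs₁, htop.vb]
  refine Run.seq (Run.setv (Run.wr ?_))
  refine hQ _ ⟨?_, ?_, ?_⟩ ⟨?_, ?_, ?_, ?_, ?_, ?_⟩
    ⟨⟨?_, ?_, ?_, ?_⟩, ?_, ?_, ?_, ?_, ?_, ?_, ?_⟩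
  · simpa using hlv
  · simp [hs₃, hs₂, hs₁, htop.fb]
  · simpa using hvb
  · intro y hy
    rcases hy with rfl | rfl | rfl | rfl | rfl <;> simp [hs₃, hs₂, hs₁]
  · intro j hj
    rcases hj with rfl | rfl | rfl | rfl | rfl | rfl | rfl | rfl <;> simp
  · intro j hj i hi
    rcases hj with rfl | rfl | rfl | rfl <;> simp
    exact overwrite_of_lt (by simpa using hi)
  · intro i hi
    simp only [Store.setW_w, Store.setV_w, ne_eq, reduceCtorEq, not_false_eq_true,
      Function.update_of_ne, Function.update_self]
    exact overwrite_of_lt hi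
  · intro j hj i hi
    rcases hj with rfl | rfl | rfl | rfl <;> simp [hlv]
    exact Function.update_of_ne (by omega) _ _
  · intro i hi
    simp only [Store.setW_v, Store.setV_v, Ex.eval, hvb]
    exact Function.update_of_ne (by omega) _ _
  · simpa using hm.base
  · simpa using hm.set
  · simpa using hm.bud
  · simpa using hm.clr
  · simp [hlv]
  · simpa using hm.idx
  · simpa using hm.best
  · simpa [hvb] using hm.bestVal
  · simp only [Store.setW_w, Store.setV_w, ne_eq, reduceCtorEq, not_false_eq_true,
      Function.update_of_ne, Function.update_self]
    rw [← hm.clr]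
    exact HasRow.overwrite (by simp)
  · simpa using HasRow.overwrite (by simp)
  · simp [hvb]

theorem Run.finish {j : ℕ} {S C : Finset ℕ} (hctx : Ctx P σ) (htop : Top P σ l)
    (hm : AtComp P σ l B A d j S ∅ C)
    (hQ : ∀ σ', Top P σ' l → Agree P l 0 σ σ' → AtMove P σ' l B A d (j + 1)
      (if ∑ p ∈ S, P.wt p < ∑ p ∈ C, P.wt p then C else S) → Q σ') :
    Run finish σ ((((P.N * 4 + 2) + 1) + 1) + (1 + 1)) Q := by
  refine Run.seq (Run.ifc (T := (P.N * 4 + 2) + 1) (fun h => ?_) fun h => Run.weaken (Run.skip ?_) (by omega))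
  · have hlt : ∑ p ∈ S, P.wt p < ∑ p ∈ C, P.wt p := by
      simpa [htop.vb, hm.bestVal, hm.curVal] using h
    rw [if_pos hlt] at hQ
    refine Run.seq (Run.fillIf (N := P.N) (l * P.N) (fun i => i ∈ C) hctx.pairs ?_ ?_ ?_)
    · intro i hi s' w v hs' hx
      simp [here, hx, hs', htop.fb]
    · intro i hi s' hs' hx
      simp [isOne, here, hx, hs', htop.fb, hm.cur.one_iff hi]
    intro s₁ hs₁
    have hlv : s₁ .lv = l := by simp [hs₁, htop.lv]
    have hvb : s₁ .vb = P.N + 2 * l := by simp [hs₁, htop.vb]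
    refine Run.setv (Run.seq (Run.wr (Run.wr ?_)))
    refine hQ _ ⟨?_, ?_, ?_⟩ ⟨?_, ?_, ?_, ?_, ?_, ?_⟩ ⟨⟨?_, ?_, ?_, ?_⟩, ?_, ?_, ?_, ?_⟩
    · simpa using hlv
    · simp [hs₁, htop.fb]
    · simpa using hvb
    · intro y hy
      rcases hy with rfl | rfl | rfl | rfl | rfl <;> simp [hs₁]
    · intro j hj
      rcases hj with rfl | rfl | rfl | rfl | rfl | rfl | rfl | rfl <;> simp
    · intro j hj i hi
      rcases hj with rfl | rfl | rfl | rfl <;> simp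
      exact overwrite_of_lt (by simpa using hi)
    · intro i hi; simp
    · intro j hj i hi
      rcases hj with rfl | rfl | rfl | rfl <;> simp [hlv] <;>
        exact Function.update_of_ne (by omega) _ _
    · intro i hi
      simp only [Store.setW_v, Store.setV_v, Ex.eval, hvb]
      exact Function.update_of_ne (by omega) _ _
    · simpa using hm.base
    · simpa using hm.set
    · simpa using hm.bud
    · simpa using hm.clr
    · simp [hlv]
    · simp [hlv, hm.idx]
    · simpa using HasRow.overwrite (by simp)
    · simp [hvb, hm.curVal]
  · have hlt : ¬ ∑ p ∈ S, P.wt p < ∑ p ∈ C, P.wt p := by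
      simpa [htop.vb, hm.bestVal, hm.curVal] using h
    rw [if_neg hlt] at hQ
    have hlv := htop.lv
    refine Run.seq (Run.wr (Run.wr ?_))
    refine hQ _ ⟨hlv, htop.fb, htop.vb⟩ ⟨fun _ _ => rfl, ?_, ?_, ?_, ?_, fun _ _ => rfl⟩
      ⟨⟨?_, ?_, ?_, ?_⟩, ?_, ?_, ?_, ?_⟩
    · intro j hj
      rcases hj with rfl | rfl | rfl | rfl | rfl | rfl | rfl | rfl <;> simp
    · intro j hj i hi
      rcases hj with rfl | rfl | rfl | rfl <;> simp
    · intro i hi; simp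
    · intro j hj i hi
      rcases hj with rfl | rfl | rfl | rfl <;> simp [hlv] <;>
        exact Function.update_of_ne (by omega) _ _
    · simpa using hm.base
    · simpa using hm.set
    · simpa using hm.bud
    · simpa using hm.clr
    · simp [hlv]
    · simp [hlv, hm.idx]
    · simpa using hm.best
    · simpa using hm.bestVal

theorem Run.ret {j : ℕ} {S C : Finset ℕ} (hctx : Ctx P σ) (htop : Top P σ (l + 1))
    (hm : AtMove P σ (l + 1) B A d j S) (hC : HasRow (σ.w .cur) (l * P.N) P.N C)
    (hQ : ∀ σ', Top P σ' l → Agree P l 1 σ σ' → HasRow (σ'.w .cur) (l * P.N) P.N (C ∪ S) →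
      σ'.v (P.N + 2 * l + 1) = σ.v (P.N + 2 * l + 1) + ∑ p ∈ S, P.wt p → Q σ') :
    Run ret σ ((P.N * 4 + 2) + (1 + (1 + (1 + 1)))) Q := by
  have hfb : (l + 1) * P.N - P.N = l * P.N := by rw [Nat.add_mul]; omega
  refine Run.seq (Run.fillIf (N := P.N) (l * P.N) (fun i => i ∈ C ∪ S) hctx.pairs ?_ ?_ ?_)
  · intro i hi s' w v hs' hx
    simp [PartialColoringAlgorithm.below, hx, hs', htop.fb, hctx.pairs, hfb]
  · intro i hi s' hs' hx
    simp [PartialColoringAlgorithm.below, here, isOne, hx, hs', htop.fb, hctx.pairs, hfb,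
      overwrite_of_ge le_rfl, hC.one_iff hi, hm.best.one_iff hi, or_comm]
  intro s₁ hs₁
  have hlv : s₁ .lv = l + 1 := by simp [hs₁, htop.lv]
  have hvb : s₁ .vb = P.N + 2 * (l + 1) := by simp [hs₁, htop.vb]
  have hvb' : P.N + 2 * (l + 1) - 1 = P.N + 2 * l + 1 := by omega
  refine Run.seq (Run.setv (Run.seq (Run.set (Run.seq (Run.set (Run.set ?_))))))
  refine hQ _ ⟨?_, ?_, ?_⟩ ⟨?_, ?_, ?_, ?_, ?_, ?_⟩ ?_ ?_
  · simp [hlv]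
  · simp [hs₁, htop.fb, hctx.pairs, hfb]
  · simp [hvb]; omega
  · intro y hy
    rcases hy with rfl | rfl | rfl | rfl | rfl <;> simp [hs₁]
  · intro j hj
    rcases hj with rfl | rfl | rfl | rfl | rfl | rfl | rfl | rfl <;> simp
  · intro j hj i hi
    rcases hj with rfl | rfl | rfl | rfl <;> simp
  · intro i hi
    simp only [Store.setS_w, Store.setV_w, Function.update_self]
    exact overwrite_of_lt hi
  · intro j hj i hi
    rcases hj with rfl | rfl | rfl | rfl <;> simp
  · intro i hi
    simp only [Store.setS_v, Store.setV_v, Ex.eval, hvb]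
    exact Function.update_of_ne (by omega) _ _
  · simpa using HasRow.overwrite (by simp)
  · simp only [Store.setS_v, Store.setV_v, Ex.eval, VEx.eval, hvb, hvb', Function.update_self,
      hm.bestVal]

end PartialColoringAlgorithm

namespace PartialColoringAlgorithm

open Classical

/-! ### Components and recursive calls -/

variable {P : Inst} {σ : Store} {l : ℕ} {B A : Finset ℕ} {d : ℕ} {Q : Store → Prop}

/-- The set `C` contains `f` and lies in the component of `f` in `R`. -/
structure Grown (H : SimpleGraph ℕ) (k : ℕ) (R : Finset ℕ) (f : ℕ) (C : Finset ℕ) : Prop where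
  mem : f ∈ C
  subset : C ⊆ R
  least : ∀ T ⊆ R, (∀ p ∈ T, ∀ q ∈ R, Conflict H k p q → q ∈ T) → f ∈ T → C ⊆ T

theorem Grown.isComp {H : SimpleGraph ℕ} {k f : ℕ} {R C : Finset ℕ} (h : Grown H k R f C)
    (hcl : ∀ p ∈ C, ∀ q ∈ R, Conflict H k p q → q ∈ C) : IsComp H k R C := by
  refine ⟨h.subset, ⟨f, h.mem⟩, hcl, fun T hT hne hTcl => ?_⟩
  by_cases hf : f ∈ T
  · exact Finset.Subset.antisymm hT (h.least T (hT.trans h.subset)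
      (fun p hp q hq hpq => hTcl p hp q (hcl p (hT hp) q hq hpq) hpq) hf)
  · obtain ⟨t, ht⟩ := hne
    have := h.least (C \ T) (Finset.sdiff_subset.trans h.subset) (by
      intro p hp q hq hpq
      rw [Finset.mem_sdiff] at hp ⊢
      exact ⟨hcl p hp.1 q hq hpq, fun hqT => hp.2 (hTcl q hqT p hp.1 hpq.symm)⟩)
      (Finset.mem_sdiff.mpr ⟨h.mem, hf⟩) (hT ht)
    exact absurd ht (Finset.mem_sdiff.mp this).2

theorem Grown.insert {H : SimpleGraph ℕ} {k f p q : ℕ} {R C : Finset ℕ} (h : Grown H k R f C)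
    (hp : p ∈ C) (hq : q ∈ R) (hpq : Conflict H k p q) : Grown H k R f (insert q C) :=
  ⟨Finset.mem_insert_of_mem h.mem, Finset.insert_subset hq h.subset, fun T hT hcl hf =>
    Finset.insert_subset (hcl p (h.least T hT hcl hf hp) q hq hpq) (h.least T hT hcl hf)⟩

theorem overwrite_insert {a : ℕ → ℕ} {b N q : ℕ} {C : Finset ℕ} (hq : q < N) :
    Function.update (overwrite a b N (ind (· ∈ C))) (b + q) 1 =
      overwrite a b N (ind (· ∈ insert q C)) := by
  funext i
  by_cases hi : i = b + q
  · subst hi; simp [overwrite, hq, ind]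
  · rw [Function.update_of_ne hi]
    simp only [overwrite, ind, Finset.mem_insert]
    split_ifs with h1 h2 h3 h3 <;> first | rfl | skip
    · exact absurd (Or.inr h2) h3
    · rcases h3 with h3 | h3
      · omega
      · exact absurd h3 h2

/-- The store `τ` differs from `σ` by the loop variables and by the row of the next frame, which holds
the set `C`. -/
structure Closing (P : Inst) (σ : Store) (l : ℕ) (C : Finset ℕ) (τ : Store) : Prop where
  vars : ∀ y, y ≠ .ix → y ≠ .iy → y ≠ .iz → τ.s y = σ.s y
  arrays : τ.w = Function.update σ.w .set (overwrite (σ.w .set) ((l + 1) * P.N) P.N (ind (· ∈ C)))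
  vals : τ.v = σ.v

theorem Closing.setS {τ : Store} {C : Finset ℕ} (h : Closing P σ l C τ) {x : Var} (a : ℕ)
    (hx : x = .ix ∨ x = .iy ∨ x = .iz) : Closing P σ l C (τ.setS x a) := by
  refine ⟨fun y h1 h2 h3 => ?_, h.arrays, h.vals⟩
  have : y ≠ x := by rcases hx with rfl | rfl | rfl <;> assumption
  simp [this, h.vars y h1 h2 h3]

theorem conflictCond_holds {τ : Store} (hctx : Ctx P σ) (hw : ∀ j, j ≠ .set → τ.w j = σ.w j)
    {x y : Var} {p q : ℕ} (hx : τ.s x = p) (hy : τ.s y = q) (hp : p < P.N) (hq : q < P.N) :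
    (conflictCond x y).Holds τ ↔ Conflict P.H P.k p q := by
  have hdp := P.div_lt hp
  have hdq := P.div_lt hq
  simp only [conflictCond, vtx, clrOf, adjTo, isOne, Cond.Holds, Ex.eval, hw .vert (by simp),
    hw .col (by simp), hw .row (by simp), hw .adj (by simp), hx, hy, hctx.vert p hp, hctx.vert q hq,
    hctx.col p hp, hctx.col q hq, hctx.row _ hdp, hctx.adj _ hdp _ hdq, Conflict]

theorem Run.component {R : Finset ℕ} {f : ℕ} (hctx : Ctx P σ) (hfb : σ.s .fb = l * P.N)
    (hrest : HasRow (σ.w .rest) (l * P.N) P.N R) (hR : R ⊆ Finset.range P.N) (hrf : σ.s .rf = f)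
    (hf : f ∈ R) (hQ : ∀ τ C, IsComp P.H P.k R C → Closing P σ l C τ → Q τ) :
    Run component σ
      ((P.N * 4 + 2) + (P.N * ((P.N * ((P.N * ((1 + 1) + 2) + 2) + 2) + 2) + 2) + 2)) Q := by
  have hb : (l + 1) * P.N = l * P.N + P.N := by ring
  have hlt : ∀ q ∈ R, q < P.N := fun q hq => Finset.mem_range.mp (hR hq)
  have hfb' : ∀ {C τ}, Closing P σ l C τ → τ.s .fb = l * P.N := fun h => by
    rw [h.vars _ (by simp) (by simp) (by simp), hfb]
  have hpairs : ∀ {C τ}, Closing P σ l C τ → τ.s .pairs = P.N := fun h => by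
    rw [h.vars _ (by simp) (by simp) (by simp), hctx.pairs]
  refine Run.seq (Run.fillIf (N := P.N) ((l + 1) * P.N) (· ∈ ({f} : Finset ℕ)) hctx.pairs ?_ ?_ ?_)
  · intro i hi s' w v hs' hx
    simp [PartialColoringAlgorithm.above, hx, hs', hfb, hctx.pairs, hb]
  · intro i hi s' hs' hx
    simp [hx, hs', hrf]
  intro s₁ hs₁
  have h₁ : Closing P σ l {f} ⟨s₁, Function.update σ.w .set
      (overwrite (σ.w .set) ((l + 1) * P.N) P.N (ind (· ∈ ({f} : Finset ℕ)))), σ.v⟩ :=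
    ⟨fun y h _ _ => hs₁ y h, rfl, rfl⟩
  have closedN : ∀ C : Finset ℕ, Grown P.H P.k R f C → ((∀ p ∈ C, ∀ q ∈ R, Conflict P.H P.k p q → q ∈ C) ∨
      P.N < C.card) → ∀ p ∈ C, ∀ q ∈ R, Conflict P.H P.k p q → q ∈ C := by
    intro C hC h
    rcases h with h | h
    · exact h
    · have := Finset.card_le_card (hC.subset.trans hR)
      rw [Finset.card_range] at this
      omega
  -- Each round either leaves a closed set or enlarges the set.
  refine Run.forLoop P.N (fun r τ => ∃ C, Closing P σ l C τ ∧ Grown P.H P.k R f C ∧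
    ((∀ p ∈ C, ∀ q ∈ R, Conflict P.H P.k p q → q ∈ C) ∨ r < C.card)) ?_ ?_ ?_ ?_
  · refine ⟨{f}, h₁.setS 0 (by tauto), ⟨by simp, by simpa using hf, fun T _ _ h => by simpa using h⟩,
      Or.inr (by simp)⟩
  · rintro r - τ - ⟨C, hC, -⟩
    exact hpairs hC
  · rintro r hr τ hτr ⟨C₀, hcl₀, hC₀, hgrow⟩
    refine Run.forLoop P.N (fun i τ => τ.s .iz = r ∧ ∃ C, C₀ ⊆ C ∧ Closing P σ l C τ ∧
      Grown P.H P.k R f C ∧ ∀ p ∈ C₀, p < i → ∀ q ∈ R, Conflict P.H P.k p q → q ∈ C) ?_ ?_ ?_ ?_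
    · exact ⟨by simp [hτr], C₀, subset_rfl, hcl₀.setS 0 (by tauto), hC₀, by simp⟩
    · rintro i - τ - ⟨-, C, -, hC, -⟩
      exact hpairs hC
    · rintro i hi τ hτi ⟨hτr, C₁, h01, hcl₁, hC₁, hdone⟩
      refine Run.forLoop P.N (fun j τ => τ.s .iz = r ∧ τ.s .ix = i ∧ ∃ C, C₀ ⊆ C ∧ Closing P σ l C τ ∧
        Grown P.H P.k R f C ∧ (∀ p ∈ C₀, p < i → ∀ q ∈ R, Conflict P.H P.k p q → q ∈ C) ∧
        (i ∈ C₀ → ∀ q ∈ R, q < j → Conflict P.H P.k i q → q ∈ C)) ?_ ?_ ?_ ?_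
      · exact ⟨by simp [hτr], by simp [hτi], C₁, h01, hcl₁.setS 0 (by tauto), hC₁, hdone, by simp⟩
      · rintro j - τ - ⟨-, -, C, -, hC, -⟩
        exact hpairs hC
      · rintro j hj τ hτj ⟨hτr, hτi, C, h0C, hcl, hC, hdone, hdone'⟩
        have hset : ∀ p < P.N, τ.w .set (l * P.N + P.N + p) = 1 ↔ p ∈ C := by
          intro p hp
          rw [hcl.arrays, ← hb, Function.update_self]
          exact (HasRow.overwrite (A := C) (by simp)).one_iff hp
        have hcond : (Cond.conj (isOne .set (above .ix)) (.conj (isOne .rest (here .iy))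
            (conflictCond .ix .iy))).Holds τ ↔ i ∈ C ∧ j ∈ R ∧ Conflict P.H P.k i j := by
          have := conflictCond_holds (τ := τ) hctx
            (fun j hj => by rw [hcl.arrays, Function.update_of_ne hj]) hτi hτj hi hj
          simp only [Cond.Holds, this]
          simp only [isOne, above, here, Cond.Holds, Ex.eval, hfb' hcl, hpairs hcl, hτi, hτj, hset i hi]
          rw [hcl.arrays, Function.update_of_ne (by simp), hrest.one_iff hj]
        refine Run.ifc (fun h => Run.wr ?_) (fun h => Run.skip ?_)
        · obtain ⟨h1, h2, h3⟩ := hcond.mp h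
          refine ⟨hτj, by simp [hτr], by simp [hτi], insert j C, h0C.trans (Finset.subset_insert _ _),
            ⟨fun y h1 h2 h3 => ?_, ?_, hcl.vals⟩, hC.insert h1 h2 h3, ?_, ?_⟩
          · simp [h2, hcl.vars y h1 h2 h3]
          · simp only [Store.setS_w, Store.setW_w, above, Ex.eval, hfb' hcl, hpairs hcl, hτj, ← hb]
            rw [hcl.arrays, Function.update_self, Function.update_idem, overwrite_insert hj]
          · exact fun p hp hpi q hq hpq => Finset.mem_insert_of_mem (hdone p hp hpi q hq hpq)
          · intro hi0 q hq hqj hiq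
            by_cases hqj' : q = j
            · exact hqj' ▸ Finset.mem_insert_self _ _
            · exact Finset.mem_insert_of_mem (hdone' hi0 q hq (by omega) hiq)
        · refine ⟨hτj, by simp [hτr], by simp [hτi], C, h0C, hcl.setS _ (by tauto), hC, hdone, ?_⟩
          intro hi0 q hq hqj hiq
          by_cases hqj' : q = j
          · subst hqj'
            exact absurd (hcond.mpr ⟨h0C hi0, hq, hiq⟩) h
          · exact hdone' hi0 q hq (by omega) hiq
      · rintro τ - ⟨hτr, hτi, C, h0C, hcl, hC, hdone, hdone'⟩
        refine ⟨hτi, by simp [hτr], C, h0C, hcl.setS _ (by tauto), hC, fun p hp hpi q hq hpq => ?_⟩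
        by_cases hpi' : p = i
        · subst hpi'
          exact hdone' hp q hq (hlt q hq) hpq
        · exact hdone p hp (by omega) q hq hpq
    · rintro τ - ⟨hτr, C, h0C, hcl, hC, hdone⟩
      refine ⟨hτr, C, hcl.setS _ (by tauto), hC, ?_⟩
      have hall : ∀ p ∈ C₀, ∀ q ∈ R, Conflict P.H P.k p q → q ∈ C := fun p hp =>
        hdone p hp (hlt p (hC₀.subset hp))
      rcases hgrow with h | h
      · left
        have : C = C₀ := Finset.Subset.antisymm (hC.least C₀ hC₀.subset h hC₀.mem) h0C
        rw [this]; exact h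
      · by_cases hEq : C₀ = C
        · left; rw [← hEq] at hall ⊢; exact hall
        · right
          have := Finset.card_lt_card (Finset.ssubset_iff_subset_ne.mpr ⟨h0C, hEq⟩)
          omega
  · rintro τ - ⟨C, hcl, hC, h⟩
    exact hQ τ C (hC.isComp (closedN C hC h)) hcl

/-- The color of the next smaller budget is found without a division. -/
theorem pred_mod {k d : ℕ} (hk : 0 < k) (hd : d ≠ 0) :
    (d - 1) % k = if d % k = 0 then k - 1 else d % k - 1 := by
  obtain ⟨e, rfl⟩ : ∃ e, d = e + 1 := ⟨d - 1, by omega⟩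
  have h1 := Nat.div_add_mod e k
  have h2 := Nat.mod_lt e hk
  rw [Nat.add_sub_cancel]
  by_cases h : e % k + 1 = k
  · have : (e + 1) % k = 0 := by
      rw [← Nat.mod_add_mod, h, Nat.mod_self]
    rw [if_pos this]; omega
  · have : (e + 1) % k = e % k + 1 := by
      rw [← Nat.mod_add_mod, Nat.mod_eq_of_lt (by omega)]
    rw [if_neg (by omega), this]; omega

theorem Run.prepare {j : ℕ} {C : Finset ℕ} (hctx : Ctx P σ) (htop : Top P σ l)
    (hbase : HasRow (σ.w .base) (l * P.N) P.N B) (hset : HasRow (σ.w .set) ((l + 1) * P.N) P.N C)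
    (hB : B ⊆ Finset.range P.N) (hC : C ⊆ Finset.range P.N) (hbud : σ.w .bud l = d)
    (hclr : σ.w .clr l = d % P.k) (hidx : σ.w .idx l = j) (hj : j < P.M) (hd : d ≠ 0)
    (hQ : ∀ τ, (∀ y, y ≠ .ix → y ≠ .cv → y ≠ .rv → y ≠ .rg → y ≠ .rh → τ.s y = σ.s y) → τ.v = σ.v →
      (∀ a, a ≠ .base → a ≠ .bud → a ≠ .clr → τ.w a = σ.w a) →
      (∀ i < (l + 1) * P.N, τ.w .base i = σ.w .base i) →
      (∀ i < l + 1, τ.w .bud i = σ.w .bud i) → (∀ i < l + 1, τ.w .clr i = σ.w .clr i) →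
      Call P τ (l + 1) (if Fresh P.H P.k B C (P.mv j) then C else B) C
        (if Fresh P.H P.k B C (P.mv j) then P.D else d - 1) → Q τ) :
    Run prepare σ (1 + (1 + ((4 * P.N + 3) + ((4 * P.N + 3) +
      (((P.N * 4 + 2) + (1 + (1 + 1))) + 1))))) Q := by
  have hb : (l + 1) * P.N = l * P.N + P.N := by ring
  have hv := P.mv_lt j hj
  have hrow := hctx.row _ hv
  refine Run.seq (Run.set (Run.seq (Run.set ?_)))
  set σ₂ := (σ.setS .cv ((Ex.rd .mv (.rd .idx (.var .lv))).eval σ)).setS .rv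
    ((Ex.rd .row (.var .cv)).eval (σ.setS .cv ((Ex.rd .mv (.rd .idx (.var .lv))).eval σ))) with hσ₂
  have e1 : σ₂.s .cv = P.mv j := by simp [hσ₂, htop.lv, hidx, hctx.mv j hj]
  have e2 : σ₂.s .rv = P.n * P.mv j := by simp [hσ₂, htop.lv, hidx, hctx.mv j hj, hrow]
  have e3 : ∀ y, y ≠ .cv → y ≠ .rv → σ₂.s y = σ.s y := fun y h1 h2 => by simp [hσ₂, h1, h2]
  have e4 : σ₂.w = σ.w := rfl
  have e5 : σ₂.v = σ.v := rfl
  clear_value σ₂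
  refine Run.seq (Run.search (x := .ix) (f := .rg) (N := P.N) (fun q => q ∈ B ∧ q / P.k = P.mv j)
    ?_ (by simp) (by simp) (by simp) ?_ ?_)
  · simp [e3, hctx.pairs]
  · intro i hi s' hs' hx
    simp [isOne, here, vtx, hx, hs', e1, e3, e4, htop.fb, hbase.one_iff hi, hctx.vert i hi]
  intro s₃ hs₃ hrg
  refine Run.seq (Run.search (x := .ix) (f := .rh) (N := P.N) (fun q => q ∈ C ∧ ¬ P.H.Adj (P.mv j) (q / P.k))
    ?_ (by simp) (by simp) (by simp) ?_ ?_)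
  · simp [hs₃, e3, hctx.pairs]
  · intro i hi s' hs' hx
    have := hset.one_iff hi
    rw [hb] at this
    simp [isOne, PartialColoringAlgorithm.above, adjTo, vtx, hx, hs', hs₃, e2, e3, e4, htop.fb, this, hctx.vert i hi, hctx.pairs,
      hctx.adj _ hv _ (P.div_lt hi)]
  intro s₄ hs₄ hrh
  rw [e4, e5]
  have f0 : s₄ .pairs = P.N := by simp [hs₄, hs₃, e3, hctx.pairs]
  have f1 : s₄ .fb = l * P.N := by simp [hs₄, hs₃, e3, htop.fb]
  have f2 : s₄ .lv = l := by simp [hs₄, hs₃, e3, htop.lv]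
  have f3 : ∀ y, y ≠ .ix → y ≠ .cv → y ≠ .rv → y ≠ .rg → y ≠ .rh → s₄ y = σ.s y :=
    fun y h1 h2 h3 h4 h5 => (hs₄ y h1 h5).trans ((hs₃ y h1 h4).trans (e3 y h2 h3))
  have hfresh : (Cond.conj (.lt (.var .rg) (.var .pairs)) (.eq (.var .rh) (.var .pairs))).Holds
      ⟨s₄, σ.w, σ.v⟩ ↔ Fresh P.H P.k B C (P.mv j) := by
    have hg : s₄ .rg < P.N ↔ P.mv j ∈ verts P.k B := by
      rw [hs₄ .rg (by simp) (by simp), mem_verts]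
      rcases hrg with ⟨h, h'⟩ | ⟨h, h'⟩
      · exact ⟨fun _ => ⟨_, h'⟩, fun _ => h⟩
      · refine ⟨fun h'' => absurd h (by simpa using h''.ne), fun ⟨p, hp, hpv⟩ => ?_⟩
        exact absurd ⟨hp, hpv⟩ (h' p (Finset.mem_range.mp (hB hp)))
    have hh : s₄ .rh = P.N ↔ ∀ p ∈ C, P.H.Adj (P.mv j) (p / P.k) := by
      rcases hrh with ⟨h, h'⟩ | ⟨h, h'⟩
      · exact ⟨fun h'' => absurd h'' h.ne, fun h'' => absurd (h'' _ h'.1) h'.2⟩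
      · refine ⟨fun _ p hp => ?_, fun _ => h⟩
        by_contra hadj
        exact h' p (Finset.mem_range.mp (hC hp)) ⟨hp, hadj⟩
    simp only [Cond.Holds, Ex.eval, f0, hg, hh, Fresh]
  have hpos : ∀ i < P.N, ∀ s' : Var → ℕ, ∀ w v, (∀ y, y ≠ .ix → s' y = s₄ y) → s' .ix = i →
      (above .ix).eval ⟨s', w, v⟩ = (l + 1) * P.N + i := by
    intro i hi s' w v hs' hx
    simp [PartialColoringAlgorithm.above, hx, hs', f0, f1, hb]
  refine Run.ifc (T := (P.N * 4 + 2) + (1 + (1 + 1))) (fun h => ?_) (fun h => ?_)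
  · have hF := hfresh.mp h
    simp only [if_pos hF] at hQ
    refine Run.seq (T₁ := P.N * 4 + 2) (T₂ := 1 + (1 + 1)) (Run.fillIf (N := P.N) ((l + 1) * P.N) (· ∈ C) f0 hpos ?_ ?_)
    · intro i hi s' hs' hx
      have := hset.one_iff hi
      rw [hb] at this
      simp [isOne, PartialColoringAlgorithm.above, hx, hs', f0, f1, this]
    intro s₅ hs₅
    have g1 : s₅ .lv = l := by simp [hs₅, f2]
    have g2 : s₅ .full = P.D := by simp [hs₅, f3, hctx.full]
    refine Run.seq (Run.wr (Run.weaken (T := 1) (Run.wr ?_) (by omega)))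
    refine hQ _ ?_ rfl ?_ ?_ ?_ ?_ ⟨?_, ?_, ?_, ?_⟩
    · intro y h1 h2 h3 h4 h5
      simp [hs₅ y h1, f3 y h1 h2 h3 h4 h5]
    · intro a h1 h2 h3
      simp [h1, h2, h3]
    · intro i hi
      simpa using overwrite_of_lt hi
    · intro i hi
      simp only [Store.setW_w, Ex.eval, Store.setW_s, g1, ne_eq, reduceCtorEq, not_false_eq_true,
        Function.update_of_ne, Function.update_self]
      exact Function.update_of_ne (by omega) _ _
    · intro i hi
      simp only [Store.setW_w, Ex.eval, Store.setW_s, g1, ne_eq, reduceCtorEq, not_false_eq_true,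
        Function.update_of_ne, Function.update_self]
      exact Function.update_of_ne (by omega) _ _
    · simpa using HasRow.overwrite (by simp)
    · simpa using hset
    · simp [g1, g2]
    · simp [g1, P.mod_D]
  · have hF : ¬ Fresh P.H P.k B C (P.mv j) := fun h' => h (hfresh.mpr h')
    simp only [if_neg hF] at hQ
    refine Run.seq (T₁ := P.N * 4 + 2) (T₂ := 1 + (1 + 1)) (Run.fillIf (N := P.N) ((l + 1) * P.N) (· ∈ B) f0 hpos ?_ ?_)
    · intro i hi s' hs' hx
      have : overwrite (σ.w .base) ((l + 1) * P.N) i (ind (· ∈ B)) (l * P.N + i) =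
        σ.w .base (l * P.N + i) := overwrite_of_lt (by omega)
      simp only [isOne, here, Cond.Holds, Ex.eval, hx, hs' .fb (by simp), f1, Function.update_self]
      rw [this, hbase.one_iff hi]
    intro s₅ hs₅
    have g1 : s₅ .lv = l := by simp [hs₅, f2]
    have g2 : s₅ .colors = P.k := by simp [hs₅, f3, hctx.colors]
    refine Run.seq (Run.wr ?_)
    have fin : ∀ a, a = (d - 1) % P.k → Q (((⟨s₅, Function.update σ.w .base
        (overwrite (σ.w .base) ((l + 1) * P.N) P.N (ind (· ∈ B))), σ.v⟩ : Store).setW .bud (l + 1)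
          (d - 1)).setW .clr (l + 1) a) := by
      rintro a rfl
      refine hQ _ ?_ rfl ?_ ?_ ?_ ?_ ⟨?_, ?_, ?_, ?_⟩
      · intro y h1 h2 h3 h4 h5
        simp [hs₅ y h1, f3 y h1 h2 h3 h4 h5]
      · intro a h1 h2 h3
        simp [h1, h2, h3]
      · intro i hi
        simpa using overwrite_of_lt hi
      · intro i hi
        simp only [Store.setW_w, ne_eq, reduceCtorEq, not_false_eq_true,
          Function.update_of_ne, Function.update_self]
        exact Function.update_of_ne (by omega) _ _
      · intro i hi
        simp only [Store.setW_w, ne_eq, reduceCtorEq, not_false_eq_true,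
          Function.update_of_ne, Function.update_self]
        exact Function.update_of_ne (by omega) _ _
      · simpa using HasRow.overwrite (by simp)
      · simpa using hset
      · simp
      · simp
    have hmod := pred_mod P.k_pos hd
    refine Run.ifc (fun h => Run.wr ?_) (fun h => Run.wr ?_)
    · have h0 : d % P.k = 0 := by simpa [g1, hclr] using h
      rw [if_pos h0] at hmod
      simpa [g1, g2, hbud] using fin (P.k - 1) hmod.symm
    · have h0 : ¬ d % P.k = 0 := by simpa [g1, hclr] using h
      rw [if_neg h0] at hmod
      simpa [g1, g2, hbud, hclr] using fin (d % P.k - 1) hmod.symm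

theorem Run.descend {j f : ℕ} {S R C : Finset ℕ} (hctx : Ctx P σ) (htop : Top P σ l)
    (hm : AtComp P σ l B A d j S R C) (hB : B ⊆ Finset.range P.N) (hR : R ⊆ Finset.range P.N)
    (hj : j < P.M) (hd : d ≠ 0) (hrf : σ.s .rf = f) (hf : f ∈ R)
    (hQ : ∀ σ' K, IsComp P.H P.k R K → Top P σ' (l + 1) → Agree P l 0 σ σ' →
      AtComp P σ' l B A d j S (R \ K) C →
      Call P σ' (l + 1) (if Fresh P.H P.k B K (P.mv j) then K else B) K
        (if Fresh P.H P.k B K (P.mv j) then P.D else d - 1) →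
      σ'.w .phase (l + 1) = 0 → Q σ') :
    Run descend σ
      (((P.N * 4 + 2) + (P.N * ((P.N * ((P.N * ((1 + 1) + 2) + 2) + 2) + 2) + 2) + 2)) +
      ((P.N * 4 + 2) + ((1 + (1 + ((4 * P.N + 3) + ((4 * P.N + 3) +
      (((P.N * 4 + 2) + (1 + (1 + 1))) + 1))))) + (1 + (1 + (1 + 1)))))) Q := by
  have hb : (l + 1) * P.N = l * P.N + P.N := by ring
  refine Run.seq (Run.component hctx htop.fb hm.rest hR hrf hf fun τ K hK hcl => ?_)
  have hKN : K ⊆ Finset.range P.N := hK.subset.trans hR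
  have hτ : ∀ y, y ≠ .ix → y ≠ .iy → y ≠ .iz → τ.s y = σ.s y := hcl.vars
  have hset : HasRow (τ.w .set) ((l + 1) * P.N) P.N K := by
    rw [hcl.arrays, Function.update_self]; exact HasRow.overwrite (by simp)
  have hset' : ∀ i < (l + 1) * P.N, τ.w .set i = σ.w .set i := fun i hi => by
    rw [hcl.arrays, Function.update_self]; exact overwrite_of_lt hi
  have hw : ∀ a, a ≠ .set → τ.w a = σ.w a := fun a ha => by
    rw [hcl.arrays, Function.update_of_ne ha]
  refine Run.seq (Run.fillIf (N := P.N) (l * P.N) (· ∈ R \ K) (by simp [hτ, hctx.pairs]) ?_ ?_ ?_)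
  · intro i hi s' w v hs' hx
    simp [here, hx, hs', hτ, htop.fb]
  · intro i hi s' hs' hx
    have h1 := hset.one_iff hi
    rw [hb] at h1
    simp [isOne, here, PartialColoringAlgorithm.above, hx, hs', hτ, htop.fb, hctx.pairs, h1,
      overwrite_of_ge le_rfl, hw, hm.rest.one_iff hi]
  intro s₁ hs₁
  have hs : ∀ y, y ≠ .ix → y ≠ .iy → y ≠ .iz → s₁ y = σ.s y := fun y h1 h2 h3 => by
    rw [hs₁ y h1, hτ y h1 h2 h3]
  have hvals : τ.v = σ.v := hcl.vals
  have hctx₁ : Ctx P ⟨s₁, Function.update τ.w .rest (overwrite (τ.w .rest) (l * P.N) P.N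
      (ind (· ∈ R \ K))), τ.v⟩ := by
    refine hctx.congr (l := 0) (r := 0) ⟨?_, ?_, ?_, ?_, ?_, ?_⟩
    · intro y hy
      rcases hy with rfl | rfl | rfl | rfl | rfl <;> simp [hs]
    · intro j hj
      rcases hj with rfl | rfl | rfl | rfl | rfl | rfl | rfl | rfl <;> simp [hw]
    · intro j _ i hi
      exact absurd hi (by simp)
    · intro i hi
      exact absurd hi (by simp)
    · intro j _ i hi
      exact absurd hi (by simp)
    · intro i _
      rw [← hvals]
  refine Run.seq (Run.prepare hctx₁ (l := l) (B := B) (C := K) (d := d) (j := j)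
    ⟨by simp [hs, htop.lv], by simp [hs, htop.fb], by simp [hs, htop.vb]⟩
    (by simpa [hw] using hm.base) (by simpa using hset) hB hKN (by simp [hw, hm.bud])
    (by simp [hw, hm.clr]) (by simp [hw, hm.idx]) hj hd ?_)
  intro ρ hρs hρv hρw hρbase hρbud hρclr hcall
  simp only at hρs hρv
  have hs' : ∀ y, y ≠ .ix → y ≠ .iy → y ≠ .iz → y ≠ .cv → y ≠ .rv → y ≠ .rg → y ≠ .rh →
      ρ.s y = σ.s y := fun y h1 h2 h3 h4 h5 h6 h7 => by rw [hρs y h1 h4 h5 h6 h7, hs y h1 h2 h3]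
  have r1 : ∀ a, a ≠ .base → a ≠ .bud → a ≠ .clr → a ≠ .rest → a ≠ .set → ρ.w a = σ.w a := by
    intro a h1 h2 h3 h4 h5
    rw [hρw a h1 h2 h3]
    simp [h4, hw a h5]
  have r2 : ∀ i < (l + 1) * P.N, ρ.w .base i = σ.w .base i := fun i hi => by
    rw [hρbase i hi]; simp [hw]
  have r3 : ∀ i < l + 1, ρ.w .bud i = σ.w .bud i := fun i hi => by rw [hρbud i hi]; simp [hw]
  have r4 : ∀ i < l + 1, ρ.w .clr i = σ.w .clr i := fun i hi => by rw [hρclr i hi]; simp [hw]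
  have r5 : ρ.w .rest = overwrite (σ.w .rest) (l * P.N) P.N (ind (· ∈ R \ K)) := by
    rw [hρw _ (by simp) (by simp) (by simp)]; simp [hw]
  have r6 : ∀ i < (l + 1) * P.N, ρ.w .set i = σ.w .set i := fun i hi => by
    rw [hρw _ (by simp) (by simp) (by simp)]; simpa using hset' i hi
  have r7 : ρ.v = σ.v := hρv.trans hvals
  have hlv : ρ.s .lv = l := by simp [hs', htop.lv]
  refine Run.seq (Run.wr (Run.seq (Run.set (Run.seq (Run.set (Run.set ?_))))))
  refine hQ _ K hK ⟨?_, ?_, ?_⟩ ⟨?_, ?_, ?_, ?_, ?_, ?_⟩ ⟨⟨?_, ?_, ?_, ?_⟩, ?_, ?_, ?_, ?_, ?_, ?_, ?_⟩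
    ⟨?_, ?_, ?_, ?_⟩ ?_
  · simp [hlv]
  · simp [hs', htop.fb, hctx.pairs, hb]
  · simp [hs', htop.vb]; omega
  · intro y hy
    rcases hy with rfl | rfl | rfl | rfl | rfl <;> simp [hs']
  · intro j hj
    rcases hj with rfl | rfl | rfl | rfl | rfl | rfl | rfl | rfl <;> simp [r1]
  · intro j hj i hi
    rw [Nat.add_zero] at hi
    rcases hj with rfl | rfl | rfl | rfl
    · simpa using r6 i (by omega)
    · simpa using r2 i (by omega)
    · simpa [r5] using overwrite_of_lt hi
    · simp [r1]
  · intro i hi; simp [r1]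
  · intro j hj i hi
    rw [Nat.add_zero] at hi
    rcases hj with rfl | rfl | rfl | rfl
    · simpa using r3 i (by omega)
    · simpa using r4 i (by omega)
    · simp [r1]
    · simp only [Store.setS_w, Store.setW_w, Ex.eval, hlv, Function.update_self]
      rw [Function.update_of_ne (by omega), r1 _ (by simp) (by simp) (by simp) (by simp) (by simp)]
  · intro i hi; simp [r7]
  · exact hm.base.congr fun i hi => by simpa using r2 i (by omega)
  · exact hm.set.congr fun i hi => by simpa using r6 i (by omega)
  · simpa using (r3 l (by omega)).trans hm.bud
  · simpa using (r4 l (by omega)).trans hm.clr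
  · simp only [Store.setS_w, Store.setW_w, Ex.eval, hlv, Function.update_self]
    rw [Function.update_of_ne (by omega), r1 _ (by simp) (by simp) (by simp) (by simp) (by simp),
      hm.phase]
  · simpa [r1] using hm.idx
  · simpa [r1] using hm.best
  · simpa [r7] using hm.bestVal
  · simpa [r5] using HasRow.overwrite (by simp)
  · simpa [r1] using hm.cur
  · simpa [r7] using hm.curVal
  · simpa using hcall.base
  · simpa using hcall.set
  · simpa using hcall.bud
  · simpa using hcall.clr
  · simp [hlv]

end PartialColoringAlgorithm

namespace PartialColoringAlgorithm

open Classical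

variable {P : Inst} {σ : Store} {l : ℕ} {B A : Finset ℕ} {d : ℕ} {Q : Store → Prop}

/-! ### Correctness and running time of the recursion -/

/-- A bound for the time of one step of the stack machine. -/
def Inst.cost (P : Inst) : ℕ := 50 * (P.N + 1) ^ 3

theorem Run.main_step {T : ℕ} (hlv : σ.s .lv ≠ 0)
    (h : Run step σ (P.cost - 1) fun σ' => Run mainLoop σ' T Q) : Run mainLoop σ (P.cost + T) Q := by
  have hc : 0 < P.cost := by unfold Inst.cost; positivity
  refine Run.weaken (Run.loop_true (by simpa using Nat.pos_of_ne_zero hlv) h) (by omega)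

theorem Run.main_enter {T : ℕ} (hctx : Ctx P σ) (htop : Top P σ (l + 1))
    (hcall : Call P σ (l + 1) B A d) (hph : σ.w .phase (l + 1) = 0) (hA : A ⊆ Finset.range P.N)
    (hne : A.Nonempty)
    (hQ : ∀ σ' p, p ∈ A → Top P σ' (l + 1) → Agree P (l + 1) 0 σ σ' →
      AtMove P σ' (l + 1) B A d (if d = 0 then P.M else 0) {p} → Run mainLoop σ' T Q) :
    Run mainLoop σ (P.cost + T) Q := by
  refine Run.main_step (by simp [htop.lv]) (Run.weaken (Run.ifc (fun _ =>
    Run.enter hctx htop hcall hA hne hQ) fun h => absurd ?_ h) ?_)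
  · simp [htop.lv, hph]
  · have : P.cost = 50 * P.N ^ 3 + 150 * P.N ^ 2 + 150 * P.N + 50 := by unfold Inst.cost; ring
    omega

theorem Run.main_ret {T : ℕ} {S C : Finset ℕ} (hctx : Ctx P σ) (htop : Top P σ (l + 1))
    (hm : AtMove P σ (l + 1) B A d P.M S) (hC : HasRow (σ.w .cur) (l * P.N) P.N C)
    (hQ : ∀ σ', Top P σ' l → Agree P l 1 σ σ' → HasRow (σ'.w .cur) (l * P.N) P.N (C ∪ S) →
      σ'.v (P.N + 2 * l + 1) = σ.v (P.N + 2 * l + 1) + ∑ p ∈ S, P.wt p → Run mainLoop σ' T Q) :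
    Run mainLoop σ (P.cost + T) Q := by
  refine Run.main_step (by simp [htop.lv]) (Run.weaken (Run.ifc (fun h => absurd h ?_) fun _ =>
    Run.ifc (fun _ => Run.ifc (fun _ => Run.ret hctx htop hm hC hQ) fun h => absurd ?_ h)
      fun h => absurd ?_ h) ?_)
  · simp [htop.lv, hm.phase]
  · simp [htop.lv, hm.idx, hctx.moves]
  · simp [htop.lv, hm.phase]
  · have : P.cost = 50 * P.N ^ 3 + 150 * P.N ^ 2 + 150 * P.N + 50 := by unfold Inst.cost; ring
    omega

theorem Run.main_start {T j : ℕ} {S : Finset ℕ} (hctx : Ctx P σ) (htop : Top P σ (l + 1))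
    (hm : AtMove P σ (l + 1) B A d j S) (hA : A ⊆ Finset.range P.N) (hj : j < P.M)
    (hQ : ∀ σ', Top P σ' (l + 1) → Agree P (l + 1) 0 σ σ' →
      AtComp P σ' (l + 1) B A d j S (move P.H P.k A (P.mv j) (P.ma j) (P.mb j) (d % P.k)) ∅ →
      Run mainLoop σ' T Q) :
    Run mainLoop σ (P.cost + T) Q := by
  refine Run.main_step (by simp [htop.lv]) (Run.weaken (Run.ifc (fun h => absurd h ?_) fun _ =>
    Run.ifc (fun _ => Run.ifc (fun h => absurd h ?_) fun _ => Run.startMove hctx htop hm hA hj hQ)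
      fun h => absurd ?_ h) ?_)
  · simp [htop.lv, hm.phase]
  · simp [htop.lv, hm.idx, hctx.moves, hj.ne]
  · simp [htop.lv, hm.phase]
  · have : P.cost = 50 * P.N ^ 3 + 150 * P.N ^ 2 + 150 * P.N + 50 := by unfold Inst.cost; ring
    have h2 : P.N * ((4 * P.N + 3 + 2) + 2) = 4 * P.N ^ 2 + 7 * P.N := by ring
    omega

theorem Run.main_comp {T j : ℕ} {S R C : Finset ℕ} (hctx : Ctx P σ) (htop : Top P σ (l + 1))
    (hm : AtComp P σ (l + 1) B A d j S R C) (hB : B ⊆ Finset.range P.N)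
    (hR : R ⊆ Finset.range P.N) (hj : j < P.M) (hd : d ≠ 0)
    (hfin : R = ∅ → ∀ σ', Top P σ' (l + 1) → Agree P (l + 1) 0 σ σ' →
      AtMove P σ' (l + 1) B A d (j + 1) (if ∑ p ∈ S, P.wt p < ∑ p ∈ C, P.wt p then C else S) →
      Run mainLoop σ' T Q)
    (hdesc : ∀ σ' K, IsComp P.H P.k R K → Top P σ' (l + 2) → Agree P (l + 1) 0 σ σ' →
      AtComp P σ' (l + 1) B A d j S (R \ K) C →
      Call P σ' (l + 2) (if Fresh P.H P.k B K (P.mv j) then K else B) K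
        (if Fresh P.H P.k B K (P.mv j) then P.D else d - 1) →
      σ'.w .phase (l + 2) = 0 → Run mainLoop σ' T Q) :
    Run mainLoop σ (P.cost + T) Q := by
  have hcost : P.cost = 50 * P.N ^ 3 + 150 * P.N ^ 2 + 150 * P.N + 50 := by unfold Inst.cost; ring
  have hpoly : P.N * ((P.N * ((P.N * ((1 + 1) + 2) + 2) + 2) + 2) + 2) =
    4 * P.N ^ 3 + 4 * P.N ^ 2 + 4 * P.N := by ring
  refine Run.main_step (by simp [htop.lv]) (Run.weaken (T := (4 * P.N + 3 +
    ((((P.N * 4 + 2) + (P.N * ((P.N * ((P.N * ((1 + 1) + 2) + 2) + 2) + 2) + 2) + 2)) +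
      ((P.N * 4 + 2) + ((1 + (1 + ((4 * P.N + 3) + ((4 * P.N + 3) +
      (((P.N * 4 + 2) + (1 + (1 + 1))) + 1))))) + (1 + (1 + (1 + 1)))))) + 1)) + 1 + 1)
    (Run.ifc (fun h => absurd h ?_) fun _ => Run.ifc (fun h => absurd h ?_) fun _ =>
      Run.seq (Run.search (N := P.N) (· ∈ R) hctx.pairs (by simp) (by simp) (by simp) ?_ ?_)) ?_)
  · simp [htop.lv, hm.phase]
  · simp [htop.lv, hm.phase]
  · intro i hi s' hs' hx
    simp [isOne, here, hx, hs', htop.fb, hm.rest.one_iff hi]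
  · intro s₁ hs₁ hf
    have hag : Agree P (l + 1) 0 σ ⟨s₁, σ.w, σ.v⟩ := by
      refine ⟨?_, ?_, ?_, ?_, ?_, ?_⟩
      · intro y hy
        rcases hy with rfl | rfl | rfl | rfl | rfl <;> simp [hs₁]
      all_goals intros; rfl
    have hctx₁ : Ctx P ⟨s₁, σ.w, σ.v⟩ := hctx.congr hag
    have htop₁ : Top P ⟨s₁, σ.w, σ.v⟩ (l + 1) :=
      ⟨by simp [hs₁, htop.lv], by simp [hs₁, htop.fb], by simp [hs₁, htop.vb]⟩
    have hm₁ : AtComp P ⟨s₁, σ.w, σ.v⟩ (l + 1) B A d j S R C :=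
      ⟨⟨hm.base, hm.set, hm.bud, hm.clr⟩, hm.phase, hm.idx, hm.best, hm.bestVal, hm.rest, hm.cur,
        hm.curVal⟩
    refine Run.ifc (fun h => ?_) fun h => ?_
    · have h' : s₁ .rf = P.N := Eq.trans (by simpa using h) hctx₁.pairs
      have hR0 : R = ∅ := by
        rcases hf with hf | ⟨-, hf⟩
        · exact absurd h' hf.1.ne
        · exact Finset.eq_empty_of_forall_notMem fun p hp =>
            hf p (Finset.mem_range.mp (hR hp)) hp
      subst hR0
      exact Run.weaken (Run.finish hctx₁ htop₁ hm₁ fun σ' h1 h2 h3 =>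
        hfin rfl σ' h1 (hag.trans h2) h3) (by omega)
    · have h' : s₁ .rf ≠ P.N := by
        intro h'; exact h (by simpa using h'.trans hctx₁.pairs.symm)
      have hfR : s₁ .rf ∈ R := by
        rcases hf with hf | ⟨hf, -⟩
        · exact hf.2
        · exact absurd hf h'
      exact Run.descend hctx₁ htop₁ hm₁ hB hR hj hd rfl hfR fun σ' K h1 h2 h3 h4 h5 h6 =>
        hdesc σ' K h1 h2 (hag.trans h3) h4 h5 h6
  · omega

/-- Within time `U` for each pair of the set, the procedure returns a solution that is at least as
good as all those that are reached, for all calls of measure at most `μ`. -/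
def Solves (P : Inst) (μ U : ℕ) : Prop :=
  ∀ (l : ℕ) (σ : Store) (B A : Finset ℕ) (d w : ℕ) (C : Finset ℕ) (T : ℕ) (Q : Store → Prop),
    Ctx P σ → Top P σ (l + 1) → Call P σ (l + 1) B A d → σ.w .phase (l + 1) = 0 → A ⊆ B →
    B ⊆ Finset.range P.N → A.Nonempty → CliqueLE P.H (verts P.k B) w → w * (P.D + 1) + d ≤ μ →
    HasRow (σ.w .cur) (l * P.N) P.N C →
    (∀ σ' S, S ⊆ A → ConflictFree P.H P.k S →
      (∀ I, Reach P.n P.k P.D P.H B A d I → ∑ p ∈ I, P.wt p ≤ ∑ p ∈ S, P.wt p) →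
      Top P σ' l → Agree P l 1 σ σ' → HasRow (σ'.w .cur) (l * P.N) P.N (C ∪ S) →
      σ'.v (P.N + 2 * l + 1) = σ.v (P.N + 2 * l + 1) + ∑ p ∈ S, P.wt p → Run mainLoop σ' T Q) →
    Run mainLoop σ (A.card * U + T) Q

/-- The solution `I` lives in `R`, and on each component of `R` it is reached by the recursive call. -/
def Covers (P : Inst) (B R : Finset ℕ) (d v : ℕ) (I : Finset ℕ) : Prop :=
  I ⊆ R ∧ ∀ K, IsComp P.H P.k R K → Reach P.n P.k P.D P.H
    (if Fresh P.H P.k B K v then K else B) K (if Fresh P.H P.k B K v then P.D else d - 1) (I ∩ K)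

theorem IsComp.of_closed {H : SimpleGraph ℕ} {k : ℕ} {R R' K : Finset ℕ} (h : IsComp H k R K)
    (hR : R ⊆ R') (hcl : ∀ p ∈ R, ∀ q ∈ R', Conflict H k p q → q ∈ R) : IsComp H k R' K :=
  ⟨h.subset.trans hR, h.nonempty, fun p hp q hq hpq =>
    h.closed p hp q (hcl p (h.subset hp) q hq hpq) hpq, h.conn⟩

theorem ConflictFree.union {H : SimpleGraph ℕ} {k : ℕ} {I J : Finset ℕ} (hI : ConflictFree H k I)
    (hJ : ConflictFree H k J) (h : ∀ p ∈ I, ∀ q ∈ J, ¬ Conflict H k p q) :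
    ConflictFree H k (I ∪ J) := by
  intro p hp q hq hpq
  rcases Finset.mem_union.mp hp with hp | hp <;> rcases Finset.mem_union.mp hq with hq | hq
  · exact hI p hp q hq hpq
  · exact h p hp q hq hpq
  · exact h q hq p hp hpq.symm
  · exact hJ p hp q hq hpq

theorem AtComp.congr {j : ℕ} {S R C C' : Finset ℕ} {σ' : Store} (h : AtComp P σ l B A d j S R C)
    (ha : Agree P l 1 σ σ') (hcur : HasRow (σ'.w .cur) (l * P.N) P.N C')
    (hval : σ'.v (P.N + 2 * l + 1) = ∑ p ∈ C', P.wt p) : AtComp P σ' l B A d j S R C' := by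
  have hb : (l + 1) * P.N = l * P.N + P.N := by ring
  refine ⟨⟨?_, ?_, ?_, ?_⟩, ?_, ?_, ?_, ?_, ?_, hcur, hval⟩
  · exact h.base.congr fun i hi => ha.rows _ (by tauto) i (by omega)
  · exact h.set.congr fun i hi => ha.rows _ (by tauto) i (by omega)
  · rw [ha.entries _ (by tauto) _ (by omega), h.bud]
  · rw [ha.entries _ (by tauto) _ (by omega), h.clr]
  · rw [ha.entries _ (by tauto) _ (by omega), h.phase]
  · rw [ha.entries _ (by tauto) _ (by omega), h.idx]
  · exact h.best.congr fun i hi => ha.rows _ (by tauto) i (by omega)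
  · rw [ha.vals _ (by omega), h.bestVal]
  · exact h.rest.congr fun i hi => ha.rows _ (by tauto) i (by omega)

/-- Treating all components of a move: `R` is the union of the components of `R₀` that remain, and `C` is at
least as good on the others as every solution that is reached. -/
theorem Solves.components {μ U T j w : ℕ} {S R₀ : Finset ℕ} (hs : Solves P μ U)
    (hAB : A ⊆ B) (hB : B ⊆ Finset.range P.N) (hRA : R₀ ⊆ A) (hw : CliqueLE P.H (verts P.k B) w)
    (hμ : w * (P.D + 1) + d ≤ μ + 1) (hj : j < P.M) (hd : d ≠ 0) :
    ∀ (r : ℕ) (σ : Store) (R C : Finset ℕ), R.card = r → Ctx P σ → Top P σ (l + 1) →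
    AtComp P σ (l + 1) B A d j S R C → R ⊆ R₀ →
    (∀ p ∈ R, ∀ q ∈ R₀, Conflict P.H P.k p q → q ∈ R) → C ⊆ R₀ \ R → ConflictFree P.H P.k C →
    (∀ I, Covers P B R₀ d (P.mv j) I → ∑ p ∈ I \ R, P.wt p ≤ ∑ p ∈ C, P.wt p) →
    (∀ σ' S', (S' = S ∨ S' ⊆ R₀ ∧ ConflictFree P.H P.k S') → ∑ p ∈ S, P.wt p ≤ ∑ p ∈ S', P.wt p →
      (∀ I, Covers P B R₀ d (P.mv j) I → ∑ p ∈ I, P.wt p ≤ ∑ p ∈ S', P.wt p) →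
      Top P σ' (l + 1) → Agree P (l + 1) 0 σ σ' → AtMove P σ' (l + 1) B A d (j + 1) S' →
      Run mainLoop σ' T Q) →
    Run mainLoop σ (R.card * (P.cost + U) + (P.cost + T)) Q := by
  intro r
  induction r using Nat.strong_induction_on with
  | _ r ih =>
  intro σ R C hr hctx htop hm hRR hcl hC hCF hopt hQ
  have hRN : R ⊆ Finset.range P.N := hRR.trans (hRA.trans (hAB.trans hB))
  by_cases hR : R = ∅
  · subst hR
    refine Run.weaken (Run.main_comp (T := T) hctx htop hm hB hRN hj hd ?_ ?_) (by simp)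
    · rintro - σ' h1 h2 h3
      refine hQ σ' _ ?_ ?_ ?_ h1 h2 h3
      · split_ifs
        · exact Or.inr ⟨hC.trans Finset.sdiff_subset, hCF⟩
        · exact Or.inl rfl
      · split_ifs with h
        · exact h.le
        · exact le_rfl
      · intro I hI
        have := hopt I hI
        rw [Finset.sdiff_empty] at this
        split_ifs with h
        · exact this
        · exact this.trans (not_lt.mp h)
    · intro σ' K hK
      exact absurd (Finset.subset_empty.mp hK.subset) hK.nonempty.ne_empty
  · have hlt : P.cost + (R.card * (P.cost + U) + T) ≤ R.card * (P.cost + U) + (P.cost + T) := by omega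
    refine Run.weaken (Run.main_comp (T := R.card * (P.cost + U) + T) hctx htop hm hB hRN hj hd
      (fun h => absurd h hR) ?_) hlt
    intro σ₁ K hK htop₁ hag₁ hm₁ hcall hph
    have hctx₁ := hctx.congr hag₁
    have hK0 : IsComp P.H P.k R₀ K := hK.of_closed hRR hcl
    have hKA : K ⊆ A := hK0.subset.trans hRA
    have hKpos : 0 < K.card := hK.nonempty.card_pos
    have hcard : K.card + (R \ K).card = R.card := by
      rw [Finset.card_sdiff_of_subset hK.subset]
      have := Finset.card_le_card hK.subset
      omega
    -- The measure decreases: either the budget does, or the clique number of the base set.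
    obtain ⟨w', hw', hμ'⟩ : ∃ w', CliqueLE P.H (verts P.k
        (if Fresh P.H P.k B K (P.mv j) then K else B)) w' ∧
        w' * (P.D + 1) + (if Fresh P.H P.k B K (P.mv j) then P.D else d - 1) ≤ μ := by
      by_cases hF : Fresh P.H P.k B K (P.mv j)
      · simp only [if_pos hF]
        have hpos : 0 < w := hw.pos ⟨_, hF.1⟩
        obtain ⟨w', rfl⟩ : ∃ w', w = w' + 1 := ⟨w - 1, by omega⟩
        refine ⟨w', hw.nbhd hF.1 (verts_mono (hKA.trans hAB)) ?_, ?_⟩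
        · intro x hx
          obtain ⟨p, hp, rfl⟩ := mem_verts.mp hx
          exact hF.2 p hp
        · have : (w' + 1) * (P.D + 1) = w' * (P.D + 1) + P.D + 1 := by ring
          omega
      · simp only [if_neg hF]
        exact ⟨w, hw, by omega⟩
    have htime : K.card * U + ((R \ K).card * (P.cost + U) + (P.cost + T)) ≤
        R.card * (P.cost + U) + T := by
      rw [← hcard]
      have : P.cost ≤ K.card * P.cost := Nat.le_mul_of_pos_left _ hKpos
      have e : (K.card + (R \ K).card) * (P.cost + U) =
        K.card * P.cost + K.card * U + (R \ K).card * (P.cost + U) := by ring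
      omega
    refine Run.weaken (hs (l + 1) σ₁ _ K _ w' C _ Q hctx₁ htop₁ hcall hph ?_ ?_ hK.nonempty hw' hμ'
      hm₁.cur ?_) htime
    · split_ifs
      · exact subset_rfl
      · exact hKA.trans hAB
    · split_ifs
      · exact hKA.trans (hAB.trans hB)
      · exact hB
    intro σ₂ S₂ hS₂ hCF₂ hopt₂ htop₂ hag₂ hcur₂ hval₂
    have hdisj : Disjoint C S₂ := by
      rw [Finset.disjoint_left]
      exact fun p hp hp' => (Finset.mem_sdiff.mp (hC hp)).2 (hK.subset (hS₂ hp'))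
    refine ih (R \ K).card (by omega) σ₂ (R \ K) (C ∪ S₂) rfl (hctx₁.congr hag₂) htop₂
      (hm₁.congr hag₂ hcur₂ ?_) (Finset.sdiff_subset.trans hRR) ?_ ?_ ?_ ?_ ?_
    · rw [hval₂, hm₁.curVal, Finset.sum_union hdisj]
    · intro p hp q hq hpq
      rw [Finset.mem_sdiff] at hp ⊢
      exact ⟨hcl p hp.1 q hq hpq, fun h => hp.2 (hK.closed q h p hp.1 hpq.symm)⟩
    · refine Finset.union_subset (fun p hp => ?_) fun p hp => ?_
      · have := Finset.mem_sdiff.mp (hC hp)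
        exact Finset.mem_sdiff.mpr ⟨this.1, fun h => this.2 (Finset.mem_sdiff.mp h).1⟩
      · exact Finset.mem_sdiff.mpr ⟨hK0.subset (hS₂ hp), fun h => (Finset.mem_sdiff.mp h).2 (hS₂ hp)⟩
    · refine hCF.union hCF₂ fun p hp q hq hpq => ?_
      have := Finset.mem_sdiff.mp (hC hp)
      exact this.2 (hcl q (hK.subset (hS₂ hq)) p this.1 hpq.symm)
    · intro I hI
      have h1 := hopt I hI
      have h2 := hopt₂ _ (hI.2 K hK0)
      have e : I \ (R \ K) = (I \ R) ∪ (I ∩ K) := by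
        ext p
        have := @hK.subset p
        simp only [Finset.mem_sdiff, Finset.mem_union, Finset.mem_inter]
        tauto
      have hd' : Disjoint (I \ R) (I ∩ K) := by
        rw [Finset.disjoint_left]
        exact fun p hp hp' => (Finset.mem_sdiff.mp hp).2 (hK.subset (Finset.mem_inter.mp hp').2)
      rw [e, Finset.sum_union hd', Finset.sum_union hdisj]
      exact add_le_add h1 h2
    · intro σ' S' h1 h2 h3 h4 h5 h6
      exact hQ σ' S' h1 h2 h3 h4 ((hag₁.trans hag₂.weaken).trans h5) h6

theorem move_subset {H : SimpleGraph ℕ} {k v a b e : ℕ} : move H k A v a b e ⊆ A :=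
  Finset.filter_subset _ _

/-- Trying all moves from number `j` on, where `S` is at least as good as every solution that is reached by
the moves before. -/
theorem Solves.loop {μ U T w : ℕ} {C₀ : Finset ℕ} (hs : Solves P μ U)
    (hAB : A ⊆ B) (hB : B ⊆ Finset.range P.N) (hw : CliqueLE P.H (verts P.k B) w)
    (hμ : w * (P.D + 1) + d ≤ μ + 1) (hd : d ≠ 0) :
    ∀ (m j : ℕ) (σ : Store) (S : Finset ℕ), j + m = P.M → Ctx P σ → Top P σ (l + 1) →
    AtMove P σ (l + 1) B A d j S → S ⊆ A → ConflictFree P.H P.k S →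
    (∀ i < j, ∀ I, Covers P B (move P.H P.k A (P.mv i) (P.ma i) (P.mb i) (d % P.k)) d (P.mv i) I →
      ∑ p ∈ I, P.wt p ≤ ∑ p ∈ S, P.wt p) →
    HasRow (σ.w .cur) (l * P.N) P.N C₀ →
    (∀ σ' S', S' ⊆ A → ConflictFree P.H P.k S' → ∑ p ∈ S, P.wt p ≤ ∑ p ∈ S', P.wt p →
      (∀ i < P.M, ∀ I, Covers P B (move P.H P.k A (P.mv i) (P.ma i) (P.mb i) (d % P.k)) d (P.mv i) I →
        ∑ p ∈ I, P.wt p ≤ ∑ p ∈ S', P.wt p) →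
      Top P σ' l → Agree P l 1 σ σ' → HasRow (σ'.w .cur) (l * P.N) P.N (C₀ ∪ S') →
      σ'.v (P.N + 2 * l + 1) = σ.v (P.N + 2 * l + 1) + ∑ p ∈ S', P.wt p → Run mainLoop σ' T Q) →
    Run mainLoop σ (m * (2 * P.cost + A.card * (P.cost + U)) + (P.cost + T)) Q := by
  intro m
  induction m with
  | zero =>
    intro j σ S hj hctx htop hm hSA hCF hopt hcur hQ
    obtain rfl : j = P.M := by omega
    exact Run.weaken (Run.main_ret (T := T) hctx htop hm hcur fun σ' h1 h2 h3 h4 =>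
      hQ σ' S hSA hCF le_rfl hopt h1 h2 h3 h4) (by simp)
  | succ m ih =>
    intro j σ S hj hctx htop hm hSA hCF hopt hcur hQ
    have hjM : j < P.M := by omega
    set R₀ := move P.H P.k A (P.mv j) (P.ma j) (P.mb j) (d % P.k) with hR₀
    have hRA : R₀ ⊆ A := move_subset
    have hcard : R₀.card * (P.cost + U) ≤ A.card * (P.cost + U) :=
      Nat.mul_le_mul_right _ (Finset.card_le_card hRA)
    refine Run.weaken (Run.main_start (T := R₀.card * (P.cost + U) + (P.cost +
      (m * (2 * P.cost + A.card * (P.cost + U)) + (P.cost + T)))) hctx htop hm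
      (hAB.trans hB) hjM ?_) (by rw [Nat.succ_mul m]; omega)
    intro σ₁ htop₁ hag₁ hm₁
    have hctx₁ := hctx.congr hag₁
    refine hs.components hAB hB hRA hw hμ hjM hd R₀.card σ₁ R₀ ∅ rfl hctx₁ htop₁ hm₁ subset_rfl
      (fun _ _ q hq _ => hq) (by simp) (by intro p hp; simp at hp) ?_ ?_
    · intro I hI
      rw [Finset.sdiff_eq_empty_iff_subset.mpr hI.1]
    · intro σ₂ S₂ hS₂ hle hopt₂ htop₂ hag₂ hm₂
      have hS₂' : S₂ ⊆ A ∧ ConflictFree P.H P.k S₂ := by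
        rcases hS₂ with rfl | h
        · exact ⟨hSA, hCF⟩
        · exact ⟨h.1.trans hRA, h.2⟩
      have hag := hag₁.trans hag₂
      have hb : (l + 1) * P.N = l * P.N + P.N := by ring
      refine ih (j + 1) σ₂ S₂ (by omega) (hctx₁.congr hag₂) htop₂ hm₂ hS₂'.1 hS₂'.2 ?_
        (hcur.congr fun i hi => hag.cur i (by omega)) ?_
      · intro i hi I hI
        rcases Nat.lt_succ_iff_lt_or_eq.mp hi with h | rfl
        · exact (hopt i h I hI).trans hle
        · exact hopt₂ I hI
      · intro σ' S' h1 h2 h3 h4 h5 h6 h7 h8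
        refine hQ σ' S' h1 h2 (hle.trans h3) h4 h5 (hag.down.trans h6) h7 ?_
        rw [h8, hag.vals _ (by omega)]

theorem Inst.M_pos (hN : 0 < P.N) : 0 < P.M := by
  have hn : 0 < P.n := Nat.pos_of_ne_zero fun h => by simp [Inst.N, h] at hN
  obtain ⟨j, hj, -⟩ := P.moves 0 hn 0 hn 0 hn
  omega

theorem conflictFree_singleton {H : SimpleGraph ℕ} {k p : ℕ} : ConflictFree H k {p} := by
  intro q hq r hr
  rw [Finset.mem_singleton] at hq hr
  subst hq hr
  rintro (⟨-, h⟩ | ⟨-, h⟩)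
  · exact h rfl
  · exact H.irrefl h

/-- The procedure is correct, and its running time is governed by the measure, which drops in
each recursive call. -/
theorem solves (P : Inst) (μ : ℕ) : Solves P μ (P.cost * (10 * P.M) ^ (μ + 1)) := by
  induction μ with
  | zero =>
    -- A nonempty base set has positive clique number, so that the measure is positive.
    intro l σ B A d w C T Q hctx htop hcall hph hAB hB hne hw hμ hcur hQ
    have hA := hAB.trans hB
    exfalso
    obtain ⟨p, hp⟩ := hne
    have : 0 < w := hw.pos ⟨_, mem_verts.mpr ⟨p, hAB hp, rfl⟩⟩
    have : 0 < w * (P.D + 1) := by positivity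
    omega
  | succ μ ih =>
    intro l σ B A d w C T Q hctx htop hcall hph hAB hB hne hw hμ hcur hQ
    have hA := hAB.trans hB
    have hM : 0 < P.M := by
      obtain ⟨p, hp⟩ := hne
      have := Finset.mem_range.mp (hA hp)
      exact Inst.M_pos (by omega)
    have hb : (l + 1) * P.N = l * P.N + P.N := by ring
    have hcard := hne.card_pos
    set U := P.cost * (10 * P.M) ^ (μ + 1) with hU
    have hUc : P.cost ≤ U := Nat.le_mul_of_pos_right _ (by positivity)
    have hU' : P.cost * (10 * P.M) ^ (μ + 1 + 1) = P.M * (10 * U) := by rw [hU]; ring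
    have htime : P.cost + (P.M * (2 * P.cost + A.card * (P.cost + U)) + (P.cost + T)) ≤
        A.card * (P.cost * (10 * P.M) ^ (μ + 1 + 1)) + T := by
      rw [hU']
      have h1 : 2 * P.cost ≤ A.card * (P.M * (2 * U)) := by
        calc 2 * P.cost ≤ 2 * U := by omega
          _ ≤ P.M * (2 * U) := Nat.le_mul_of_pos_left _ hM
          _ ≤ _ := Nat.le_mul_of_pos_left _ hcard
      have h2 : P.M * (2 * P.cost) ≤ A.card * (P.M * (2 * U)) :=
        (Nat.mul_le_mul_left _ (by omega)).trans (Nat.le_mul_of_pos_left _ hcard)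
      have h3 : P.M * (A.card * (P.cost + U)) ≤ A.card * (P.M * (2 * U)) := by
        rw [Nat.mul_left_comm]
        exact Nat.mul_le_mul_left _ (Nat.mul_le_mul_left _ (by omega))
      have e1 : A.card * (P.M * (10 * U)) = 5 * (A.card * (P.M * (2 * U))) := by ring
      rw [Nat.mul_add]
      omega
    refine Run.weaken (Run.main_enter (T := P.M * (2 * P.cost + A.card * (P.cost + U)) + (P.cost + T))
      hctx htop hcall hph hA hne ?_) htime
    intro σ₁ p hp htop₁ hag₁ hm₁
    have hctx₁ := hctx.congr hag₁
    have hcur₁ : HasRow (σ₁.w .cur) (l * P.N) P.N C := hcur.congr fun i hi => hag₁.cur i (by omega)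
    have hval₁ : σ₁.v (P.N + 2 * l + 1) = σ.v (P.N + 2 * l + 1) := hag₁.vals _ (by omega)
    have single : ∀ S : Finset ℕ, ∑ q ∈ {p}, P.wt q ≤ ∑ q ∈ S, P.wt q → ∀ q I, A = {q} →
        I ⊆ {q} → ∑ q ∈ I, P.wt q ≤ ∑ q ∈ S, P.wt q := by
      rintro S hS q I rfl hI
      obtain rfl : p = q := by simpa using hp
      exact (Finset.sum_le_sum_of_subset_of_nonneg hI fun i _ _ => P.wt_nonneg i).trans hS
    by_cases hd : d = 0
    · rw [if_pos hd] at hm₁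
      refine Run.weaken (Run.main_ret (T := T) hctx₁ htop₁ hm₁ hcur₁ ?_) (by omega)
      intro σ' h1 h2 h3 h4
      refine hQ σ' {p} (by simpa using hp) conflictFree_singleton ?_ h1 (hag₁.down.trans h2) h3
        (by rw [h4, hval₁])
      subst hd
      intro I hI
      cases hI with
      | single _ _ q _ h => exact single _ le_rfl q I rfl h
    · rw [if_neg hd] at hm₁
      refine ih.loop hAB hB hw hμ hd P.M 0 σ₁ {p} (by omega) hctx₁ htop₁ hm₁ (by simpa using hp)
        conflictFree_singleton (by simp) hcur₁ ?_
      intro σ' S h1 h2 h3 h4 h5 h6 h7 h8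
      refine hQ σ' S h1 h2 ?_ h5 (hag₁.down.trans h6) h7 (by rw [h8, hval₁])
      intro I hI
      cases hI with
      | single _ _ q _ h => exact single _ h3 q I rfl h
      | step _ _ d' _ v a b hv ha hb' hsub hrec =>
        obtain ⟨i, hi, rfl, rfl, rfl⟩ := P.moves v hv a ha b hb'
        exact h4 i hi I ⟨hsub, hrec⟩

end PartialColoringAlgorithm

namespace PartialColoringAlgorithm

open Classical

/-! ### Tables, root of the recursion and output -/

/-- The table of the rows of the adjacency matrix, and the tables of the vertex and the color of each
pair. -/
def pairTables (k : ℕ) : Stmt :=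
  .seq (.set .colors (.num k))
  (forLoop .ix (.var .size)
    (.seq (.wr .row (.var .ix) (.var .rg))
    (.seq (.set .rg (.add (.var .rg) (.var .size)))
    (forLoop .iy (.var .colors)
      (.seq (.wr .vert (.var .pairs) (.var .ix))
      (.seq (.wr .col (.var .pairs) (.var .iy))
      (.set .pairs (.add (.var .pairs) (.num 1)))))))))

/-- The list of all moves. -/
def moveTables : Stmt :=
  forLoop .ix (.var .size) (forLoop .iy (.var .size) (forLoop .iz (.var .size)
    (.seq (.wr .mv (.var .moves) (.var .ix))
    (.seq (.wr .ma (.var .moves) (.var .iy))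
    (.seq (.wr .mb (.var .moves) (.var .iz))
    (.set .moves (.add (.var .moves) (.num 1))))))))

/-- The full budget: `5 * k` for each doubling step up to the number of vertices. -/
def fullBudget (k : ℕ) : Stmt :=
  .seq (.set .rt (.num 1))
  (forLoop .ix (.var .size) (.ifc (.lt (.var .size) (.var .rt)) .skip
    (.seq (.set .rt (.add (.var .rt) (.var .rt))) (.set .full (.add (.var .full) (.num (5 * k)))))))

/-- The frame of the call for the set of all pairs. This set need not be connected; the additional budget of
`k` pays for the first move, which splits it into components. -/
def rootFrame : Stmt :=
  .seq (.set .lv (.num 1))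
  (.seq (.set .fb (.var .pairs))
  (.seq (.set .vb (.add (.var .pairs) (.num 2)))
  (.seq (fillIf .set (here .ix) (.eq (.num 0) (.num 0)))
  (.seq (fillIf .base (here .ix) (.eq (.num 0) (.num 0)))
  (.wr .bud (.num 1) (.add (.var .full) (.var .colors)))))))

/-- The colors of the vertices in the solution that has been found. -/
def colorTable : Stmt :=
  forLoop .ix (.var .pairs) (.ifc (isOne .cur (.var .ix))
    (.wr .out (vtx .ix) (.add (clrOf .ix) (.num 1))) .skip)

/-- The algorithm, for at least two vertices and with the adjacency matrix in place. -/
def algorithm (k : ℕ) : Stmt :=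
  .seq (pairTables k) (.seq moveTables (.seq (fullBudget k) (.seq rootFrame (.seq mainLoop colorTable))))

theorem Run.pairTables {n k : ℕ} {σ : Store} {Q : Store → Prop} (hk : 0 < k) (hn : σ.s .size = n)
    (hg : σ.s .rg = 0) (hp : σ.s .pairs = 0)
    (hQ : ∀ τ, (∀ y, y ≠ .ix → y ≠ .iy → y ≠ .rg → y ≠ .pairs → y ≠ .colors → τ.s y = σ.s y) →
      (∀ j, j ≠ .row → j ≠ .vert → j ≠ .col → τ.w j = σ.w j) → τ.v = σ.v → τ.s .colors = k →
      τ.s .pairs = n * k → (∀ u < n, τ.w .row u = n * u) → (∀ p < n * k, τ.w .vert p = p / k) →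
      (∀ p < n * k, τ.w .col p = p % k) → Q τ) :
    Run (pairTables k) σ (1 + (n * ((1 + (1 + (k * ((1 + (1 + 1)) + 2) + 2))) + 2) + 2)) Q := by
  refine Run.seq (Run.set ?_)
  -- The invariant after `u` vertices and `c` colors of the next vertex.
  let Inv : ℕ → ℕ → ℕ → Store → Prop := fun u u' c τ =>
    (∀ y, y ≠ .ix → y ≠ .iy → y ≠ .rg → y ≠ .pairs → y ≠ .colors → τ.s y = σ.s y) ∧
    (∀ j, j ≠ .row → j ≠ .vert → j ≠ .col → τ.w j = σ.w j) ∧ τ.v = σ.v ∧ τ.s .colors = k ∧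
    τ.s .pairs = u * k + c ∧ τ.s .rg = n * u' ∧ (∀ x < u', τ.w .row x = n * x) ∧
    (∀ p < u * k + c, τ.w .vert p = p / k) ∧ (∀ p < u * k + c, τ.w .col p = p % k)
  refine Run.forLoop n (fun u τ => Inv u u 0 τ) ?_ ?_ ?_ ?_
  · refine ⟨fun y h1 h2 h3 h4 h5 => by simp [h1, h5], fun _ _ _ _ => rfl, rfl, by simp, by simp [hp],
      by simp [hg], by simp, by simp, by simp⟩
  · rintro u - τ - ⟨h, -⟩
    simp [h, hn]
  · rintro u hu τ hx ⟨h1, h2, h3, h4, h5, h6, h7, h8, h9⟩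
    refine Run.seq (Run.wr (Run.seq (Run.set ?_)))
    refine Run.forLoop k (fun c τ => τ.s .ix = u ∧ Inv u (u + 1) c τ) ?_ ?_ ?_ ?_
    · refine ⟨by simp [hx], fun y a1 a2 a3 a4 a5 => by simp [a2, a3, h1 y a1 a2 a3 a4 a5],
        fun j a1 a2 a3 => by simp [a1, h2 j a1 a2 a3], by simp [h3], by simp [h4], by simp [h5],
        by simp [h6, h1, hn]; ring, fun x hx' => ?_, by simpa using h8, by simpa using h9⟩
      by_cases hxu : x = u
      · subst hxu; simp [hx, h6]
      · simp [hx, hxu, h7 x (by omega)]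
    · rintro c - τ' - ⟨-, -, -, -, h, -⟩
      simp [h]
    · rintro c hc τ' hy ⟨hx, h1, h2, h3, h4, h5, h6, h7, h8, h9⟩
      refine Run.seq (Run.wr (Run.seq (Run.wr (Run.set ?_))))
      have hdiv : (u * k + c) / k = u := by
        rw [Nat.mul_comm, Nat.mul_add_div hk, Nat.div_eq_of_lt hc, Nat.add_zero]
      have hmod : (u * k + c) % k = c := by
        rw [Nat.mul_comm, Nat.mul_add_mod, Nat.mod_eq_of_lt hc]
      refine ⟨by simp [hy], by simp [hx], fun y a1 a2 a3 a4 a5 => by simp [a2, a4, h1 y a1 a2 a3 a4 a5],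
        fun j a1 a2 a3 => by simp [a2, a3, h2 j a1 a2 a3], by simp [h3], by simp [h4],
        by simp [h5]; omega, by simp [h6], by simpa using h7, fun p hp' => ?_, fun p hp' => ?_⟩
      · by_cases hpu : p = u * k + c
        · subst hpu; simp [hx, h5, hdiv]
        · simp [h5, hpu, h8 p (by omega)]
      · by_cases hpu : p = u * k + c
        · subst hpu; simp [hy, h5, hmod]
        · simp [h5, hpu, h9 p (by omega)]
    · rintro τ' - ⟨hx, h1, h2, h3, h4, h5, h6, h7, h8, h9⟩
      have e : (u + 1) * k + 0 = u * k + k := by ring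
      refine ⟨hx, fun y a1 a2 a3 a4 a5 => by simp [a1, h1 y a1 a2 a3 a4 a5], h2, h3, by simp [h4],
        by simp [h5, e], by simp [h6], h7, ?_, ?_⟩
      · rw [e]; exact h8
      · rw [e]; exact h9
  · rintro τ - ⟨h1, h2, h3, h4, h5, h6, h7, h8, h9⟩
    exact hQ τ h1 h2 h3 h4 h5 h7 h8 h9

theorem Run.moveTables {n : ℕ} {σ : Store} {Q : Store → Prop} (hn : σ.s .size = n)
    (hm : σ.s .moves = 0)
    (hQ : ∀ τ, (∀ y, y ≠ .ix → y ≠ .iy → y ≠ .iz → y ≠ .moves → τ.s y = σ.s y) →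
      (∀ j, j ≠ .mv → j ≠ .ma → j ≠ .mb → τ.w j = σ.w j) → τ.v = σ.v →
      τ.s .moves = n * n * n → (∀ j < n * n * n, τ.w .mv j = j / n / n) →
      (∀ j < n * n * n, τ.w .ma j = j / n % n) → (∀ j < n * n * n, τ.w .mb j = j % n) → Q τ) :
    Run moveTables σ (n * ((n * ((n * ((1 + (1 + (1 + 1))) + 2) + 2) + 2) + 2) + 2) + 2) Q := by
  let Inv : ℕ → Store → Prop := fun c τ =>
    (∀ y, y ≠ .ix → y ≠ .iy → y ≠ .iz → y ≠ .moves → τ.s y = σ.s y) ∧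
    (∀ j, j ≠ .mv → j ≠ .ma → j ≠ .mb → τ.w j = σ.w j) ∧ τ.v = σ.v ∧ τ.s .moves = c ∧
    (∀ j < c, τ.w .mv j = j / n / n) ∧ (∀ j < c, τ.w .ma j = j / n % n) ∧
    (∀ j < c, τ.w .mb j = j % n)
  have hset : ∀ {c τ x a}, x = .ix ∨ x = .iy ∨ x = .iz → Inv c τ → Inv c (τ.setS x a) := by
    rintro c τ x a hx ⟨h1, h2, h3, h4, h5, h6, h7⟩
    refine ⟨fun y a1 a2 a3 a4 => ?_, h2, h3, ?_, h5, h6, h7⟩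
    · have : y ≠ x := by rcases hx with rfl | rfl | rfl <;> assumption
      simp [this, h1 y a1 a2 a3 a4]
    · have : Var.moves ≠ x := by rcases hx with rfl | rfl | rfl <;> simp
      simp [this, h4]
  refine Run.forLoop n (fun a τ => Inv (a * n * n) τ) ?_ ?_ ?_ ?_
  · refine hset (by tauto) ⟨fun _ _ _ _ _ => rfl, fun _ _ _ _ => rfl, rfl, by simp [hm], by simp,
      by simp, by simp⟩
  · rintro a - τ - ⟨h, -⟩
    simp [h, hn]
  · rintro a ha τ hx hI
    refine Run.forLoop n (fun b τ => τ.s .ix = a ∧ Inv ((a * n + b) * n) τ) ?_ ?_ ?_ ?_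
    · exact ⟨by simp [hx], hset (by tauto) hI⟩
    · rintro b - τ - ⟨-, h, -⟩
      simp [h, hn]
    · rintro b hb τ hy ⟨hx, hI⟩
      refine Run.forLoop n (fun c τ => τ.s .ix = a ∧ τ.s .iy = b ∧ Inv ((a * n + b) * n + c) τ)
        ?_ ?_ ?_ ?_
      · exact ⟨by simp [hx], by simp [hy], hset (by tauto) hI⟩
      · rintro c - τ - ⟨-, -, h, -⟩
        simp [h, hn]
      · rintro c hc τ hz ⟨hx, hy, h1, h2, h3, h4, h5, h6, h7⟩
        have hn0 : 0 < n := by omega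
        set e := (a * n + b) * n + c with he
        have e1 : e % n = c := by rw [he, Nat.mul_comm, Nat.mul_add_mod, Nat.mod_eq_of_lt hc]
        have e2 : e / n = a * n + b := by
          rw [he, Nat.mul_comm, Nat.mul_add_div hn0, Nat.div_eq_of_lt hc, Nat.add_zero]
        have e3 : e / n % n = b := by rw [e2, Nat.mul_comm, Nat.mul_add_mod, Nat.mod_eq_of_lt hb]
        have e4 : e / n / n = a := by
          rw [e2, Nat.mul_comm, Nat.mul_add_div hn0, Nat.div_eq_of_lt hb, Nat.add_zero]
        refine Run.seq (Run.wr (Run.seq (Run.wr (Run.seq (Run.wr (Run.set ?_))))))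
        refine ⟨by simp [hz], by simp [hx], by simp [hy],
          fun y a1 a2 a3 a4 => by simp [a3, a4, h1 y a1 a2 a3 a4],
          fun j a1 a2 a3 => by simp [a1, a2, a3, h2 j a1 a2 a3], by simp [h3],
          by simp [h4, he]; omega, ?_, ?_, ?_⟩
        all_goals
          intro j hj
          by_cases hje : j = e
          · subst hje; simp [h4, hx, hy, hz, e1, e3, e4]
          · have : j < e := by omega
            simp [h4, hje, h5 j this, h6 j this, h7 j this]
      · rintro τ - ⟨hx, hy, hI⟩
        refine ⟨hy, by simp [hx], hset (by tauto) ?_⟩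
        have e : (a * n + (b + 1)) * n = (a * n + b) * n + n := by ring
        rw [e]; exact hI
    · rintro τ - ⟨hx, hI⟩
      refine ⟨hx, hset (by tauto) ?_⟩
      have e : (a + 1) * n * n = (a * n + n) * n := by ring
      rw [e]; exact hI
  · rintro τ - ⟨h1, h2, h3, h4, h5, h6, h7⟩
    exact hQ τ h1 h2 h3 h4 h5 h6 h7

theorem Run.fullBudget {n k : ℕ} {σ : Store} {Q : Store → Prop} (hn : σ.s .size = n)
    (hn0 : n ≠ 0) (hf : σ.s .full = 0)
    (hQ : ∀ s' : Var → ℕ, ∀ r, (∀ y, y ≠ .ix → y ≠ .rt → y ≠ .full → s' y = σ.s y) → n < 2 ^ r →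
      r ≤ Nat.log 2 n + 1 → s' .full = 5 * k * r → Q ⟨s', σ.w, σ.v⟩) :
    Run (fullBudget k) σ (1 + (n * (((1 + 1) + 1) + 2) + 2)) Q := by
  refine Run.seq (Run.set ?_)
  refine Run.forLoop n (fun i τ => (∀ y, y ≠ .ix → y ≠ .rt → y ≠ .full → τ.s y = σ.s y) ∧
    τ.w = σ.w ∧ τ.v = σ.v ∧ ∃ r, τ.s .rt = 2 ^ r ∧ τ.s .full = 5 * k * r ∧ (r = i ∨ n < 2 ^ r) ∧
      r ≤ Nat.log 2 n + 1) ?_ ?_ ?_ ?_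
  · exact ⟨fun y h1 h2 h3 => by simp [h1, h2], rfl, rfl, 0, by simp, by simp [hf], Or.inl rfl, by omega⟩
  · rintro i - τ - ⟨h, -⟩
    simp [h, hn]
  · rintro i hi τ hx ⟨h1, h2, h3, r, h4, h5, h6, h7⟩
    have hsz : τ.s .size = n := by simp [h1, hn]
    refine Run.ifc (T := 1 + 1) (fun h => Run.weaken (Run.skip ?_) (by omega))
      (fun h => Run.seq (Run.set (Run.set ?_)))
    · have h' : n < 2 ^ r := by simpa [hsz, h4] using h
      exact ⟨hx, fun y a1 a2 a3 => by simp [a1, h1 y a1 a2 a3], h2, h3, r, by simp [h4], by simp [h5],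
        Or.inr h', h7⟩
    · have h' : 2 ^ r ≤ n := by simpa [hsz, h4] using h
      refine ⟨by simp [hx], fun y a1 a2 a3 => by simp [a1, a2, a3, h1 y a1 a2 a3], h2, h3, r + 1,
        by simp [h4]; ring, by simp [h5]; ring, ?_, ?_⟩
      · left
        rcases h6 with h6 | h6 <;> omega
      · have := Nat.le_log_of_pow_le (by omega) h'
        omega
  · rintro ⟨s', w', v'⟩ - ⟨h1, h2, h3, r, h4, h5, h6, h7⟩
    simp only at h1 h2 h3 h4 h5
    subst h2 h3
    refine hQ s' r h1 ?_ h7 h5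
    rcases h6 with rfl | h6
    · exact Nat.lt_two_pow_self
    · exact h6

theorem Run.rootFrame {N D k : ℕ} {σ : Store} {Q : Store → Prop} (hN : σ.s .pairs = N)
    (hD : σ.s .full = D) (hk : σ.s .colors = k)
    (hQ : ∀ τ, (∀ y, y ≠ .ix → y ≠ .lv → y ≠ .fb → y ≠ .vb → τ.s y = σ.s y) →
      (∀ j, j ≠ .set → j ≠ .base → j ≠ .bud → τ.w j = σ.w j) → τ.v = σ.v →
      τ.s .lv = 1 → τ.s .fb = N → τ.s .vb = N + 2 →
      HasRow (τ.w .set) N N (Finset.range N) → HasRow (τ.w .base) N N (Finset.range N) →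
      τ.w .bud 1 = D + k → Q τ) :
    Run rootFrame σ (1 + (1 + (1 + ((N * 4 + 2) + ((N * 4 + 2) + 1))))) Q := by
  refine Run.seq (Run.set (Run.seq (Run.set (Run.seq (Run.set ?_)))))
  refine Run.seq (Run.fillIf (N := N) N (· ∈ Finset.range N) (by simp [hN]) ?_ ?_ ?_)
  · intro i hi s' w v hs' hx
    simp [here, hx, hs', hN]
  · intro i hi s' hs' hx
    simp [hi]
  intro s₁ hs₁
  refine Run.seq (Run.fillIf (N := N) N (· ∈ Finset.range N) (by simp [hs₁, hN]) ?_ ?_ ?_)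
  · intro i hi s' w v hs' hx
    simp [here, hx, hs', hs₁, hN]
  · intro i hi s' hs' hx
    simp [hi]
  intro s₂ hs₂
  refine Run.wr (hQ _ ?_ ?_ ?_ ?_ ?_ ?_ ?_ ?_ ?_)
  · intro y h1 h2 h3 h4
    simp [hs₂ y h1, hs₁ y h1, h2, h3, h4]
  · intro j h1 h2 h3
    simp [h1, h2, h3]
  · simp
  · simp [hs₂, hs₁]
  · simp [hs₂, hs₁, hN]
  · simp [hs₂, hs₁, hN]
  · simpa using HasRow.overwrite (by simp)
  · simpa using HasRow.overwrite (by simp)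
  · simp [hs₂, hs₁, hD, hk]

/-- The array `a` holds the color table of the solution `S`: `0` for an uncolored vertex, and the
color plus one for a colored vertex. -/
def ColorTable (k : ℕ) (S : Finset ℕ) (a : ℕ → ℕ) : Prop :=
  (∀ p ∈ S, a (p / k) = p % k + 1) ∧ ∀ u, (∀ p ∈ S, p / k ≠ u) → a u = 0

theorem Run.colorTable {P : Inst} {σ : Store} {S : Finset ℕ} {Q : Store → Prop} (hctx : Ctx P σ)
    (hS : S ⊆ Finset.range P.N) (hCF : ConflictFree P.H P.k S) (hcur : HasRow (σ.w .cur) 0 P.N S)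
    (hout : σ.w .out = fun _ => 0)
    (hQ : ∀ τ, τ.s .size = σ.s .size → ColorTable P.k S (τ.w .out) → Q τ) :
    Run colorTable σ (P.N * ((1 + 1) + 2) + 2) Q := by
  refine Run.forLoop P.N (fun i τ => (∀ y, y ≠ .ix → τ.s y = σ.s y) ∧ (∀ j, j ≠ .out → τ.w j = σ.w j) ∧
    ColorTable P.k (S.filter (· < i)) (τ.w .out)) ?_ ?_ ?_ ?_
  · exact ⟨fun y hy => by simp [hy], fun _ _ => rfl, by simp [ColorTable, hout]⟩
  · rintro i - τ - ⟨h, -⟩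
    simp [h, hctx.pairs]
  · rintro i hi τ hx ⟨h1, h2, h3⟩
    have hone := hcur.one_iff hi
    rw [Nat.zero_add] at hone
    refine Run.ifc (fun h => Run.wr ?_) (fun h => Run.skip ?_)
    · have hiS : i ∈ S := hone.mp (by simpa [isOne, hx, h2] using h)
      refine ⟨by simp [hx], fun y hy => by simp [hy, h1], fun j hj => by simp [hj, h2], ?_⟩
      have e : S.filter (· < i + 1) = insert i (S.filter (· < i)) := by
        ext p
        simp only [Finset.mem_filter, Finset.mem_insert]
        constructor
        · rintro ⟨h, h'⟩
          by_cases hp : p = i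
          · exact Or.inl hp
          · exact Or.inr ⟨h, by omega⟩
        · rintro (rfl | ⟨h, h'⟩)
          · exact ⟨hiS, by omega⟩
          · exact ⟨h, by omega⟩
      rw [e]
      have hw : ((τ.setW .out ((vtx .ix).eval τ) ((Ex.add (clrOf .ix) (.num 1)).eval τ)).setS .ix
          (i + 1)).w .out = Function.update (τ.w .out) (i / P.k) (i % P.k + 1) := by
        simp [vtx, clrOf, hx, h2, hctx.vert i hi, hctx.col i hi]
      rw [hw]
      refine ⟨fun p hp => ?_, fun u hu => ?_⟩
      · rcases Finset.mem_insert.mp hp with rfl | hp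
        · simp
        · have hp' := Finset.mem_filter.mp hp
          have hne : p / P.k ≠ i / P.k := fun h' =>
            hCF p hp'.1 i hiS (Or.inl ⟨h', hp'.2.ne⟩)
          rw [Function.update_of_ne hne, h3.1 p hp]
      · have hne : u ≠ i / P.k := fun h' => hu i (Finset.mem_insert_self _ _) h'.symm
        rw [Function.update_of_ne hne, h3.2 u fun p hp => hu p (Finset.mem_insert_of_mem hp)]
    · have hiS : i ∉ S := fun hiS => h (by simpa [isOne, hx, h2] using hone.mpr hiS)
      refine ⟨hx, fun y hy => by simp [hy, h1], h2, ?_⟩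
      have e : S.filter (· < i + 1) = S.filter (· < i) := by
        ext p
        simp only [Finset.mem_filter]
        refine ⟨fun ⟨h, h'⟩ => ⟨h, ?_⟩, fun ⟨h, h'⟩ => ⟨h, by omega⟩⟩
        have : p ≠ i := fun h' => hiS (h' ▸ h)
        omega
      rw [e]; exact h3
  · rintro τ - ⟨h1, h2, h3⟩
    refine hQ τ (h1 _ (by simp)) ?_
    rwa [Finset.filter_true_of_mem fun p hp => Finset.mem_range.mp (hS hp)] at h3

/-- The data of the recursion for the given graph on the vertices `0, …, n - 1` and the given
revenues, with the budget for `r` halvings. -/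
def instOf (n k r : ℕ) (H : SimpleGraph ℕ) (wt : ℕ → ℚ) (hk : 0 < k) (hwt : ∀ p, 0 ≤ wt p) : Inst where
  n := n
  k := k
  M := n * n * n
  D := 5 * k * r
  H := H
  mv j := j / n / n
  ma j := j / n % n
  mb j := j % n
  wt := wt
  k_pos := hk
  mod_D := by rw [Nat.mul_comm 5, Nat.mul_assoc]; exact Nat.mul_mod_right _ _
  mv_lt j hj := Nat.div_lt_of_lt_mul (Nat.div_lt_of_lt_mul (by rwa [← Nat.mul_assoc]))
  ma_lt j hj := Nat.mod_lt _ (Nat.pos_of_ne_zero fun h => by simp [h] at hj)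
  mb_lt j hj := Nat.mod_lt _ (Nat.pos_of_ne_zero fun h => by simp [h] at hj)
  moves v hv a ha b hb := by
    have hn : 0 < n := by omega
    have e2 : ((v * n + a) * n + b) / n = v * n + a := by
      rw [Nat.mul_comm, Nat.mul_add_div hn, Nat.div_eq_of_lt hb, Nat.add_zero]
    refine ⟨(v * n + a) * n + b, ?_, ?_, ?_, ?_⟩
    · calc (v * n + a) * n + b < (v * n + a) * n + n := by omega
        _ = (v * n + a + 1) * n := by ring
        _ ≤ (v * n + n) * n := Nat.mul_le_mul_right _ (by omega)
        _ = (v + 1) * n * n := by ring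
        _ ≤ n * n * n := Nat.mul_le_mul_right _ (Nat.mul_le_mul_right _ (by omega))
    · rw [e2, Nat.mul_comm, Nat.mul_add_div hn, Nat.div_eq_of_lt ha, Nat.add_zero]
    · rw [e2, Nat.mul_comm, Nat.mul_add_mod, Nat.mod_eq_of_lt ha]
    · rw [Nat.mul_comm, Nat.mul_add_mod, Nat.mod_eq_of_lt hb]
  wt_nonneg := hwt

/-- The store before the algorithm starts: number of vertices, adjacency matrix and revenues. -/
structure Initial (n : ℕ) (H : SimpleGraph ℕ) (σ : Store) : Prop where
  size : σ.s .size = n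
  vars : ∀ y, y ≠ .size → y ≠ .ix → σ.s y = 0
  adj : ∀ u < n, ∀ v < n, σ.w .adj (n * u + v) = 1 ↔ H.Adj u v
  arrays : ∀ j, j ≠ .adj → σ.w j = fun _ => 0
  wt_nonneg : ∀ p, 0 ≤ σ.v p

/-- A bound for the number of ticks of the algorithm on `n` vertices of clique number at most `w`: one term
for tables and output, and one for the recursion, with full budget `5 * k * (log₂ n + 1)`. -/
def ticks (n k w : ℕ) : ℕ :=
  (20 * (n * k + n + 2) ^ 3) +
    n * k * (50 * (n * k + 1) ^ 3 *
      (10 * (n * n * n)) ^ (w * (5 * k * (Nat.log 2 n + 1) + 1) + (5 * k * (Nat.log 2 n + 1) + k) + 1))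

theorem Run.algorithm {n k w : ℕ} {H : SimpleGraph ℕ} {σ : Store} (hb : BullFree H) (he : EFree H)
    (hn : 2 ≤ n) (hk : 0 < k) (hw : CliqueLE H (Finset.range n) w) (hσ : Initial n H σ) :
    Run (algorithm k) σ (ticks n k w) fun τ => τ.s .size = n ∧ ∃ S ⊆ Finset.range (n * k),
      ConflictFree H k S ∧ (∀ I ⊆ Finset.range (n * k), ConflictFree H k I →
        ∑ p ∈ I, σ.v p ≤ ∑ p ∈ S, σ.v p) ∧ ColorTable k S (τ.w .out) := by
  have hn0 : n ≠ 0 := by omega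
  set U := 50 * (n * k + 1) ^ 3 *
      (10 * (n * n * n)) ^ (w * (5 * k * (Nat.log 2 n + 1) + 1) + (5 * k * (Nat.log 2 n + 1) + k) + 1)
    with hU
  have hticks : (1 + (n * ((1 + (1 + (k * ((1 + (1 + 1)) + 2) + 2))) + 2) + 2)) +
      ((n * ((n * ((n * ((1 + (1 + (1 + 1))) + 2) + 2) + 2) + 2) + 2) + 2) +
      ((1 + (n * (((1 + 1) + 1) + 2) + 2)) +
      ((1 + (1 + (1 + ((n * k * 4 + 2) + ((n * k * 4 + 2) + 1))))) +
      ((n * k * U + 1) + (n * k * ((1 + 1) + 2) + 2))))) ≤ ticks n k w := by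
    have e : ticks n k w = 20 * (n * k + n + 2) ^ 3 + n * k * U := rfl
    rw [e]
    have h1 : (1 + (n * ((1 + (1 + (k * ((1 + (1 + 1)) + 2) + 2))) + 2) + 2)) = 5 * (n * k) + 6 * n + 3 := by
      ring
    have h2 : (n * ((n * ((n * ((1 + (1 + (1 + 1))) + 2) + 2) + 2) + 2) + 2) + 2) =
      6 * n ^ 3 + 4 * n ^ 2 + 4 * n + 2 := by ring
    rw [h1, h2]
    have h3 : 20 * (n * k + n + 2) ^ 3 = 20 * (n * k) ^ 3 + 20 * n ^ 3 + 160 + 60 * ((n * k) ^ 2 * n)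
      + 120 * (n * k) ^ 2 + 60 * (n * k * n ^ 2) + 120 * n ^ 2 + 240 * (n * k) + 240 * n
      + 240 * (n * k * n) := by ring
    rw [h3]
    omega
  refine Run.weaken ?_ hticks
  refine Run.seq (Run.pairTables hk hσ.size (hσ.vars _ (by simp) (by simp)) (hσ.vars _ (by simp) (by simp))
    ?_)
  intro σ₁ s₁ w₁ v₁ hcol hpairs hrow hvert hcolor
  refine Run.seq (Run.moveTables (n := n) (by simp [s₁, hσ.size]) (by simp [s₁, hσ.vars]) ?_)
  intro σ₂ s₂ w₂ v₂ hmoves hmv hma hmb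
  refine Run.seq (Run.fullBudget (n := n) (by simp [s₂, s₁, hσ.size]) hn0 (by simp [s₂, s₁, hσ.vars]) ?_)
  intro s₃' r s₃ hr hr' hfull
  refine Run.seq (Run.rootFrame (N := n * k) (D := 5 * k * r) (k := k) (by simp [s₃, s₂, hpairs])
    (by simp [hfull]) (by simp [s₃, s₂, hcol]) ?_)
  intro σ₄ s₄ w₄ v₄ hlv hfb hvb hset hbase hbud
  set P := instOf n k r H σ.v hk hσ.wt_nonneg with hP
  have hPN : P.N = n * k := rfl
  have hv : σ₄.v = σ.v := v₄.trans (v₂.trans v₁)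
  have hw₁ : ∀ j, j ≠ .row → j ≠ .vert → j ≠ .col → j ≠ .mv → j ≠ .ma → j ≠ .mb → j ≠ .set →
      j ≠ .base → j ≠ .bud → σ₄.w j = σ.w j := fun j a1 a2 a3 a4 a5 a6 a7 a8 a9 => by
    rw [w₄ j a7 a8 a9, ← w₁ j a1 a2 a3, ← w₂ j a4 a5 a6]
  have hctx : Ctx P σ₄ := by
    refine ⟨?_, ?_, ?_, ?_, ?_, ?_, ?_, ?_, ?_, ?_, ?_, ?_⟩
    · simp [s₄, s₃, s₂, hcol]; rfl
    · simp [s₄, s₃, s₂, hpairs]; rfl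
    · simp [s₄, s₃, hmoves]; rfl
    · simp [s₄, hfull]; rfl
    · intro p hp; simp [w₄, w₂]; exact hvert p hp
    · intro p hp; simp [w₄, w₂]; exact hcolor p hp
    · intro u hu; simp [w₄, w₂]; exact hrow u hu
    · intro u hu v hv'
      rw [hw₁ _ (by simp) (by simp) (by simp) (by simp) (by simp) (by simp) (by simp) (by simp) (by simp)]
      exact hσ.adj u hu v hv'
    · intro j hj; simp [w₄]; exact hmv j hj
    · intro j hj; simp [w₄]; exact hma j hj
    · intro j hj; simp [w₄]; exact hmb j hj
    · intro p hp; rw [hv]; rfl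
  have hzero : ∀ j, j ≠ .adj → j ≠ .row → j ≠ .vert → j ≠ .col → j ≠ .mv → j ≠ .ma → j ≠ .mb →
      j ≠ .set → j ≠ .base → j ≠ .bud → σ₄.w j = fun _ => 0 :=
    fun j a0 a1 a2 a3 a4 a5 a6 a7 a8 a9 => by rw [hw₁ j a1 a2 a3 a4 a5 a6 a7 a8 a9, hσ.arrays j a0]
  have htop : Top P σ₄ (0 + 1) := ⟨hlv, by rw [hfb, hPN]; ring, by rw [hvb, hPN]⟩
  have hmod : (5 * k * r + k) % k = 0 := by
    rw [show 5 * k * r + k = k * (5 * r + 1) by ring]; exact Nat.mul_mod_right _ _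
  have hcall : Call P σ₄ (0 + 1) (Finset.range P.N) (Finset.range P.N) (5 * k * r + k) := by
    refine ⟨?_, ?_, hbud, ?_⟩
    · rw [hPN, Nat.zero_add, Nat.one_mul]; exact hbase
    · rw [hPN, Nat.zero_add, Nat.one_mul]; exact hset
    · rw [hzero .clr (by simp) (by simp) (by simp) (by simp) (by simp) (by simp) (by simp) (by simp)
        (by simp) (by simp)]
      exact hmod.symm
  have hverts : ∀ p ∈ Finset.range P.N, p / k < n := fun p hp =>
    P.div_lt (Finset.mem_range.mp hp)
  have hw' : CliqueLE H (verts k (Finset.range P.N)) w := hw.mono fun x hx => by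
    obtain ⟨p, hp, rfl⟩ := mem_verts.mp hx
    exact Finset.mem_range.mpr (hverts p hp)
  have hNpos : 0 < P.N := Nat.mul_pos (show 0 < n by omega) hk
  have hcard : (Finset.range P.N).card * (P.cost * (10 * P.M) ^
      (w * (P.D + 1) + (5 * k * r + k) + 1)) ≤ n * k * U := by
    rw [Finset.card_range]
    refine Nat.mul_le_mul_left _ (Nat.mul_le_mul_left _ (Nat.pow_le_pow_right ?_ ?_))
    · have := P.M_pos hNpos
      change 0 < 10 * P.M
      omega
    · have h1 : 5 * k * r ≤ 5 * k * (Nat.log 2 n + 1) := Nat.mul_le_mul_left _ hr'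
      have h2 : w * (P.D + 1) ≤ w * (5 * k * (Nat.log 2 n + 1) + 1) :=
        Nat.mul_le_mul_left _ (Nat.add_le_add_right h1 1)
      omega
  refine Run.seq (Run.weaken (solves P _ 0 σ₄ (Finset.range P.N) (Finset.range P.N) (5 * k * r + k) w ∅ 1 _
    hctx htop hcall ?_ subset_rfl subset_rfl ⟨0, Finset.mem_range.mpr hNpos⟩ hw' le_rfl ?_ ?_)
    (Nat.add_le_add_right hcard 1))
  · rw [hzero .phase (by simp) (by simp) (by simp) (by simp) (by simp) (by simp) (by simp) (by simp)
        (by simp) (by simp)]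
  · intro p hp
    rw [hzero .cur (by simp) (by simp) (by simp) (by simp) (by simp) (by simp) (by simp) (by simp)
        (by simp) (by simp)]
    simp
  · intro σ₅ S hS hCF hopt htop₅ hag hcur₅ _
    refine Run.loop_false (by simp [htop₅.lv]) ?_
    refine Run.colorTable (hctx.congr hag) hS hCF (by simpa using hcur₅) ?_ ?_
    · rw [hag.tables _ (by tauto), hzero .out (by simp) (by simp) (by simp) (by simp) (by simp) (by simp)
        (by simp) (by simp) (by simp) (by simp)]
    · intro τ hsz htab
      refine ⟨?_, S, hS, hCF, fun I hI hICF => ?_, htab⟩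
      · rw [hsz, hag.vars _ (by tauto)]
        simp [s₄, s₃, s₂, s₁, hσ.size]
      · exact hopt I (reach_root hb he hn hk hr hverts hICF hI hw')

end PartialColoringAlgorithm

namespace PartialColoringAlgorithm

open Classical RAM

/-! ### The program for the random access machine -/

theorem Rep.low {Z a x : ℕ} {m : Memory} {σ : Store} (h : Rep Z m σ) (ha : 0 < a) (haZ : a < Z) :
    Rep Z (m.setWord a x) σ := by
  refine ⟨?_, h.pos, fun y => ?_, fun j i => ?_, h.val⟩
  · simp only [Memory.setWord]
    rw [Function.update_of_ne (by omega), h.base]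
  · simp only [Memory.setWord]
    rw [Function.update_of_ne (by omega), h.var]
  · simp only [Memory.setWord]
    rw [Function.update_of_ne (by omega), h.arr]

/-- The address `n + 2`, which holds a diagonal entry of the adjacency matrix. -/
def counter : WordExpr := .add (.load (.num 0)) (.num 2)

/-- Computing `n * n` in word cell `1`, with a counter in word cell `n + 2`. Both cells hold diagonal
entries of the adjacency matrix. -/
def squareLoop : Program :=
  .loop (.wordLt (.load counter) (.load (.num 0)))
    (.seq (.setWord (.num 1) (.add (.load (.num 1)) (.load (.num 0))))
      (.setWord counter (.add (.load counter) (.num 1))))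

/-- Putting the base address `n * n + 1` of the working memory into word cell `0`, and the number of
vertices into the working memory. -/
def layout : Program :=
  .seq squareLoop
  (.seq (.setWord (.add (.load (.num 1)) (.num 1)) (.load (.num 0)))
  (.seq (.setWord counter (.num 0))
  (.seq (.setWord (.num 0) (.add (.load (.num 1)) (.num 1)))
  (.setWord (.num 1) (.num 0)))))

theorem squareLoop_runs {n : ℕ} (r : ℕ) : ∀ (i : ℕ) (m : Memory), i + r = n → m.word 0 = n →
    m.word 1 = n * i → m.word (n + 2) = i → ∃ m', squareLoop.Runs m (27 * r + 8) m' ∧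
      m'.word 1 = n * n ∧ (∀ a, a ≠ 1 → a ≠ n + 2 → m'.word a = m.word a) ∧
      m'.val = m.val := by
  induction r with
  | zero =>
    intro i m hi h0 h1 h2
    obtain rfl : i = n := by omega
    refine ⟨m, ?_, h1, fun _ _ _ => rfl, rfl⟩
    refine Program.Runs.loopFalse ?_
    simp [counter, Test.Holds, WordExpr.eval, h0, h2]
  | succ r ih =>
    intro i m hi h0 h1 h2
    obtain ⟨m', hr, g1, g2, g3⟩ := ih (i + 1)
      ((m.setWord 1 (m.word 1 + n)).setWord (n + 2) (i + 1)) (by omega)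
      (by simp [Memory.setWord, h0]) (by
        simp only [Memory.setWord]
        rw [Function.update_of_ne (by omega), Function.update_self, h1]; ring)
      (by simp [Memory.setWord])
    refine ⟨m', ?_, g1, fun a ha ha' => ?_, by rw [g3]; rfl⟩
    · have hb : (Program.seq (.setWord (.num 1) (.add (.load (.num 1)) (.load (.num 0))))
          (.setWord counter (.add (.load counter) (.num 1)))).Runs m 19
          ((m.setWord 1 (m.word 1 + n)).setWord (n + 2) (i + 1)) := by
        have r1 := Program.Runs.setWord m (.num 1) (.add (.load (.num 1)) (.load (.num 0)))
        have r2 := Program.Runs.setWord (m.setWord 1 (m.word 1 + n)) counter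
          (.add (.load counter) (.num 1))
        have e1 : (WordExpr.num 1).eval m = 1 := rfl
        have e2 : (WordExpr.add (.load (.num 1)) (.load (.num 0))).eval m = m.word 1 + n := by
          simp [WordExpr.eval, h0]
        have e3 : counter.eval (m.setWord 1 (m.word 1 + n)) = n + 2 := by
          simp [counter, WordExpr.eval, Memory.setWord, h0]
        have e4 : (WordExpr.add (.load counter) (.num 1)).eval (m.setWord 1 (m.word 1 + n)) = i + 1 := by
          simp only [WordExpr.eval, e3]
          simp [Memory.setWord, h2]
        rw [e1, e2] at r1
        rw [e3, e4] at r2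
        exact r1.seq r2
      have e : 27 * (r + 1) + 8 = 8 + 19 + (27 * r + 8) := by ring
      rw [e]
      refine Program.Runs.loopTrue ?_ hb hr
      simp only [Test.Holds, counter, WordExpr.eval, h0, h2]; omega
    · rw [g2 a ha ha']
      simp [Memory.setWord, ha, ha']

theorem layout_runs {n : ℕ} {m : Memory} (hn : 2 ≤ n) (h0 : m.word 0 = n) (h1 : m.word 1 = 0)
    (h2 : m.word (n + 2) = 0) : ∃ m', layout.Runs m (27 * n + 30) m' ∧ m'.word 0 = n * n + 1 ∧
      m'.word (n * n + 1) = n ∧ (∀ a, a ≠ 0 → a ≠ n * n + 1 → m'.word a = m.word a) ∧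
      m'.val = m.val := by
  obtain ⟨m₁, hr, g1, g2, g3⟩ := squareLoop_runs (n := n) n 0 m (by omega) h0 (by simp [h1]) h2
  have g0 : m₁.word 0 = n := by rw [g2 0 (by omega) (by omega), h0]
  have hlt : n + 2 < n * n + 1 := by nlinarith
  have hpos : 0 < n * n := by positivity
  have r1 := Program.Runs.setWord m₁ (.add (.load (.num 1)) (.num 1)) (.load (.num 0))
  have e1 : (WordExpr.add (.load (.num 1)) (.num 1)).eval m₁ = n * n + 1 := by
    simp [WordExpr.eval, g1]
  have e2 : (WordExpr.load (.num 0)).eval m₁ = n := by simp [WordExpr.eval, g0]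
  rw [e1, e2] at r1
  set m₂ := m₁.setWord (n * n + 1) n with hm₂
  have a0 : m₂.word 0 = n := by
    simp only [hm₂, Memory.setWord]; rw [Function.update_of_ne (by omega), g0]
  have a1 : m₂.word 1 = n * n := by
    simp only [hm₂, Memory.setWord]; rw [Function.update_of_ne (by omega), g1]
  have r2 := Program.Runs.setWord m₂ counter (.num 0)
  have e3 : counter.eval m₂ = n + 2 := by simp [counter, WordExpr.eval, a0]
  have e4 : (WordExpr.num 0).eval m₂ = 0 := rfl
  rw [e3, e4] at r2
  set m₃ := m₂.setWord (n + 2) 0 with hm₃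
  have b1 : m₃.word 1 = n * n := by
    simp only [hm₃, Memory.setWord]; rw [Function.update_of_ne (by omega), a1]
  have r3 := Program.Runs.setWord m₃ (.num 0) (.add (.load (.num 1)) (.num 1))
  have e5 : (WordExpr.num 0).eval m₃ = 0 := rfl
  have e6 : (WordExpr.add (.load (.num 1)) (.num 1)).eval m₃ = n * n + 1 := by
    simp [WordExpr.eval, b1]
  rw [e5, e6] at r3
  have r4 := Program.Runs.setWord (m₃.setWord 0 (n * n + 1)) (.num 1) (.num 0)
  have e7 : (WordExpr.num 1).eval (m₃.setWord 0 (n * n + 1)) = 1 := rfl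
  have e8 : (WordExpr.num 0).eval (m₃.setWord 0 (n * n + 1)) = 0 := rfl
  rw [e7, e8] at r4
  refine ⟨(m₃.setWord 0 (n * n + 1)).setWord 1 0, ?_, ?_, ?_, ?_, ?_⟩
  · have e : 27 * n + 30 = (27 * n + 8) + (7 + (6 + (6 + 3))) := by ring
    rw [e]
    exact hr.seq (r1.seq (r2.seq (r3.seq r4)))
  · simp [Memory.setWord]
  · simp only [hm₃, hm₂, Memory.setWord]
    rw [Function.update_of_ne (by omega), Function.update_of_ne (by omega),
      Function.update_of_ne (by omega), Function.update_self]
  · intro a ha ha'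
    by_cases h1a : a = 1
    · subst h1a; simp [Memory.setWord, h1]
    · by_cases h2a : a = n + 2
      · subst h2a
        simp [hm₃, hm₂, Memory.setWord, h2]
      · simp [hm₃, hm₂, Memory.setWord, ha, ha', h1a, h2a, g2]
  · exact g3

/-- The value of a variable. -/
def Var.val (x : Var) : WordExpr := .load x.addr

theorem Rep.eval_val {Z : ℕ} {m : Memory} {σ : Store} (h : Rep Z m σ) (x : Var) :
    x.val.eval m = σ.s x := by
  simp only [Var.val, WordExpr.eval, h.eval_var_addr, h.var]

/-- Copying the adjacency matrix from the input into the array `adj`. -/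
def copyAdj : Program :=
  .loop (.wordLt (.add (Var.val .ix) (.num 1)) basePtr)
    (.seq (.setWord (Arr.addr .adj (Var.val .ix)) (.load (.add (Var.val .ix) (.num 1))))
      (.setWord (Var.addr .ix) (.add (Var.val .ix) (.num 1))))

theorem copyAdj_runs {Z : ℕ} (r : ℕ) : ∀ (i : ℕ) (m : Memory) (σ : Store), i + r + 1 = Z →
    Rep Z m σ → σ.s .ix = i → ∃ m' τ, copyAdj.Runs m (227 * r + 10) m' ∧ Rep Z m' τ ∧
      (∀ y, y ≠ .ix → τ.s y = σ.s y) ∧ (∀ j, j ≠ .adj → τ.w j = σ.w j) ∧ τ.v = σ.v ∧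
      (∀ a < i, τ.w .adj a = σ.w .adj a) ∧
      (∀ a, i ≤ a → a + 1 < Z → τ.w .adj a = m.word (a + 1)) := by
  induction r with
  | zero =>
    intro i m σ hi hr hx
    refine ⟨m, σ, Program.Runs.loopFalse ?_, hr, fun _ _ => rfl, fun _ _ => rfl, rfl, fun _ _ => rfl,
      fun a ha ha' => by omega⟩
    simp only [Test.Holds, basePtr, WordExpr.eval, hr.eval_val, hx, hr.base]; omega
  | succ r ih =>
    intro i m σ hi hr hx
    have r1 := Program.Runs.setWord m (Arr.addr .adj (Var.val .ix)) (.load (.add (Var.val .ix) (.num 1)))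
    have e2 : (WordExpr.load (.add (Var.val .ix) (.num 1))).eval m = m.word (i + 1) := by
      simp only [WordExpr.eval, hr.eval_val, hx]
    rw [hr.eval_arr_addr, hr.eval_val, hx, e2] at r1
    have hr1 := hr.setW .adj i (m.word (i + 1))
    set m₁ := m.setWord (Z + (32 * i + Arr.code .adj)) (m.word (i + 1)) with hm₁
    have r2 := Program.Runs.setWord m₁ (Var.addr .ix) (.add (Var.val .ix) (.num 1))
    have e3 : (WordExpr.add (Var.val .ix) (.num 1)).eval m₁ = i + 1 := by
      simp only [WordExpr.eval, hr1.eval_val]; simp [hx]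
    rw [hr1.eval_var_addr, e3] at r2
    have hr2 := hr1.setS .ix (i + 1)
    obtain ⟨m', τ, g1, g2, g3, g4, g5, g6, g7⟩ := ih (i + 1) _ _ (by omega) hr2 (by simp)
    refine ⟨m', τ, ?_, g2, fun y hy => ?_, fun j hj => ?_, g5, fun a ha => ?_, fun a ha ha' => ?_⟩
    · have e : 227 * (r + 1) + 10 = 10 + 217 + (227 * r + 10) := by ring
      rw [e]
      refine Program.Runs.loopTrue ?_ (r1.seq r2) g1
      simp only [Test.Holds, basePtr, WordExpr.eval, hr.eval_val, hx, hr.base]; omega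
    · rw [g3 y hy]; simp [hy]
    · rw [g4 j hj]; simp [hj]
    · rw [g6 a (by omega)]
      simp only [Store.setS_w, Store.setW_w, Function.update_self]
      rw [Function.update_of_ne (by omega)]
    · by_cases hai : a = i
      · subst hai
        rw [g6 a (by omega)]
        simp
      · rw [g7 a (by omega) ha']
        simp only [hm₁, Memory.setWord]
        have := Arr.code_pos .adj
        rw [Function.update_of_ne (by omega), Function.update_of_ne (by omega)]

/-- Copying the color table except for vertex `0` to the output cells, from the end. -/
def writeLoop : Program :=
  .loop (.wordLt (.num 1) (Var.val .ix))
    (.seq (.setWord (Var.addr .ix) (.sub (Var.val .ix) (.num 1)))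
      (.setWord (Var.val .ix) (.load (Arr.addr .out (Var.val .ix)))))

/-- Copying the color table to the output cells. Word cell `0` holds the base address and comes last. -/
def writeOut : Program :=
  .seq (.setWord (Var.addr .ix) (Var.val .size))
  (.seq writeLoop (.setWord (.num 0) (.load (Arr.addr .out (.num 0)))))

theorem writeLoop_runs {Z : ℕ} (r : ℕ) : ∀ (m : Memory) (σ : Store), r + 1 < Z → Rep Z m σ →
    σ.s .ix = r + 1 → ∃ m' τ, writeLoop.Runs m (222 * r + 7) m' ∧ Rep Z m' τ ∧ τ.w = σ.w ∧
      (∀ a, 0 < a → a ≤ r → m'.word a = σ.w .out a) ∧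
      (∀ a, r < a → a < Z → m'.word a = m.word a) := by
  induction r with
  | zero =>
    intro m σ hZ hr hx
    refine ⟨m, σ, Program.Runs.loopFalse ?_, hr, rfl, fun a ha ha' => by omega, fun _ _ _ => rfl⟩
    simp only [Test.Holds, WordExpr.eval, hr.eval_val, hx]; omega
  | succ r ih =>
    intro m σ hZ hr hx
    have r1 := Program.Runs.setWord m (Var.addr .ix) (.sub (Var.val .ix) (.num 1))
    have e1 : (WordExpr.sub (Var.val .ix) (.num 1)).eval m = r + 1 := by
      simp only [WordExpr.eval, hr.eval_val, hx]; omega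
    rw [hr.eval_var_addr, e1] at r1
    have hr1 := hr.setS .ix (r + 1)
    set m₁ := m.setWord (Z + 32 * Var.code .ix) (r + 1) with hm₁
    have r2 := Program.Runs.setWord m₁ (Var.val .ix) (.load (Arr.addr .out (Var.val .ix)))
    have e2 : (Var.val .ix).eval m₁ = r + 1 := by rw [hr1.eval_val]; simp
    have e3 : (WordExpr.load (Arr.addr .out (Var.val .ix))).eval m₁ = σ.w .out (r + 1) := by
      simp only [WordExpr.eval, hr1.eval_arr_addr, e2, hr1.arr]; simp
    rw [e2, e3] at r2
    have hr2 : Rep Z (m₁.setWord (r + 1) (σ.w .out (r + 1))) (σ.setS .ix (r + 1)) :=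
      hr1.low (by omega) (by omega)
    obtain ⟨m', τ, g1, g2, g3, g4, g5⟩ := ih _ _ (by omega) hr2 (by simp)
    refine ⟨m', τ, ?_, g2, g3, fun a ha ha' => ?_, fun a ha ha' => ?_⟩
    · have e : 222 * (r + 1) + 7 = 7 + 215 + (222 * r + 7) := by ring
      rw [e]
      refine Program.Runs.loopTrue ?_ (r1.seq r2) g1
      simp only [Test.Holds, WordExpr.eval, hr.eval_val, hx]; omega
    · by_cases har : a = r + 1
      · subst har
        rw [g5 _ (by omega) (by omega)]
        simp [Memory.setWord]
      · exact g4 a ha (by omega)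
    · rw [g5 a (by omega) ha']
      simp only [hm₁, Memory.setWord]
      rw [Function.update_of_ne (by omega), Function.update_of_ne (by omega)]

theorem writeOut_runs {Z n : ℕ} {m : Memory} {σ : Store} (hn : 0 < n) (hnZ : n < Z) (hr : Rep Z m σ)
    (hsz : σ.s .size = n) : ∃ m' t, t ≤ 222 * n + 90 ∧ writeOut.Runs m t m' ∧
      ∀ a < n, m'.word a = σ.w .out a := by
  have r1 := Program.Runs.setWord m (Var.addr .ix) (Var.val .size)
  rw [hr.eval_var_addr, hr.eval_val, hsz] at r1
  have hr1 := hr.setS .ix n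
  obtain ⟨m₁, τ, g1, g2, g3, g4, -⟩ := writeLoop_runs (n - 1) _ _ (by omega) hr1
    (by simp; omega)
  have r2 := Program.Runs.setWord m₁ (.num 0) (.load (Arr.addr .out (.num 0)))
  have e1 : (WordExpr.load (Arr.addr .out (.num 0))).eval m₁ = σ.w .out 0 := by
    simp only [WordExpr.eval, g2.eval_arr_addr, g2.arr, g3]; rfl
  rw [e1] at r2
  refine ⟨_, _, ?_, r1.seq (g1.seq r2), fun a ha => ?_⟩
  · have e : (10 : ℕ) + ((222 * (n - 1) + 7) + 71) ≤ 222 * n + 90 := by omega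
    exact e
  · by_cases h0 : a = 0
    · subst h0; simp [Memory.setWord, WordExpr.eval]
    · have := g4 a (by omega) (by omega)
      simpa [Memory.setWord, WordExpr.eval, h0] using this

/-- The algorithm for at most one vertex: word cell `0` becomes the first color of largest revenue,
plus one. -/
def bestColor : ℕ → Program
  | 0 => .setWord (.num 0) (.num 1)
  | c + 1 => .seq (bestColor c)
      (.ite (.valLt (.load (.sub (.load (.num 0)) (.num 1))) (.load (.num (c + 1))))
        (.setWord (.num 0) (.num (c + 2))) .skip)

theorem bestColor_runs (m : Memory) (c : ℕ) : ∃ t m', t ≤ 20 * (c + 1) ∧ (bestColor c).Runs m t m' ∧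
    m'.val = m.val ∧ ∃ b ≤ c, m'.word 0 = b + 1 ∧ ∀ i ≤ c, m.val i ≤ m.val b := by
  induction c with
  | zero =>
    refine ⟨_, _, ?_, .setWord _ _ _, rfl, 0, le_rfl, by simp [Memory.setWord, WordExpr.eval], fun i hi => ?_⟩
    · simp [WordExpr.cost]
    · obtain rfl : i = 0 := by omega
      exact le_rfl
  | succ c ih =>
    obtain ⟨t, m₁, ht, hr, hv, b, hb, hw, hmax⟩ := ih
    by_cases h : m.val b < m.val (c + 1)
    · refine ⟨_, _, ?_, hr.seq (.iteTrue ?_ (.setWord _ _ _)), hv, c + 1, le_rfl,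
        by simp [Memory.setWord, WordExpr.eval], fun i hi => ?_⟩
      · simp only [Test.cost, ValExpr.cost, WordExpr.cost]; omega
      · simpa [Test.Holds, ValExpr.eval, WordExpr.eval, hw, hv] using h
      · rcases Nat.le_succ_iff.mp hi with hi | rfl
        · exact (hmax i hi).trans h.le
        · exact le_rfl
    · refine ⟨_, _, ?_, hr.seq (.iteFalse ?_ (.skip _)), hv, b, by omega, hw, fun i hi => ?_⟩
      · simp only [Test.cost, ValExpr.cost, WordExpr.cost]; omega
      · simpa [Test.Holds, ValExpr.eval, WordExpr.eval, hw, hv] using h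
      · rcases Nat.le_succ_iff.mp hi with hi | rfl
        · exact hmax i hi
        · exact not_lt.mp h

/-- The program for `k` colors. -/
def program (k : ℕ) : Program :=
  .ite (.wordLt (.load (.num 0)) (.num 2)) (bestColor (k - 1))
    (.seq layout (.seq copyAdj (.seq (algorithm k).code writeOut)))

/-- The largest number of machine steps behind one tick of the algorithm. It does not depend on `k`, which
enters the program only through constants, and a constant takes one step to evaluate. -/
def tickCost : ℕ := (algorithm 0).tick

theorem tick_algorithm (k : ℕ) : (algorithm k).tick = tickCost := rfl

theorem program_runs {n k w : ℕ} {H : SimpleGraph ℕ} {m : Memory} (hb : BullFree H) (he : EFree H)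
    (hn : 2 ≤ n) (hk : 0 < k) (hw : CliqueLE H (Finset.range n) w) (h0 : m.word 0 = n)
    (hadj : ∀ u < n, ∀ v < n, m.word (1 + (n * u + v)) = if H.Adj u v then 1 else 0)
    (hzero : ∀ a, n * n < a → m.word a = 0) (hval : ∀ p, 0 ≤ m.val p) :
    ∃ t m', t ≤ tickCost * ticks n k w + 1000 * n ^ 2 ∧ (program k).Runs m t m' ∧
      ∃ S ⊆ Finset.range (n * k), ConflictFree H k S ∧
        (∀ I ⊆ Finset.range (n * k), ConflictFree H k I → ∑ p ∈ I, m.val p ≤ ∑ p ∈ S, m.val p) ∧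
        ∃ out : ℕ → ℕ, ColorTable k S out ∧ ∀ v < n, m'.word v = out v := by
  have h1 : m.word 1 = 0 := by simpa using hadj 0 (by omega) 0 (by omega)
  have h2 : m.word (n + 2) = 0 := by
    have := hadj 1 (by omega) 1 (by omega)
    rw [if_neg (H.irrefl), show 1 + (n * 1 + 1) = n + 2 by ring] at this
    exact this
  obtain ⟨m₁, r1, g1, g2, g3, g4⟩ := layout_runs hn h0 h1 h2
  have hrep : Rep (n * n + 1) m₁ ⟨fun x => if x = .size then n else 0, fun _ _ => 0, m.val⟩ := by
    refine ⟨g1, by omega, fun x => ?_, fun j i => ?_, g4⟩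
    · by_cases hx : x = .size
      · subst hx; simpa [Var.code] using g2
      · have : x.code ≠ 0 := fun h => hx (Var.code_injective h)
        simp only [hx, if_false]
        rw [g3 _ (by omega) (by omega), hzero _ (by omega)]
    · have := j.code_pos
      show m₁.word _ = 0
      rw [g3 _ (by omega) (by omega), hzero _ (by omega)]
  obtain ⟨m₂, σ, r2, hrep₂, f1, f2, f3, -, f4⟩ := copyAdj_runs (n * n) 0 m₁ _ (by omega) hrep (by simp)
  have hinit : Initial n H σ := by
    refine ⟨by simp [f1], fun y h h' => by simp [f1 y h', h], fun u hu v hv => ?_,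
      fun j hj => by rw [f2 j hj], fun p => by rw [f3]; exact hval p⟩
    have hlt : n * u + v < n * n := by
      calc n * u + v < n * u + n := by omega
        _ = n * (u + 1) := by ring
        _ ≤ n * n := Nat.mul_le_mul_left _ hu
    rw [f4 _ (Nat.zero_le _) (by omega), g3 _ (by omega) (by omega), Nat.add_comm _ 1,
      hadj u hu v hv]
    simp
  obtain ⟨t₃, τ, ht₃, hex, hsz, S, hS, hCF, hopt, htab⟩ := Run.algorithm hb he hn hk hw hinit
  obtain ⟨t₃', m₃, ht₃', r3, hrep₃⟩ := hex.runs (tick_algorithm k).le hrep₂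
  have hnn : n < n * n + 1 := by nlinarith
  obtain ⟨m₄, t₄, ht₄, r4, hout⟩ := writeOut_runs (by omega) hnn hrep₃ hsz
  refine ⟨_, m₄, ?_, .iteFalse ?_ (r1.seq (r2.seq (r3.seq r4))), S, hS, hCF, ?_, τ.w .out, htab, hout⟩
  · have a1 : t₃' ≤ tickCost * ticks n k w := ht₃'.trans (Nat.mul_le_mul_left _ ht₃)
    have a2 : n * 2 ≤ n * n := Nat.mul_le_mul_left _ hn
    have a3 : n ^ 2 = n * n := by ring
    simp only [Test.cost, WordExpr.cost]
    rw [a3]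
    omega
  · simp only [Test.Holds, WordExpr.eval, h0]; omega
  · rw [f3] at hopt; exact hopt

end PartialColoringAlgorithm

namespace PartialColoringAlgorithm

open Classical

/-! ### Graphs and solutions in terms of numbers -/

/-- An adjacency-preserving map is an induced copy: without twins, injectivity is automatic. -/
theorem isIndContained_of_map {m : ℕ} {V : Type*} {B : SimpleGraph (Fin m)} {G : SimpleGraph V}
    (b : Fin m → Fin m → Bool) (hB : ∀ i j, B.Adj i j ↔ b i j = true)
    (hb : ∀ i j, (∀ l, b i l = b j l) → i = j) (f : Fin m → V)
    (hf : ∀ i j, G.Adj (f i) (f j) ↔ b i j = true) : B.IsIndContained G := by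
  refine ⟨⟨⟨f, fun i j hij => hb i j fun l => ?_⟩, fun {i j} => ?_⟩⟩
  · rw [Bool.eq_iff_iff, ← hf, ← hf, hij]
  · exact (hf i j).trans (hB i j).symm

variable {n : ℕ}

/-- The graph `G` on the vertices `0, …, n - 1`, with isolated vertices from `n` on. -/
def natGraph (G : SimpleGraph (Fin n)) : SimpleGraph ℕ := G.map Fin.valEmbedding

theorem natGraph_adj {G : SimpleGraph (Fin n)} {u v : Fin n} :
    (natGraph G).Adj u v ↔ G.Adj u v :=
  SimpleGraph.map_adj_apply (f := Fin.valEmbedding)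

theorem natGraph_lt {G : SimpleGraph (Fin n)} {u v : ℕ} (h : (natGraph G).Adj u v) : u < n := by
  obtain ⟨a, b, -, rfl, -⟩ := (SimpleGraph.map_adj _ _ _ _).mp h
  exact a.2

theorem bullFree_natGraph {G : SimpleGraph (Fin n)} (h : ¬ bullGraph.IsIndContained G) :
    BullFree (natGraph G) := by
  intro x y z a b hxy hyz hzx hxa hyb nxb nya nza nzb nab
  lift x to Fin n using natGraph_lt hxy
  lift z to Fin n using natGraph_lt hyz.symm
  lift y to Fin n using natGraph_lt hyz
  lift a to Fin n using natGraph_lt hxa.symm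
  lift b to Fin n using natGraph_lt hyb.symm
  rw [natGraph_adj] at *
  refine h (isIndContained_of_map (fun i j => (i, j) ∈ ([(0, 1), (1, 0), (1, 2), (2, 1), (0, 2), (2, 0),
    (0, 3), (3, 0), (1, 4), (4, 1)] : List (Fin 5 × Fin 5))) ?_ (by decide) ![x, y, z, a, b] ?_)
  · intro i j
    fin_cases i <;> fin_cases j <;> simp [bullGraph]
  · intro i j
    fin_cases i <;> fin_cases j <;> simp_all [G.adj_comm]

theorem eFree_natGraph {G : SimpleGraph (Fin n)} (h : ¬ graphE.IsIndContained G) :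
    EFree (natGraph G) := by
  intro o x a y b z hox hxa hoy hyb hoz noa nob nxy nxb nxz nay nab naz nyz nbz _
  lift o to Fin n using natGraph_lt hox
  lift x to Fin n using natGraph_lt hxa
  lift a to Fin n using natGraph_lt hxa.symm
  lift y to Fin n using natGraph_lt hyb
  lift b to Fin n using natGraph_lt hyb.symm
  lift z to Fin n using natGraph_lt hoz.symm
  rw [natGraph_adj] at *
  refine h (isIndContained_of_map (fun i j => (i, j) ∈ ([(0, 1), (1, 0), (1, 2), (2, 1), (2, 3), (3, 2),
    (3, 4), (4, 3), (2, 5), (5, 2)] : List (Fin 6 × Fin 6))) ?_ (by decide) ![a, x, o, y, b, z] ?_)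
  · intro i j
    fin_cases i <;> fin_cases j <;> simp [graphE]
  · intro i j
    fin_cases i <;> fin_cases j <;> simp_all [G.adj_comm]

theorem cliqueLE_natGraph (G : SimpleGraph (Fin n)) :
    CliqueLE (natGraph G) (Finset.range n) G.cliqueNum := by
  intro K hK hcl
  have hlt : ∀ m ∈ K, m < n := fun m hm => Finset.mem_range.mp (hK hm)
  have : G.IsClique (K.attachFin hlt : Set (Fin n)) := by
    intro u hu v hv huv
    rw [Finset.mem_coe, Finset.mem_attachFin] at hu hv
    exact natGraph_adj.mp (hcl u hu v hv fun h => huv (Fin.ext h))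
  have := this.card_le_cliqueNum
  rwa [Finset.card_attachFin] at this

section Solutions

variable {k : ℕ} {G : SimpleGraph (Fin n)}

/-- The color of a colored vertex. -/
def colorOf (T : PartialColoring G k) (v : {v // v ∈ T.X}) : Fin k := T.coloring ⟨v.1, v.2⟩

/-- The pairs of a solution: vertex `u` with color `i` is the number `k * u + i`. -/
def pairsOf (T : PartialColoring G k) : Finset ℕ :=
  T.X.attach.image fun v => k * (v.1 : ℕ) + (colorOf T v : ℕ)

theorem pair_div {u i : ℕ} (hi : i < k) : (k * u + i) / k = u := by
  rw [Nat.mul_add_div (by omega), Nat.div_eq_of_lt hi, Nat.add_zero]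

theorem pair_mod {u i : ℕ} (hi : i < k) : (k * u + i) % k = i := by
  rw [Nat.mul_add_mod, Nat.mod_eq_of_lt hi]

theorem pair_lt {u i : ℕ} (hu : u < n) (hi : i < k) : k * u + i < n * k := by
  calc k * u + i < k * u + k := by omega
    _ = (u + 1) * k := by ring
    _ ≤ n * k := Nat.mul_le_mul_right _ hu

theorem mem_pairsOf {T : PartialColoring G k} {p : ℕ} :
    p ∈ pairsOf T ↔ ∃ v, k * (v.1 : ℕ) + (colorOf T v : ℕ) = p := by
  simp [pairsOf]

theorem pairsOf_subset (T : PartialColoring G k) : pairsOf T ⊆ Finset.range (n * k) := by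
  intro p hp
  obtain ⟨v, rfl⟩ := mem_pairsOf.mp hp
  exact Finset.mem_range.mpr (pair_lt v.1.2 (colorOf T v).2)

theorem conflictFree_pairsOf (T : PartialColoring G k) :
    ConflictFree (natGraph G) k (pairsOf T) := by
  intro p hp q hq hpq
  obtain ⟨v, rfl⟩ := mem_pairsOf.mp hp
  obtain ⟨w, rfl⟩ := mem_pairsOf.mp hq
  simp only [Conflict, pair_div (colorOf T _).2, pair_mod (colorOf T _).2] at hpq
  rcases hpq with ⟨h, h'⟩ | ⟨h, h'⟩
  · obtain rfl : v = w := Subtype.ext (Fin.ext h)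
    exact h' rfl
  · rw [natGraph_adj] at h'
    exact T.coloring.valid (v := ⟨v.1, v.2⟩) (w := ⟨w.1, w.2⟩) (by simpa using h') (Fin.ext h)

theorem sum_pairsOf (T : PartialColoring G k) {rev : Fin n → Fin k → ℚ≥0} {wt : ℕ → ℚ}
    (hwt : ∀ u i, wt (k * (u : Fin n) + (i : Fin k)) = rev u i) :
    ∑ p ∈ pairsOf T, wt p = (T.revenue rev : ℚ) := by
  rw [pairsOf, Finset.sum_image, PartialColoring.revenue, NNRat.cast_sum]
  · exact Finset.sum_congr rfl fun v _ => hwt _ _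
  · intro v _ w _ h
    have := congrArg (· / k) h
    simp only [pair_div (colorOf T _).2] at this
    exact Subtype.ext (Fin.ext this)

/-- A set of pairs without conflicts is a solution. -/
theorem exists_pairsOf_eq {S : Finset ℕ} (hS : S ⊆ Finset.range (n * k))
    (hCF : ConflictFree (natGraph G) k S) : ∃ T : PartialColoring G k, pairsOf T = S := by
  have hk : ∀ p ∈ S, 0 < k := fun p hp => Nat.pos_of_ne_zero fun h => by
    have := Finset.mem_range.mp (hS hp)
    simp [h] at this
  let X : Finset (Fin n) := Finset.univ.filter fun v => ∃ p ∈ S, p / k = v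
  have hX : ∀ v : {v : Fin n | v ∈ X}, ∃ p ∈ S, p / k = v.1 := fun v =>
    (Finset.mem_filter.mp (show v.1 ∈ X from v.2)).2
  choose f hf hf' using hX
  let c : (G.induce {v | v ∈ X}).Coloring (Fin k) :=
    SimpleGraph.Coloring.mk (fun v => ⟨f v % k, Nat.mod_lt _ (hk _ (hf v))⟩) (by
      intro v w hvw h
      refine hCF (f v) (hf v) (f w) (hf w) (Or.inr ⟨congrArg Fin.val h, ?_⟩)
      rw [hf', hf', natGraph_adj]
      simpa using hvw)
  have hpair : ∀ v : {v : Fin n | v ∈ X}, k * (v.1 : ℕ) + f v % k = f v := fun v => by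
    rw [← hf' v, Nat.div_add_mod]
  refine ⟨⟨X, c⟩, ?_⟩
  ext p
  rw [mem_pairsOf]
  constructor
  · rintro ⟨v, rfl⟩
    have := hpair ⟨v.1, v.2⟩
    exact this.symm ▸ hf ⟨v.1, v.2⟩
  · intro hp
    have hlt : p / k < n := Nat.div_lt_of_lt_mul (by
      rw [Nat.mul_comm]; exact Finset.mem_range.mp (hS hp))
    have hv : (⟨p / k, hlt⟩ : Fin n) ∈ X := Finset.mem_filter.mpr ⟨Finset.mem_univ _, p, hp, rfl⟩
    refine ⟨⟨_, hv⟩, (hpair ⟨_, hv⟩).trans ?_⟩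
    by_contra hne
    exact hCF _ (hf ⟨_, hv⟩) p hp (Or.inl ⟨hf' ⟨_, hv⟩, hne⟩)

theorem ColorTable.eq_code {T : PartialColoring G k} {out : ℕ → ℕ}
    (h : ColorTable k (pairsOf T) out) (v : Fin n) : out v = T.code v := by
  unfold PartialColoring.code
  split_ifs with hv
  · have := h.1 _ (mem_pairsOf.mpr ⟨⟨v, hv⟩, rfl⟩)
    rw [pair_div (colorOf T _).2, pair_mod (colorOf T _).2] at this
    exact this
  · refine h.2 v fun p hp hpv => hv ?_
    obtain ⟨w, rfl⟩ := mem_pairsOf.mp hp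
    rw [pair_div (colorOf T _).2] at hpv
    rw [← Fin.ext hpv]
    exact w.2

end Solutions

end PartialColoringAlgorithm

namespace PartialColoringAlgorithm

open Classical

/-! ### The time bound and the input -/

/-- With `n ≥ 2`, constants and powers of `k` are absorbed into powers of `n`. -/
theorem ticks_le {n k w : ℕ} (hn : 2 ≤ n) (hk : 0 < k) :
    ticks n k w ≤ n ^ (4 * k + 17 +
      7 * (w * (5 * k * (Nat.log 2 n + 1) + 1) + (5 * k * (Nat.log 2 n + 1) + k) + 1)) := by
  set E := w * (5 * k * (Nat.log 2 n + 1) + 1) + (5 * k * (Nat.log 2 n + 1) + k) + 1 with hE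
  have hn0 : 0 < n := by omega
  have two : ∀ e, 2 ^ e ≤ n ^ e := fun e => Nat.pow_le_pow_left hn e
  have hkn : k ≤ n ^ k := Nat.lt_two_pow_self.le.trans (two k)
  have hN : n * k ≤ n ^ (k + 1) := by
    rw [pow_succ, Nat.mul_comm]; exact Nat.mul_le_mul_right _ hkn
  have hN' : n * k + n + 2 ≤ n ^ (k + 3) := by
    have h1 : n ≤ n * k := Nat.le_mul_of_pos_right _ hk
    have h2 : n ^ (k + 3) = n ^ (k + 1) * (n * n) := by ring
    have h3 : 4 ≤ n * n := Nat.mul_le_mul hn hn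
    have h4 : n ^ (k + 1) * 4 ≤ n ^ (k + 1) * (n * n) := Nat.mul_le_mul_left _ h3
    omega
  have hcube : (n * k + n + 2) ^ 3 ≤ n ^ (3 * k + 9) := by
    calc (n * k + n + 2) ^ 3 ≤ (n ^ (k + 3)) ^ 3 := Nat.pow_le_pow_left hN' 3
      _ = n ^ (3 * k + 9) := by rw [← pow_mul]; congr 1; ring
  have hcube' : (n * k + 1) ^ 3 ≤ n ^ (3 * k + 9) :=
    (Nat.pow_le_pow_left (by omega) 3).trans hcube
  have h20 : 20 ≤ n ^ 5 := le_trans (by norm_num) (two 5)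
  have h50 : 50 ≤ n ^ 6 := le_trans (by norm_num) (two 6)
  have h10 : 10 * (n * n * n) ≤ n ^ 7 := by
    have : 10 ≤ n ^ 4 := le_trans (by norm_num) (two 4)
    calc 10 * (n * n * n) ≤ n ^ 4 * (n * n * n) := Nat.mul_le_mul_right _ this
      _ = n ^ 7 := by ring
  have first : 20 * (n * k + n + 2) ^ 3 ≤ n ^ (4 * k + 16 + 7 * E) := by
    calc 20 * (n * k + n + 2) ^ 3 ≤ n ^ 5 * n ^ (3 * k + 9) := Nat.mul_le_mul h20 hcube
      _ = n ^ (3 * k + 14) := by rw [← pow_add]; congr 1; ring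
      _ ≤ _ := Nat.pow_le_pow_right hn0 (by omega)
  have second : n * k * (50 * (n * k + 1) ^ 3 * (10 * (n * n * n)) ^ E) ≤
      n ^ (4 * k + 16 + 7 * E) := by
    calc n * k * (50 * (n * k + 1) ^ 3 * (10 * (n * n * n)) ^ E)
        ≤ n ^ (k + 1) * (n ^ 6 * n ^ (3 * k + 9) * (n ^ 7) ^ E) :=
          Nat.mul_le_mul hN (Nat.mul_le_mul (Nat.mul_le_mul h50 hcube') (Nat.pow_le_pow_left h10 E))
      _ = n ^ (4 * k + 16 + 7 * E) := by
          rw [← pow_mul, ← pow_add, ← pow_add, ← pow_add]; congr 1; ring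
  calc ticks n k w ≤ n ^ (4 * k + 16 + 7 * E) + n ^ (4 * k + 16 + 7 * E) := Nat.add_le_add first second
    _ = 2 * n ^ (4 * k + 16 + 7 * E) := by ring
    _ ≤ n * n ^ (4 * k + 16 + 7 * E) := Nat.mul_le_mul_right _ hn
    _ = _ := by rw [← pow_succ']; congr 1; ring

theorem time_le {n k w : ℕ} (hn : 2 ≤ n) (hk : 0 < k) (hw : 0 < w) :
    tickCost * ticks n k w + 1000 * n ^ 2 ≤ n ^ ((tickCost + 300) * (k * w * Nat.log 2 n)) := by
  have hn0 : 0 < n := by omega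
  have hL : 0 < Nat.log 2 n := Nat.log_pos (by norm_num) hn
  set L := Nat.log 2 n with hLdef
  set E := w * (5 * k * (L + 1) + 1) + (5 * k * (L + 1) + k) + 1 with hE
  set x := k * w * L with hx
  have two : ∀ e, 2 ^ e ≤ n ^ e := fun e => Nat.pow_le_pow_left hn e
  have h1000 : 1000 * n ^ 2 ≤ n ^ 12 := by
    have : 1000 ≤ n ^ 10 := le_trans (by norm_num) (two 10)
    calc 1000 * n ^ 2 ≤ n ^ 10 * n ^ 2 := Nat.mul_le_mul_right _ this
      _ = n ^ 12 := by ring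
  have hE' : E ≤ 23 * x := by
    have e1 : w * k ≤ x := by rw [hx, Nat.mul_comm w]; exact Nat.le_mul_of_pos_right _ hL
    have e2 : w ≤ x := (Nat.le_mul_of_pos_right _ hk).trans e1
    have e3 : k ≤ x := (Nat.le_mul_of_pos_left _ hw).trans e1
    have e4 : k * L ≤ x := by
      rw [hx, Nat.mul_right_comm]; exact Nat.le_mul_of_pos_right _ hw
    have e5 : E = 5 * x + 5 * (w * k) + w + 5 * (k * L) + 6 * k + 1 := by rw [hE, hx]; ring
    omega
  have hkx : k ≤ x := (Nat.le_mul_of_pos_right _ hw).trans (Nat.le_mul_of_pos_right _ hL)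
  have hxpos : 0 < x := by omega
  have hmain : tickCost * ticks n k w ≤ n ^ (tickCost + (4 * k + 17 + 7 * E)) := by
    rw [pow_add]
    exact Nat.mul_le_mul (Nat.lt_two_pow_self.le.trans (two _)) (ticks_le hn hk)
  have hc : tickCost ≤ tickCost * x := Nat.le_mul_of_pos_right _ hxpos
  calc tickCost * ticks n k w + 1000 * n ^ 2
      ≤ n ^ (tickCost + (4 * k + 17 + 7 * E)) + n ^ (tickCost + (4 * k + 17 + 7 * E)) :=
        Nat.add_le_add hmain (h1000.trans (Nat.pow_le_pow_right hn0 (by omega)))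
    _ = 2 * n ^ (tickCost + (4 * k + 17 + 7 * E)) := by ring
    _ ≤ n * n ^ (tickCost + (4 * k + 17 + 7 * E)) := Nat.mul_le_mul_right _ hn
    _ = n ^ (tickCost + (4 * k + 17 + 7 * E) + 1) := by rw [← pow_succ']
    _ ≤ _ := Nat.pow_le_pow_right hn0 (by rw [Nat.add_mul]; omega)

section Input

variable {n k : ℕ} {G : SimpleGraph (Fin n)} {rev : Fin n → Fin k → ℚ≥0}

theorem inputMemory_adj {u v : ℕ} (hu : u < n) (hv : v < n) :
    (inputMemory G rev).word (1 + (n * u + v)) = if (natGraph G).Adj u v then 1 else 0 := by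
  have hlt : n * u + v < n * n := pair_lt hu hv
  have e : finProdFinEquiv.symm (⟨n * u + v, hlt⟩ : Fin (n * n)) = (⟨u, hu⟩, ⟨v, hv⟩) := by
    rw [Equiv.symm_apply_eq]
    exact Fin.ext (Nat.add_comm _ _)
  rw [Nat.add_comm 1]
  simp only [inputMemory, dif_pos hlt, e]
  rw [← natGraph_adj]

theorem inputMemory_zero {a : ℕ} (ha : n * n < a) : (inputMemory G rev).word a = 0 := by
  obtain ⟨b, rfl⟩ : ∃ b, a = b + 1 := ⟨a - 1, by omega⟩
  simp only [inputMemory]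
  rw [dif_neg (by omega)]

theorem inputMemory_val (u : Fin n) (i : Fin k) :
    (inputMemory G rev).val (k * u + i) = rev u i := by
  have hlt : k * (u : ℕ) + i < n * k := pair_lt u.2 i.2
  have e : finProdFinEquiv.symm (⟨k * u + i, hlt⟩ : Fin (n * k)) = (u, i) := by
    rw [Equiv.symm_apply_eq]
    exact Fin.ext (Nat.add_comm _ _)
  simp only [inputMemory, dif_pos hlt, e]

theorem inputMemory_val_nonneg (p : ℕ) : 0 ≤ (inputMemory G rev).val p := by
  simp only [inputMemory]
  split_ifs
  · exact NNRat.cast_nonneg _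
  · exact le_rfl

theorem isOptimal_of_pairs {T : PartialColoring G k}
    (h : ∀ I ⊆ Finset.range (n * k), ConflictFree (natGraph G) k I →
      ∑ p ∈ I, (inputMemory G rev).val p ≤ ∑ p ∈ pairsOf T, (inputMemory G rev).val p) :
    T.IsOptimal rev := by
  intro T'
  have := h _ (pairsOf_subset T') (conflictFree_pairsOf T')
  rw [sum_pairsOf T' inputMemory_val, sum_pairsOf T inputMemory_val] at this
  exact_mod_cast this

/-- With at most one vertex, a solution is at most one pair. -/
theorem exists_optimal_small (hn : n ≤ 1) {b : ℕ} (hb : b < k)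
    (hmax : ∀ i < k, (inputMemory G rev).val i ≤ (inputMemory G rev).val b) :
    ∃ T : PartialColoring G k, T.IsOptimal rev ∧ ∀ v : Fin n, T.code v = b + 1 := by
  rcases Nat.le_one_iff_eq_zero_or_eq_one.mp hn with rfl | rfl
  · obtain ⟨T, hT⟩ := exists_pairsOf_eq (G := G) (k := k) (S := ∅) (by simp)
      (by intro p hp; simp at hp)
    refine ⟨T, isOptimal_of_pairs fun I hI _ => ?_, fun v => v.elim0⟩
    obtain rfl : I = ∅ := by simpa using hI
    rw [hT]
  · obtain ⟨T, hT⟩ := exists_pairsOf_eq (G := G) (k := k) (S := {b}) (by simpa using hb)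
      conflictFree_singleton
    refine ⟨T, isOptimal_of_pairs fun I hI hCF => ?_, fun v => ?_⟩
    · rw [hT, Finset.sum_singleton]
      rw [Nat.one_mul] at hI
      have hdiv : ∀ p ∈ I, p / k = 0 := fun p hp =>
        Nat.div_eq_of_lt (Finset.mem_range.mp (hI hp))
      rcases I.eq_empty_or_nonempty with rfl | ⟨q, hq⟩
      · exact inputMemory_val_nonneg b
      · obtain rfl : I = {q} := Finset.eq_singleton_iff_unique_mem.mpr ⟨hq, fun p hp => by
          by_contra hpq
          exact hCF p hp q hq (Or.inl ⟨(hdiv p hp).trans (hdiv q hq).symm, hpq⟩)⟩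
        rw [Finset.sum_singleton]
        exact hmax q (Finset.mem_range.mp (hI hq))
    · have htab : ColorTable k (pairsOf T) fun u => if u = 0 then b + 1 else 0 := by
        rw [hT]
        refine ⟨fun p hp => ?_, fun u hu => ?_⟩
        · obtain rfl := Finset.mem_singleton.mp hp
          simp [Nat.div_eq_of_lt hb, Nat.mod_eq_of_lt hb]
        · have := hu b (Finset.mem_singleton_self b)
          rw [Nat.div_eq_of_lt hb] at this
          exact if_neg (Ne.symm this)
      rw [← htab.eq_code v, if_pos (by omega)]

end Input

end PartialColoringAlgorithm

open PartialColoringAlgorithm in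
theorem theorem2 :
    ∃ c : ℕ, ∀ k : ℕ, 1 ≤ k → ∃ P : RAM.Program,
      ∀ (n : ℕ) (G : SimpleGraph (Fin n)) (rev : Fin n → Fin k → ℚ≥0),
        ¬ bullGraph.IsIndContained G → ¬ graphE.IsIndContained G →
          ∃ (t : ℕ) (m : RAM.Memory) (S : PartialColoring G k),
            P.Runs (inputMemory G rev) t m ∧
            (∀ v : Fin n, m.word v = S.code v) ∧
            S.IsOptimal rev ∧
            (2 ≤ n →
              (t : ℝ) ≤ (n : ℝ) ^ ((c : ℝ) * k * G.cliqueNum * Real.logb 2 n)) ∧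
            (n ≤ 1 → t ≤ c * k) := by
  refine ⟨tickCost + 300, fun k hk => ⟨program k, fun n G rev hbull hE => ?_⟩⟩
  rcases Nat.lt_or_ge n 2 with hn | hn
  · obtain ⟨t, m, ht, hr, -, b, hb, hw, hmax⟩ := bestColor_runs (inputMemory G rev) (k - 1)
    obtain ⟨T, hT, hcode⟩ := exists_optimal_small (G := G) (rev := rev) (b := b) (by omega)
      (by omega : b < k) fun i hi => hmax i (by omega)
    refine ⟨_, m, T, .iteTrue ?_ hr, fun v => ?_, hT, fun h => by omega, fun _ => ?_⟩
    · exact hn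
    · rw [hcode, ← hw]
      congr 1
      omega
    · have h1 : (300 : ℕ) * k ≤ (tickCost + 300) * k := Nat.mul_le_mul_right _ (by omega)
      simp only [RAM.Test.cost, RAM.WordExpr.cost]
      omega
  · obtain ⟨t, m, ht, hr, S, hS, hCF, hopt, out, htab, hout⟩ := program_runs (k := k)
      (bullFree_natGraph hbull) (eFree_natGraph hE) hn hk (cliqueLE_natGraph G)
      (m := inputMemory G rev) rfl (fun u hu v hv => inputMemory_adj hu hv)
      (fun a ha => inputMemory_zero ha) inputMemory_val_nonneg
    obtain ⟨T, rfl⟩ := exists_pairsOf_eq hS hCF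
    refine ⟨t, m, T, hr, fun v => (hout v v.2).trans (htab.eq_code v), isOptimal_of_pairs hopt,
      fun _ => ?_, fun h => by omega⟩
    have hω : 0 < G.cliqueNum :=
      (cliqueLE_natGraph G).pos ⟨0, Finset.mem_range.mpr (by omega)⟩
    have h1 : (t : ℝ) ≤ (n : ℝ) ^ ((tickCost + 300) * (k * G.cliqueNum * Nat.log 2 n)) := by
      exact_mod_cast ht.trans (time_le hn hk hω)
    refine h1.trans ?_
    rw [← Real.rpow_natCast]
    refine Real.rpow_le_rpow_of_exponent_le (by exact_mod_cast (by omega : 1 ≤ n)) ?_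
    have h2 := Real.natLog_le_logb n 2
    push_cast at h2 ⊢
    have e : ((tickCost : ℝ) + 300) * (k * G.cliqueNum * Nat.log 2 n) =
      ((tickCost : ℝ) + 300) * k * G.cliqueNum * Nat.log 2 n := by ring
    rw [e]
    exact mul_le_mul_of_nonneg_left h2 (by positivity)
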